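/- **Setting.** Let $\gamma\ge 1$, $0<v_+<1$, $a=v_+^\gamma\frac{1-v_+}{1-v_+^\gamma}$, $H(v)=v\,(v-1+a(v^{-\gamma}-1))$ and $f(v)=2v-a(\gamma-1)v^{-\gamma}-(a+1)$. A compressive boundary layer is a solution $\hat v$ of $\hat v'=H(\hat v)$ with $\hat v(0)=v_0$, on $x\ge 0$ with $\hat v(+\infty)=v_+\le v_0<1$ (inflow), or on $x\le 0$ with $\hat v(-\infty)=1$ and $v_+<v_0<1$ (outflow). Put $$A(x,\lambda)=\begin{pmatrix}0&\lambda&\lambda\\0&0&\lambda\\ \hat v&\hat v&f(\hat v)-\lambda\end{pmatrix},\qquad A_\pm(\lambda)=\lim_{x\to\pm\infty}A(x,\lambda),\qquad W\cdot\widetilde W=\sum_i W_i\overline{\widetilde W_i}.$$ * *Inflow.* For $\Re\lambda\ge0$, $\lambda\ne0$, let $\tilde\mu(\lambda)$ be the eigenvalue of $-A_+(\lambda)^*$ with negative real part, with eigenvector $\widetilde V(\lambda)$, where $\overline{\widetilde V}$ is analytic and nonvanishing on $\{\Re\lambda\ge0\}$ (including $\lambda=0$), and let $\widetilde W_1^+$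 solve $\widetilde W'=-A^*\widetilde W$ on $x\ge0$ with $e^{-\tilde\mu x}\widetilde W_1^+\to\widetilde V$ as $x\to+\infty$. Then $D_{\rm in}(\lambda)=(1,0,0)^T\cdot\widetilde W_1^+|_{x=0}$, extended analytically to $\lambda=0$. * *Outflow.* For $\Re\lambda\ge0$ let $\mu(\lambda)$ be the eigenvalue of $A_-(\lambda)$ with positive real part, with analytic nonvanishing eigenvector $V(\lambda)$, and let $W_1^-$ solve $W'=AW$ on $x\le0$ with $e^{-\mu x}W_1^-\to V$ as $x\to-\infty$. Then $D_{\rm out}(\lambda)=W_1^-|_{x=0}\cdot\big(0,-1,-\tfrac{\bar\lambda}{\bar\lambda-\hat v'(0)}\big)^T$. * *Limiting functions ($v_+=0$).* For $0<v_0<1$ let $\hat v^0(x)=\frac12\big(1-\tanh\frac{x-\delta}2\big)$ with $\hat v^0(0)=v_0$, $f^0(v)=2v-1$, and let $A^0$ be $A$ with $\hat v^0,f^0$ in place of $\hat v,f$. $D^0_{\rm out}$ is defined as $D_{\rm out}$ with $\hat v^0,f^0$. $D^0_{\rm in}(\lambda)=(1,0,0)^T\cdot\widetilde W_1^{0+}|_{x=0}$,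 where $\widetilde W_1^{0+}$ solves $\widetilde W'=-(A^0)^*\widetilde W$ on $x\ge0$ and tends to $(0,-1,\bar\lambda/\bar\mu)^T$, $\mu=-1-\lambda$, as $x\to+\infty$. "Analytic on $\{\Re\lambda\ge0\}$" means analytic at each of its points, i.e. on a neighborhood. An *unstable root* is a root with $\Re\lambda\ge 0$; roots are counted with multiplicity. **Lemma (Stability index).** The Evans functions $D_{\rm in}$, $D_{\rm out}$, $D^0_{\rm in}$, $D^0_{\rm out}$ exist and are analytic on $\{\Re\lambda\ge0\}$. For all $\gamma\ge1$ and all $v_0,v_+$ as above, and for every admissible choice of the eigenvectors $\widetilde V$, $V$: 1. $D_{\rm in}(0)\ne0$, and $D_{\rm in}$ has a finite, even number of unstable roots. 2. $D^0_{\rm in}(0)=0$, and for every $\lambda$ with $\Re\lambda\ge0$, $D^0_{\rm in}(\lambda)\to0$ as $v_0\to0^+$. 3. $(D^0_{\rm in})'(0)\ne0$, and $D^0_{\rm in}$ has a finite, even number of nonzero unstable roots. 4. $D_{\rm out}'(0)\ne0$, and $D_{\rm out}$ has a finite, even number of nonzero unstable roots. When the mode is normalized so that $W_1^-|_{\lambda=0}=(0,0,\hat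 v')^T$, which is possible, $D_{\rm out}'(0)=2-v_0$. 5. $(D^0_{\rm out})'(0)\ne0$, and $D^0_{\rm out}$ has a finite, even number of nonzero unstable roots. -/

import Mathlib

open Filter Topology Set

noncomputable section

namespace BoundaryLayer

/-! ### Profiles -/

/-- The Rankine–Hugoniot constant `a = v₊^γ (1 - v₊) / (1 - v₊^γ)`. -/
def pressureConst (γ vp : ℝ) : ℝ := vp ^ γ * (1 - vp) / (1 - vp ^ γ)

/-- The right-hand side `H(v) = v (v - 1 + a (v^{-γ} - 1))` of the profile equation. -/
def profileRHS (γ vp v : ℝ) : ℝ :=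
  v * (v - 1 + pressureConst γ vp * (v ^ (-γ) - 1))

/-- The coefficient `f(v) = 2v - a (γ - 1) v^{-γ} - (a + 1)`. -/
def fCoeff (γ vp v : ℝ) : ℝ :=
  2 * v - pressureConst γ vp * (γ - 1) * v ^ (-γ) - (pressureConst γ vp + 1)

/-- `v` is (the restriction to `x ≥ 0` of) an inflow boundary-layer profile with `v(0) = v₀`
and `v(+∞) = v₊`. -/
structure IsInflowProfile (γ vp v0 : ℝ) (v : ℝ → ℝ) : Prop where
  init : v 0 = v0
  ode : ∀ x ∈ Ici (0 : ℝ), HasDerivWithinAt v (profileRHS γ vp (v x)) (Ici 0) x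
  limit : Tendsto v atTop (𝓝 vp)

/-- `v` is (the restriction to `x ≤ 0` of) an outflow boundary-layer profile with `v(0) = v₀`
and `v(-∞) = v₋ = 1`. -/
structure IsOutflowProfile (γ vp v0 : ℝ) (v : ℝ → ℝ) : Prop where
  init : v 0 = v0
  ode : ∀ x ∈ Iic (0 : ℝ), HasDerivWithinAt v (profileRHS γ vp (v x)) (Iic 0) x
  limit : Tendsto v atBot (𝓝 1)

/-- The explicit solution `(1 - tanh ((x - δ)/2))/2` of the limiting profile equation
`v' = v (v - 1)`, with `δ = log (v₀ / (1 - v₀))`, so that its value at `0` is `v₀`. -/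
def limitProfile (v0 x : ℝ) : ℝ :=
  (1 - Real.tanh ((x - Real.log (v0 / (1 - v0))) / 2)) / 2

/-- The limiting coefficient `f⁰(v) = 2v - 1`. -/
def fCoeffLimit (v : ℝ) : ℝ := 2 * v - 1

/-! ### The eigenvalue system -/

/-- The coefficient matrix of the eigenvalue system `W' = A W`, `W = (w, u - v, v)`, at a point
where the profile has the value `v` and the coefficient `f` has the value `f`; the spectral
parameter is `z`. -/
def coeffMatrix (v f : ℝ) (z : ℂ) : Matrix (Fin 3) (Fin 3) ℂ :=
  !![0, z, z; 0, 0, z; (v : ℂ), (v : ℂ), (f : ℂ) - z]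

/-- The closed right half-plane of nonstable spectral parameters. -/
def nonstable : Set ℂ := {z | 0 ≤ z.re}

/-- `W` solves on `x ≥ 0` the adjoint eigenvalue system `W' = -A(x,z)^* W` for the profile `v` and
the coefficient function `f`. -/
def SolvesAdjoint (v f : ℝ → ℝ) (z : ℂ) (W : ℝ → Fin 3 → ℂ) : Prop :=
  ∀ x ∈ Ici (0 : ℝ), HasDerivWithinAt W
    (-((coeffMatrix (v x) (f (v x)) z).conjTranspose.mulVec (W x))) (Ici 0) x

/-- `W` solves on `x ≤ 0` the eigenvalue system `W' = A(x,z) W` for the profile `v` and the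
coefficient function `f`. -/
def SolvesEigen (v f : ℝ → ℝ) (z : ℂ) (W : ℝ → Fin 3 → ℂ) : Prop :=
  ∀ x ∈ Iic (0 : ℝ), HasDerivWithinAt W
    ((coeffMatrix (v x) (f (v x)) z).mulVec (W x)) (Iic 0) x

/-- The (Hermitian) product `W · W̃` of a solution and an adjoint solution. -/
def pairing (W W' : Fin 3 → ℂ) : ℂ := W ⬝ᵥ star W'

/-! ### Evans functions -/

/-- `D` is an inflow Evans function `D_in(z) = (W₁⁰ · W̃₁⁺)|_{x=0}`, with `W₁⁰(0) = (1,0,0)`.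
For `Re z ≥ 0`, `z ≠ 0`, `W̃₁⁺` is the solution of the adjoint system that decays at `+∞`,
asymptotic to `e^{μ(z) x} V(z)`, where `μ(z)` is the eigenvalue of negative real part of
`-A₊(z)^*` and `V(z)` is an associated nonvanishing eigenvector whose conjugate depends
analytically on `z`, up to `z = 0`; the value of `D` at `0` is that of the analytic extension. -/
def IsInflowEvans (γ vp : ℝ) (v : ℝ → ℝ) (D : ℂ → ℂ) : Prop :=
  AnalyticOnNhd ℂ D nonstable ∧
  ∃ (μ : ℂ → ℂ) (V : ℂ → Fin 3 → ℂ) (W : ℂ → ℝ → Fin 3 → ℂ),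
    AnalyticOnNhd ℂ (fun z => star (V z)) nonstable ∧
    (∀ z ∈ nonstable, V z ≠ 0) ∧
    ∀ z ∈ nonstable, z ≠ 0 →
      (μ z).re < 0 ∧
      -((coeffMatrix vp (fCoeff γ vp vp) z).conjTranspose.mulVec (V z)) = μ z • V z ∧
      SolvesAdjoint v (fCoeff γ vp) z (W z) ∧
      Tendsto (fun x : ℝ => Complex.exp (-(μ z * x)) • W z x) atTop (𝓝 (V z)) ∧
      D z = pairing ![1, 0, 0] (W z 0)

/-- `D` is the limiting inflow Evans function `D⁰_in(z) = (W₁⁰⁰ · W̃₁⁰⁺)|_{x=0}` with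
`W₁⁰⁰(0) = (1,0,0)`, where `W̃₁⁰⁺` is the solution of the limiting adjoint system that tends at
`+∞` to `(0, -1, conj (z/μ))`, `μ = -1 - z`. -/
def IsLimitInflowEvans (v0 : ℝ) (D : ℂ → ℂ) : Prop :=
  AnalyticOnNhd ℂ D nonstable ∧
  ∃ W : ℂ → ℝ → Fin 3 → ℂ,
    ∀ z ∈ nonstable,
      SolvesAdjoint (limitProfile v0) fCoeffLimit z (W z) ∧
      Tendsto (W z) atTop (𝓝 ![0, -1, star (z / (-1 - z))]) ∧
      D z = pairing ![1, 0, 0] (W z 0)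

/-- `W` is a choice of the mode `W₁⁻` at `-∞`, for the profile `v` (with `v(-∞) = 1`) and the
coefficient function `f`: for `Re z ≥ 0`, `W z` is the solution of the eigenvalue system that
decays at `-∞`, asymptotic to `e^{μ(z) x} V(z)`, where `μ(z)` is the eigenvalue of positive real
part of `A₋(z)` and `V(z)` is an associated nonvanishing analytic eigenvector. -/
def IsOutflowMode (v f : ℝ → ℝ) (W : ℂ → ℝ → Fin 3 → ℂ) : Prop :=
  ∃ (μ : ℂ → ℂ) (V : ℂ → Fin 3 → ℂ),
    AnalyticOnNhd ℂ V nonstable ∧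
    ∀ z ∈ nonstable,
      V z ≠ 0 ∧
      0 < (μ z).re ∧
      (coeffMatrix 1 (f 1) z).mulVec (V z) = μ z • V z ∧
      SolvesEigen v f z (W z) ∧
      Tendsto (fun x : ℝ => Complex.exp (-(μ z * x)) • W z x) atBot (𝓝 (V z))

/-- `D` is the outflow Evans function `D_out(z) = (W₁⁻ · W̃₁⁰)|_{x=0}` built on the mode `W = W₁⁻`,
where `W̃₁⁰(0) = (0, -1, -z̄/(z̄ - s))` and `s = v'(0)` is the slope of the profile at the
boundary. The limiting function `D⁰_out` is obtained from the limiting `v`, `f` and `s`. -/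
def IsOutflowEvans (v f : ℝ → ℝ) (s : ℝ) (W : ℂ → ℝ → Fin 3 → ℂ) (D : ℂ → ℂ) : Prop :=
  AnalyticOnNhd ℂ D nonstable ∧
  IsOutflowMode v f W ∧
  ∀ z ∈ nonstable, D z = pairing (W z 0) ![0, -1, -(star z / (star z - (s : ℂ)))]

/-! ### Counting roots -/

/-- `D` has finitely many roots in `S`, and their number, counted with multiplicity, is even. -/
def EvenRootCount (D : ℂ → ℂ) (S : Set ℂ) : Prop :=
  {z | z ∈ S ∧ D z = 0}.Finite ∧
  Even (∑ᶠ z ∈ {z | z ∈ S ∧ D z = 0}, analyticOrderNatAt D z)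

end BoundaryLayer

end

open Filter Topology Set

set_option linter.unusedSectionVars false

/-! All four Evans functions have the same structure. Away from `0` each one is an explicit analytic
factor, without zeros there, times a function `g` read off at the boundary from one distinguished
solution (the mode) of a linear system on a half-line. This `g` is analytic on the closed right
half-plane, commutes with complex conjugation, and does not vanish at `0`. Nonreal zeros of `g` come
in conjugate pairs. If moreover `g` has no zero with `|z| ≥ b`, and `g 0` and `g b` have the same
sign, then the real zeros in `(0, b)` also have even total multiplicity (`evenRootCount_of_sign`).
Three things are therefore needed: analyticity of the mode up to and across the imaginary axis, the
value of `g` at `0`, and nonvanishing with a known sign for large `|z|`.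

Analyticity. Write `h = v - f`. The eigenvalues of the limiting matrix satisfy `r² (r + z + h) = v
(r + z)²`. Putting `T² = z + r + h` makes this a difference of squares, so `z` and `r` become
rational functions of `T`; inverting `z = specParam T` by a contraction gives an analytic branch on
a strip beyond the axis (`exists_isBranch`). Bernoulli's inequality shows that `h` differs from `v`
at the relevant end states, which is what leaves room for the strip. With the exponent shifted to
zero, the mode is a solution converging to a stationary vector of a system with exponentially
decaying perturbation and no eigenvalue of negative real part. It is produced by a weighted Volterra
fixed point that is analytic in `z`, and it is unique among all solutions with the same limit
(`exists_local_solution`, `exists_analytic_solution`, `IsSol.eq_zero_of_tendsto`). Uniqueness also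
gives conjugation symmetry and independence of the choice of eigenvectors. In the limiting inflow
problem the limiting matrix is simpler, and the scaled mode tends directly to an explicit stationary
vector.

The value at `0`. At `z = 0` every mode is explicit: constant for inflow, an elementary function of
the profile for limiting inflow (`limitMode_zero`), and a multiple of the derivative of the profile
for outflow (`IsOutflowLayerMode.exists_eq_at_zero`).

Large `|z|`. A quadratic form in suitable variables, rotated by a factor `η` for which `Re (η z) ≥
|z|`, is monotone along the mode and tends to `0` at infinity, so it has a strict sign on the whole
half-line (`InflowSystem.re_neg`, `OutflowSystem.key`). The sign excludes zeros of `g`. For real `z`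
it also excludes zeros of a real quantity at every point of the half-line, so that its sign at
infinity carries over to the boundary and determines the sign of `g b`.

The limit `v₀ → 0` is a translation argument: changing `v₀` shifts the limiting profile, so the
boundary recedes to `+∞` along one fixed mode whose first component tends to `0`. -/

noncomputable section

namespace BoundaryLayer

/-! ### The flow of a constant-coefficient linear system -/

section Flow

variable {F : Type*} [NormedAddCommGroup F] [NormedSpace ℂ F] [CompleteSpace F]

/-- The flow `exp (t M)` of the linear system `z' = M z`. -/
def flow (M : F →L[ℂ] F) (t : ℝ) : F →L[ℂ] F := NormedSpace.exp (t • M)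

theorem hasDerivAt_flow (M : F →L[ℂ] F) (t : ℝ) : HasDerivAt (flow M) (flow M t * M) t :=
  hasDerivAt_exp_smul_const M t

theorem hasDerivAt_flow' (M : F →L[ℂ] F) (t : ℝ) : HasDerivAt (flow M) (M * flow M t) t :=
  hasDerivAt_exp_smul_const' M t

theorem continuous_flow (M : F →L[ℂ] F) : Continuous (flow M) :=
  continuous_iff_continuousAt.2 fun t => (hasDerivAt_flow M t).continuousAt

theorem flow_add (M : F →L[ℂ] F) (s t : ℝ) : flow M (s + t) = flow M s * flow M t := by
  let _ : NormedAlgebra ℚ (F →L[ℂ] F) := NormedAlgebra.restrictScalars ℚ ℂ _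
  unfold flow
  rw [add_smul]
  exact NormedSpace.exp_add_of_commute ((Commute.refl M).smul_left s |>.smul_right t)

@[simp] theorem flow_zero (M : F →L[ℂ] F) : flow M 0 = 1 := by
  simp [flow]

theorem flow_neg_mul (M : F →L[ℂ] F) (t : ℝ) : flow M (-t) * flow M t = 1 := by
  rw [← flow_add]; simp

theorem flow_mul_neg (M : F →L[ℂ] F) (t : ℝ) : flow M t * flow M (-t) = 1 := by
  rw [← flow_add]; simp

theorem flow_commute (M : F →L[ℂ] F) (t : ℝ) : flow M t * M = M * flow M t :=
  (hasDerivAt_flow M t).unique (hasDerivAt_flow' M t)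

theorem hasDerivAt_flow_neg (M : F →L[ℂ] F) (t : ℝ) :
    HasDerivAt (fun t => flow M (-t)) (-(flow M (-t) * M)) t := by
  have h := (hasDerivAt_flow M (-t)).scomp t (hasDerivAt_neg t)
  rw [neg_one_smul] at h
  exact h

theorem hasDerivWithinAt_clm_apply {a : ℝ → F →L[ℂ] F} {a' : F →L[ℂ] F} {z : ℝ → F} {z' : F}
    {s : Set ℝ} {x : ℝ} (ha : HasDerivWithinAt a a' s x) (hz : HasDerivWithinAt z z' s x) :
    HasDerivWithinAt (fun t => a t (z t)) (a' (z x) + a x z') s x :=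
  HasDerivWithinAt.clm_apply
    ((ContinuousLinearMap.restrictScalarsL ℂ F F ℝ ℝ).hasFDerivAt.comp_hasDerivWithinAt x ha) hz

theorem flow_eigenvector {M : F →L[ℂ] F} {r : ℂ} {w : F} (h : M w = r • w) (t : ℝ) :
    flow M t w = Complex.exp (r * t) • w := by
  have key : ∀ s : ℝ, HasDerivAt (fun s : ℝ => Complex.exp (-(r * s)) • flow M s w) 0 s := by
    intro s
    have h1 : HasDerivAt (fun s : ℝ => flow M s w) (flow M s (M w)) s := by
      simpa [hasDerivWithinAt_univ] using hasDerivWithinAt_clm_apply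
        (hasDerivAt_flow M s).hasDerivWithinAt (hasDerivWithinAt_const s univ w)
    have h2 : HasDerivAt (fun s : ℝ => Complex.exp (-(r * s)))
        (Complex.exp (-(r * s)) * -(r * 1)) s :=
      ((Complex.ofRealCLM.hasDerivAt (x := s)).const_mul r).neg.cexp
    have h3 := h2.smul h1
    refine h3.congr_deriv ?_
    rw [h, map_smul, smul_smul, ← add_smul]
    simp
  have hc := is_const_of_deriv_eq_zero (fun s => (key s).differentiableAt)
    (fun s => (key s).deriv) t 0
  simp only [Complex.ofReal_zero, mul_zero, neg_zero, Complex.exp_zero, one_smul, flow_zero,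
    one_apply_eq_self] at hc
  nth_rewrite 2 [← hc]
  rw [smul_smul, ← Complex.exp_add]
  simp

end Flow

/-! ### Spectrum in the closed right half-plane and the backward flow -/

section FlowBounds

variable {F : Type*} [NormedAddCommGroup F] [NormedSpace ℂ F] [FiniteDimensional ℂ F]

theorem exists_eigenvector_mem (M : F →L[ℂ] F) (S : Submodule ℂ F) (hS : S ≠ ⊥)
    (hM : ∀ x ∈ S, M x ∈ S) : ∃ r : ℂ, ∃ w ∈ S, w ≠ 0 ∧ M w = r • w := by
  have : Nontrivial S := (Submodule.nontrivial_iff_ne_bot).2 hS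
  obtain ⟨r, hr⟩ := Module.End.exists_eigenvalue ((M : F →ₗ[ℂ] F).restrict hM)
  obtain ⟨w, hw⟩ := hr.exists_hasEigenvector
  refine ⟨r, w, w.2, fun h => hw.2 (Subtype.ext h), ?_⟩
  simpa using congrArg Subtype.val hw.apply_eq_smul

/-- All eigenvalues of `M` have nonnegative real part. -/
def NonnegSpectrum (M : F →L[ℂ] F) : Prop := ∀ (r : ℂ) (w : F), w ≠ 0 → M w = r • w → 0 ≤ r.re

variable [CompleteSpace F]

/-- The vectors whose forward orbit decays form an `M`-invariant subspace. If it were nonzero it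
would contain an eigenvector, but an eigenvector's orbit is multiplied by `exp (r t)`, of modulus at
least `1`. -/
theorem NonnegSpectrum.eq_zero_of_tendsto {M : F →L[ℂ] F} (hM : NonnegSpectrum M) {y : F}
    (hy : Tendsto (fun t => flow M t y) atTop (𝓝 0)) : y = 0 := by
  let S : Submodule ℂ F :=
    { carrier := {y | Tendsto (fun t => flow M t y) atTop (𝓝 0)}
      add_mem' := fun {a b} ha hb => by simpa using ha.add hb
      zero_mem' := by simp
      smul_mem' := fun c a ha => by simpa using ha.const_smul c }
  by_contra hne
  have hS : S ≠ ⊥ := fun h => hne (by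
    have : y ∈ S := hy
    rwa [h, Submodule.mem_bot] at this)
  obtain ⟨r, w, hwS, hw, hr⟩ := exists_eigenvector_mem M S hS (by
    intro x hx
    have h1 : Tendsto (fun t => M (flow M t x)) atTop (𝓝 (M 0)) :=
      (M.continuous.tendsto 0).comp hx
    rw [map_zero] at h1
    refine h1.congr fun t => ?_
    rw [← mul_apply_eq_comp, ← flow_commute]; rfl)
  have hre := hM r w hw hr
  have h1 : Tendsto (fun t => ‖flow M t w‖) atTop (𝓝 0) := by
    simpa using (show Tendsto (fun t => flow M t w) atTop (𝓝 0) from hwS).norm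
  have h2 : ∀ᶠ t in atTop, ‖flow M t w‖ < ‖w‖ :=
    h1.eventually_lt_const (norm_pos_iff.2 hw)
  obtain ⟨t, ht, ht0⟩ := (h2.and (eventually_ge_atTop 0)).exists
  rw [flow_eigenvector hr, norm_smul, Complex.norm_exp] at ht
  have : (1 : ℝ) ≤ Real.exp (r * t).re := by
    rw [Real.one_le_exp_iff]; simpa using mul_nonneg hre ht0
  nlinarith [norm_nonneg w]

/-- The spectrum of `exp (-M)` lies in the closed unit disc, so Gelfand's formula makes `‖exp (-n
M)‖` at most `e^{ε n}` for some `n`; powers and a compact remainder do the rest. Jordan blocks over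
the imaginary axis are the reason for allowing the loss `ε`. -/
theorem NonnegSpectrum.exists_flow_bound {M : F →L[ℂ] F} (hM : NonnegSpectrum M) {ε : ℝ}
    (hε : 0 < ε) : ∃ C : ℝ, 1 ≤ C ∧ ∀ τ : ℝ, 0 ≤ τ → ‖flow M (-τ)‖ ≤ C * Real.exp (ε * τ) := by
  have hspec : spectralRadius ℂ (flow M (-1)) ≤ 1 := by
    -- The kernel of `k - exp (-M)` is `M`-invariant, hence contains an eigenvector of `M` with some
    -- eigenvalue `r`; then `k = exp (-r)` has modulus at most `1`.
    refine iSup₂_le fun k hk => ?_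
    have hinj : LinearMap.ker ((algebraMap ℂ (F →L[ℂ] F) k - flow M (-1) : F →L[ℂ] F) :
        F →ₗ[ℂ] F) ≠ ⊥ := by
      intro h
      apply hk
      rw [spectrum.mem_resolventSet_iff, ContinuousLinearMap.isUnit_iff_bijective]
      have hi := LinearMap.ker_eq_bot.1 h
      exact ⟨hi, LinearMap.injective_iff_surjective.1 hi⟩
    obtain ⟨r, w, hwS, hw, hr⟩ := exists_eigenvector_mem M _ hinj (by
      intro x hx
      simp only [LinearMap.mem_ker, ContinuousLinearMap.coe_coe, sub_apply,
        Algebra.algebraMap_eq_smul_one, smul_apply,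
        one_apply_eq_self, sub_eq_zero] at hx ⊢
      rw [← map_smul, hx, ← mul_apply_eq_comp, ← flow_commute]; rfl)
    simp only [LinearMap.mem_ker, ContinuousLinearMap.coe_coe, sub_apply,
        Algebra.algebraMap_eq_smul_one, smul_apply,
        one_apply_eq_self, sub_eq_zero] at hwS
    rw [flow_eigenvector hr] at hwS
    have hk' : k = Complex.exp (r * ((-1 : ℝ) : ℂ)) := smul_left_injective ℂ hw hwS
    have : ‖k‖ ≤ 1 := by
      rw [hk', Complex.norm_exp, Real.exp_le_one_iff]
      simpa using hM r w hw hr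
    exact_mod_cast this
  have hG := spectrum.pow_norm_pow_one_div_tendsto_nhds_spectralRadius (flow M (-1))
  have hlt : spectralRadius ℂ (flow M (-1)) < ENNReal.ofReal (Real.exp ε) :=
    hspec.trans_lt (by rw [ENNReal.one_lt_ofReal, Real.one_lt_exp_iff]; exact hε)
  obtain ⟨n, hn, hn1⟩ := ((hG.eventually_lt_const hlt).and (eventually_ge_atTop 1)).exists
  have hnpos : (0 : ℝ) < n := by exact_mod_cast hn1
  have hpow : ∀ j : ℕ, flow M (-j) = flow M (-1) ^ j := by
    intro j
    induction j with
    | zero => simp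
    | succ j ih => rw [pow_succ, ← ih, ← flow_add]; congr 1; push_cast; ring
  have hn2 : ‖flow M (-n)‖ ≤ Real.exp (ε * n) := by
    rw [hpow]
    have h3 := (ENNReal.ofReal_lt_ofReal_iff (Real.exp_pos _)).1 hn
    have h4 : (‖flow M (-1) ^ n‖ ^ (1 / (n : ℝ))) ^ (n : ℝ) ≤ Real.exp ε ^ (n : ℝ) :=
      Real.rpow_le_rpow (by positivity) h3.le hnpos.le
    rwa [← Real.rpow_mul (norm_nonneg _), one_div_mul_cancel hnpos.ne', Real.rpow_one,
      ← Real.exp_mul] at h4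
  obtain ⟨B, hB⟩ := (isCompact_Icc (a := (0 : ℝ)) (b := n)).exists_bound_of_continuousOn
    (f := fun s => flow M (-s)) ((continuous_flow M).comp continuous_neg).continuousOn
  have hB0 : 0 ≤ B := (norm_nonneg _).trans (hB 0 ⟨le_rfl, hnpos.le⟩)
  refine ⟨B + 1, by linarith, fun τ hτ => ?_⟩
  -- Division with remainder: `τ = j n + (τ - j n)` with the remainder in `[0, n]`, where the flow
  -- is bounded by compactness.
  set j := ⌊τ / n⌋₊
  have hj1 : (j : ℝ) * n ≤ τ := by
    rw [← le_div_iff₀ hnpos]; exact Nat.floor_le (by positivity)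
  have hj2 : τ ≤ (j + 1 : ℝ) * n := by
    rw [← div_le_iff₀ hnpos]; exact (Nat.lt_floor_add_one _).le
  have hjn : ∀ i : ℕ, ‖flow M (-(i * n))‖ ≤ Real.exp (ε * (i * n)) := by
    intro i
    induction i with
    | zero =>
      have : ‖(1 : F →L[ℂ] F)‖ ≤ 1 := ContinuousLinearMap.norm_id_le
      simpa using this
    | succ i ih =>
      have : (-((i + 1 : ℕ) * n) : ℝ) = -(i * n) + -n := by push_cast; ring
      rw [this, flow_add]
      refine (norm_mul_le _ _).trans ((mul_le_mul ih hn2 (norm_nonneg _) (Real.exp_pos _).le).trans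
        (le_of_eq ?_))
      rw [← Real.exp_add]; congr 1; push_cast; ring
  have : -τ = -(j * n) + -(τ - j * n) := by ring
  rw [this, flow_add]
  refine (norm_mul_le _ _).trans ?_
  have h5 := hB (τ - j * n) ⟨by linarith, by linarith⟩
  have h6 : Real.exp (ε * (j * n)) ≤ Real.exp (ε * τ) :=
    Real.exp_le_exp.2 (mul_le_mul_of_nonneg_left hj1 hε.le)
  calc ‖flow M (-(j * n))‖ * ‖flow M (-(τ - j * n))‖ ≤ Real.exp (ε * τ) * (B + 1) :=
        mul_le_mul ((hjn j).trans h6) (by linarith) (norm_nonneg _) (Real.exp_pos _).le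
    _ = _ := mul_comm _ _

end FlowBounds

end BoundaryLayer

end

noncomputable section

namespace BoundaryLayer

/-! ### Volterra operators with exponential weights -/

section Volterra

open MeasureTheory

variable {F : Type*} [NormedAddCommGroup F] [NormedSpace ℂ F] [CompleteSpace F]

/-- An exponential weight of rate `c / 2`, steepened near the origin. -/
def wt (c b t : ℝ) : ℝ := Real.exp (-(c / 2) * t + b / c * Real.exp (-c * t))

/-- The logarithmic rate of decay of `exp (c t / 4) * wt c b t`. -/
def rate (c b t : ℝ) : ℝ := c / 4 + b * Real.exp (-c * t)

theorem wt_pos (c b t : ℝ) : 0 < wt c b t := Real.exp_pos _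

theorem continuous_wt (c b : ℝ) : Continuous (wt c b) := by unfold wt; fun_prop

theorem continuous_rate (c b : ℝ) : Continuous (rate c b) := by unfold rate; fun_prop

theorem rate_ge {c b : ℝ} (hb : 0 ≤ b) (t : ℝ) : c / 4 ≤ rate c b t := by
  unfold rate; have := Real.exp_pos (-c * t); nlinarith

theorem rate_pos {c b : ℝ} (hc : 0 < c) (hb : 0 ≤ b) (t : ℝ) : 0 < rate c b t :=
  lt_of_lt_of_le (by positivity) (rate_ge hb t)

theorem exp_le_wt {c b : ℝ} (hc : 0 < c) (hb : 0 ≤ b) (t : ℝ) :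
    Real.exp (-(c / 2) * t) ≤ wt c b t := by
  unfold wt; apply Real.exp_le_exp.2; have : 0 ≤ b / c * Real.exp (-c * t) := by positivity
  linarith

theorem wt_le_exp {c b : ℝ} (hc : 0 < c) (hb : 0 ≤ b) {t : ℝ} (ht : 0 ≤ t) :
    wt c b t ≤ Real.exp (b / c) * Real.exp (-(c / 2) * t) := by
  unfold wt; rw [← Real.exp_add]; apply Real.exp_le_exp.2
  have h1 : Real.exp (-c * t) ≤ 1 := by rw [Real.exp_le_one_iff]; nlinarith
  have : b / c * Real.exp (-c * t) ≤ b / c * 1 := mul_le_mul_of_nonneg_left h1 (by positivity)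
  linarith

/-- This identity dictates the shape of `wt` and `rate`. Since `rate * e^{c t/4} * wt` is minus an
exact derivative, its integral over `(x, ∞)` reproduces `e^{c x/4} * wt x` with constant `1`,
whatever the value of `b`. -/
theorem hasDerivAt_exp_mul_wt {c : ℝ} (hc : 0 < c) (b t : ℝ) :
    HasDerivAt (fun t => Real.exp (c / 4 * t) * wt c b t)
      (-(rate c b t * (Real.exp (c / 4 * t) * wt c b t))) t := by
  have h1 : HasDerivAt (fun t : ℝ => Real.exp (c / 4 * t)) (Real.exp (c / 4 * t) * (c / 4 * 1)) t :=
    ((hasDerivAt_id t).const_mul (c / 4)).exp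
  have h2 : HasDerivAt (fun t : ℝ => Real.exp (-c * t)) (Real.exp (-c * t) * (-c * 1)) t :=
    ((hasDerivAt_id t).const_mul (-c)).exp
  have h3 := (((hasDerivAt_id t).const_mul (-(c / 2))).add (h2.const_mul (b / c))).exp
  refine (h1.mul h3).congr_deriv ?_
  simp only [rate, wt, id, Pi.add_apply]
  field_simp
  ring

theorem tendsto_exp_mul_wt {c b : ℝ} (hc : 0 < c) (hb : 0 ≤ b) :
    Tendsto (fun t => Real.exp (c / 4 * t) * wt c b t) atTop (𝓝 0) := by
  have h0 : Tendsto (fun t : ℝ => Real.exp (b / c) * Real.exp (-(c / 4) * t)) atTop (𝓝 0) := by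
    have : Tendsto (fun t : ℝ => Real.exp (-(c / 4) * t)) atTop (𝓝 0) :=
      Real.tendsto_exp_atBot.comp ((tendsto_const_mul_atBot_of_neg (by linarith)).2 tendsto_id)
    simpa using this.const_mul (Real.exp (b / c))
  refine squeeze_zero' (Eventually.of_forall fun t => by have := wt_pos c b t; positivity) ?_ h0
  filter_upwards [eventually_ge_atTop 0] with t ht
  calc _ ≤ Real.exp (c / 4 * t) * (Real.exp (b / c) * Real.exp (-(c / 2) * t)) :=
        mul_le_mul_of_nonneg_left (wt_le_exp hc hb ht) (Real.exp_pos _).le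
    _ = _ := by
      rw [mul_left_comm, ← Real.exp_add]; congr 2; ring

theorem integrableOn_rate_mul {c b : ℝ} (hc : 0 < c) (hb : 0 ≤ b) (x : ℝ) :
    IntegrableOn (fun t => rate c b t * (Real.exp (c / 4 * t) * wt c b t)) (Ioi x) := by
  have := integrableOn_Ioi_deriv_of_nonpos' (a := x) (fun t _ => hasDerivAt_exp_mul_wt hc b t)
    (fun t _ => by have := wt_pos c b t; have := rate_pos hc hb t; simp; positivity)
    (tendsto_exp_mul_wt hc hb)
  simpa using this.neg

theorem integral_rate_mul {c b : ℝ} (hc : 0 < c) (hb : 0 ≤ b) (x : ℝ) :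
    ∫ t in Ioi x, rate c b t * (Real.exp (c / 4 * t) * wt c b t) =
      Real.exp (c / 4 * x) * wt c b x := by
  have := integral_Ioi_of_hasDerivAt_of_nonpos' (a := x) (fun t _ => hasDerivAt_exp_mul_wt hc b t)
    (fun t _ => by have := wt_pos c b t; have := rate_pos hc hb t; simp; positivity)
    (tendsto_exp_mul_wt hc hb)
  rw [integral_neg] at this
  linarith

/-- `‖exp (-τ M)‖ ≤ C exp (c τ / 4)` for `τ ≥ 0`. -/
def FlowBound (M : F →L[ℂ] F) (c C : ℝ) : Prop :=
  ∀ τ : ℝ, 0 ≤ τ → ‖flow M (-τ)‖ ≤ C * Real.exp (c / 4 * τ)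

/-- The integrand of the Volterra operator. -/
def volterraKernel (M : F →L[ℂ] F) (c b : ℝ) (h : BoundedContinuousFunction ℝ F) (t : ℝ) : F :=
  (rate c b t * wt c b t) • flow M (-t) (h t)

theorem continuous_volterraKernel (M : F →L[ℂ] F) (c b : ℝ) (h : BoundedContinuousFunction ℝ F) :
    Continuous (volterraKernel M c b h) := by
  unfold volterraKernel
  exact ((continuous_rate c b).mul (continuous_wt c b)).smul
    (((continuous_flow M).comp continuous_neg).clm_apply h.continuous)

theorem FlowBound.nonneg {M : F →L[ℂ] F} {c C : ℝ} (hM : FlowBound M c C) : 0 ≤ C := by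
  have := (norm_nonneg _).trans (hM 0 le_rfl)
  simpa using this

theorem FlowBound.integrableOn {M : F →L[ℂ] F} {c b C : ℝ} (hM : FlowBound M c C) (hc : 0 < c)
    (hb : 0 ≤ b) (h : BoundedContinuousFunction ℝ F) (x : ℝ) :
    IntegrableOn (volterraKernel M c b h) (Ioi x) := by
  have h0 : IntegrableOn (volterraKernel M c b h) (Ioi 0) := by
    refine Integrable.mono' ((integrableOn_rate_mul hc hb 0).const_mul (C * ‖h‖))
      (continuous_volterraKernel M c b h).aestronglyMeasurable ?_
    refine (ae_restrict_iff' measurableSet_Ioi).2 (Eventually.of_forall fun t ht => ?_)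
    have hr := rate_pos hc hb t
    have hw := wt_pos c b t
    rw [volterraKernel, norm_smul, Real.norm_of_nonneg (by positivity)]
    calc _ ≤ rate c b t * wt c b t * ((C * Real.exp (c / 4 * t)) * ‖h‖) := by
          gcongr
          exact (ContinuousLinearMap.le_opNorm _ _).trans
            (mul_le_mul (hM t (le_of_lt ht)) (h.norm_coe_le_norm t) (norm_nonneg _)
              (mul_nonneg hM.nonneg (Real.exp_pos _).le))
      _ = _ := by ring
  -- The flow bound covers only `t ≥ 0`; for negative `x` the missing compact piece is handled by
  -- continuity.
  have h1 : IntegrableOn (volterraKernel M c b h) (Icc (min x 0) (max x 0)) :=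
    (continuous_volterraKernel M c b h).integrableOn_Icc
  refine (h1.union h0).mono_set fun t ht => ?_
  rcases le_or_gt t 0 with h' | h'
  · exact Or.inl ⟨(min_le_left _ _).trans (le_of_lt ht), h'.trans (le_max_right _ _)⟩
  · exact Or.inr h'

/-- The solution of `ζ' = M ζ + rate * wt * h` that decays like `wt`. -/
def volterra (M : F →L[ℂ] F) (c b : ℝ) (h : BoundedContinuousFunction ℝ F) (x : ℝ) : F :=
  -(flow M x (∫ t in Ioi x, volterraKernel M c b h t))

theorem FlowBound.hasDerivAt_volterra {M : F →L[ℂ] F} {c b C : ℝ} (hM : FlowBound M c C)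
    (hc : 0 < c) (hb : 0 ≤ b) (h : BoundedContinuousFunction ℝ F) (x : ℝ) :
    HasDerivAt (volterra M c b h) (M (volterra M c b h x) + (rate c b x * wt c b x) • h x) x := by
  have hk := continuous_volterraKernel M c b h
  have hI : (fun x => ∫ t in Ioi x, volterraKernel M c b h t) = fun x =>
      (∫ t in Ioi 0, volterraKernel M c b h t) - ∫ t in (0 : ℝ)..x, volterraKernel M c b h t := by
    funext x
    rw [eq_sub_iff_add_eq, add_comm]
    exact intervalIntegral.integral_interval_add_Ioi (hM.integrableOn hc hb h 0)
      (hM.integrableOn hc hb h x)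
  have hd : HasDerivAt (fun x => ∫ t in Ioi x, volterraKernel M c b h t)
      (-volterraKernel M c b h x) x := by
    rw [hI]
    exact (intervalIntegral.integral_hasDerivAt_right (hk.intervalIntegrable _ _)
      hk.stronglyMeasurable.stronglyMeasurableAtFilter hk.continuousAt).const_sub _
  have := (hasDerivWithinAt_clm_apply (hasDerivAt_flow' M x).hasDerivWithinAt
    (hd.hasDerivWithinAt (s := univ))).neg
  rw [hasDerivWithinAt_univ] at this
  refine this.congr_deriv ?_
  have h2 : flow M x (flow M (-x) (h x)) = h x := by
    rw [← mul_apply_eq_comp, flow_mul_neg]; rfl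
  simp only [volterra, map_neg, volterraKernel, mul_apply_eq_comp, neg_add, neg_neg,
    ContinuousLinearMap.map_smul_of_tower, h2]

/-- The bound is uniform in `b`. A perturbation dominated by `e^{-c x}` becomes small after division
by `rate ≥ b e^{-c x}`, so a large `b` later yields a contraction on the whole half-line, with no
need to start far out. -/
theorem FlowBound.norm_volterra_le {M : F →L[ℂ] F} {c b C : ℝ} (hM : FlowBound M c C)
    (hc : 0 < c) (hb : 0 ≤ b) (h : BoundedContinuousFunction ℝ F) {x : ℝ} :
    ‖volterra M c b h x‖ ≤ C * ‖h‖ * wt c b x := by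
  rw [volterra, norm_neg, ← ContinuousLinearMap.integral_comp_comm _ (hM.integrableOn hc hb h x)]
  have hi := ((integrableOn_rate_mul hc hb x).const_mul (C * ‖h‖ * Real.exp (-(c / 4 * x))))
  refine (norm_integral_le_of_norm_le hi ?_).trans (le_of_eq ?_)
  · refine (ae_restrict_iff' measurableSet_Ioi).2 (Eventually.of_forall fun t ht => ?_)
    have hr := rate_pos hc hb t
    have hw := wt_pos c b t
    have h2 : flow M x (flow M (-t) (h t)) = flow M (-(t - x)) (h t) := by
      rw [← mul_apply_eq_comp, ← flow_add]; congr 2; ring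
    rw [volterraKernel, ContinuousLinearMap.map_smul_of_tower, h2, norm_smul,
      Real.norm_of_nonneg (by positivity)]
    calc _ ≤ rate c b t * wt c b t * ((C * Real.exp (c / 4 * (t - x))) * ‖h‖) := by
          gcongr
          exact (ContinuousLinearMap.le_opNorm _ _).trans
            (mul_le_mul (hM _ (sub_nonneg.2 (le_of_lt ht))) (h.norm_coe_le_norm t) (norm_nonneg _)
              (mul_nonneg hM.nonneg (Real.exp_pos _).le))
      _ = _ := by
        have : c / 4 * (t - x) = -(c / 4 * x) + c / 4 * t := by ring
        rw [this, Real.exp_add]; ring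
  · rw [integral_const_mul, integral_rate_mul hc hb]
    have : Real.exp (-(c / 4 * x)) * Real.exp (c / 4 * x) = 1 := by rw [← Real.exp_add]; simp
    linear_combination (C * ‖h‖ * wt c b x) * this

theorem volterra_add {M : F →L[ℂ] F} {c b C : ℝ} (hM : FlowBound M c C)
    (hc : 0 < c) (hb : 0 ≤ b) (h k : BoundedContinuousFunction ℝ F) (x : ℝ) :
    volterra M c b (h + k) x = volterra M c b h x + volterra M c b k x := by
  have : volterraKernel M c b (h + k) = fun t => volterraKernel M c b h t + volterraKernel M c b k t := by
    funext t; simp [volterraKernel]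
  simp only [volterra, this]
  rw [integral_add (hM.integrableOn hc hb h x) (hM.integrableOn hc hb k x)]
  simp [add_comm]

theorem volterra_smul (M : F →L[ℂ] F) (c b : ℝ) (a : ℂ) (h : BoundedContinuousFunction ℝ F)
    (x : ℝ) : volterra M c b (a • h) x = a • volterra M c b h x := by
  have : volterraKernel M c b (a • h) = fun t => a • volterraKernel M c b h t := by
    funext t; simp [volterraKernel, smul_comm a]
  simp only [volterra, this]
  rw [integral_smul]
  simp

theorem flow_apply_of_hasDeriv {M : F →L[ℂ] F} {d : ℝ → F}
    (hd : ∀ x ∈ Ici (0 : ℝ), HasDerivWithinAt d (M (d x)) (Ici 0) x) {x : ℝ} (hx : 0 ≤ x) :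
    d x = flow M x (d 0) := by
  have key : ∀ y ∈ Ici (0 : ℝ), HasDerivWithinAt (fun y => flow M (-y) (d y)) 0 (Ici 0) y := by
    intro y hy
    refine (hasDerivWithinAt_clm_apply (hasDerivAt_flow_neg M y).hasDerivWithinAt
      (hd y hy)).congr_deriv ?_
    simp
  have hc : flow M (-x) (d x) = flow M (-0) (d 0) :=
    (convex_Ici (0 : ℝ)).is_const_of_fderivWithin_eq_zero (𝕜 := ℝ)
      (fun y hy => (key y hy).differentiableWithinAt)
      (fun y hy => by
        have h1 := (key y hy).hasFDerivWithinAt.fderivWithin (uniqueDiffOn_Ici 0 y hy)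
        rw [h1]; ext; simp) hx self_mem_Ici
  have h2 : flow M x (flow M (-x) (d x)) = d x := by
    rw [← mul_apply_eq_comp, flow_mul_neg]; rfl
  rw [← h2, hc]; simp

/-- The difference of the two solutions is `exp (x M) y0`. Pulling it back from a point `y` costs `C
e^{c y/4}` and gains `wt c b y`; the product tends to `0`, so `y0 = 0`. -/
theorem FlowBound.eq_volterra {M : F →L[ℂ] F} {c b C : ℝ} (hM : FlowBound M c C)
    (hc : 0 < c) (hb : 0 ≤ b) (h : BoundedContinuousFunction ℝ F) {ζ : ℝ → F}
    (hζ : ∀ x ∈ Ici (0 : ℝ),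
      HasDerivWithinAt ζ (M (ζ x) + (rate c b x * wt c b x) • h x) (Ici 0) x)
    {K : ℝ} (hK : ∀ x, 0 ≤ x → ‖ζ x‖ ≤ K * wt c b x) {x : ℝ} (hx : 0 ≤ x) :
    ζ x = volterra M c b h x := by
  have hd : ∀ x ∈ Ici (0 : ℝ), HasDerivWithinAt (fun x => ζ x - volterra M c b h x)
      (M (ζ x - volterra M c b h x)) (Ici 0) x := by
    intro x hx
    refine ((hζ x hx).sub (hM.hasDerivAt_volterra hc hb h x).hasDerivWithinAt).congr_deriv ?_
    rw [map_sub]; abel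
  have h1 := fun y (hy : (0 : ℝ) ≤ y) => flow_apply_of_hasDeriv hd hy
  set y0 := ζ 0 - volterra M c b h 0
  have h2 : ∀ y, 0 ≤ y → ‖y0‖ ≤ C * (K + C * ‖h‖) * (Real.exp (c / 4 * y) * wt c b y) := by
    intro y hy
    have h3 : flow M (-y) (ζ y - volterra M c b h y) = y0 := by
      rw [h1 y hy, ← mul_apply_eq_comp, flow_neg_mul]; rfl
    rw [← h3]
    refine (ContinuousLinearMap.le_opNorm _ _).trans ?_
    have h4 : ‖ζ y - volterra M c b h y‖ ≤ (K + C * ‖h‖) * wt c b y := by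
      refine (norm_sub_le _ _).trans ?_
      have := hM.norm_volterra_le hc hb h (x := y)
      have := hK y hy
      linarith
    refine (mul_le_mul (hM y hy) h4 (norm_nonneg _)
      (mul_nonneg hM.nonneg (Real.exp_pos _).le)).trans (le_of_eq ?_)
    ring
  have h5 : ‖y0‖ ≤ 0 := by
    refine ge_of_tendsto (x := atTop) (f := fun y => C * (K + C * ‖h‖) *
      (Real.exp (c / 4 * y) * wt c b y)) ?_ ((eventually_ge_atTop 0).mono h2)
    simpa using (tendsto_exp_mul_wt hc hb).const_mul (C * (K + C * ‖h‖))
  have h6 : y0 = 0 := norm_le_zero_iff.1 h5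
  have := h1 x hx
  rw [h6, map_zero, sub_eq_zero] at this
  exact this

end Volterra

end BoundaryLayer

end

noncomputable section

namespace BoundaryLayer

/-! ### Asymptotically constant systems -/

section AsymptoticallyConstant

open scoped BoundedContinuousFunction

variable {F : Type*} [NormedAddCommGroup F] [NormedSpace ℂ F] [CompleteSpace F]

/-- `z` solves `z' = (M + R x) z` on the half-line `x ≥ 0`. -/
def IsSol (M : F →L[ℂ] F) (R : ℝ → F →L[ℂ] F) (z : ℝ → F) : Prop :=
  ∀ x ∈ Ici (0 : ℝ), HasDerivWithinAt z (M (z x) + R x (z x)) (Ici 0) x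

/-- `z` converges to `V` at the exponential rate `c / 2`. -/
def IsAsymptotic (c : ℝ) (V : F) (z : ℝ → F) : Prop :=
  ∃ K, ∀ x, 0 ≤ x → ‖z x - V‖ ≤ K * Real.exp (-(c / 2) * x)

/-- `R` is continuous on the half-line and decays at the exponential rate `c`. -/
structure IsDecaying (R : ℝ → F →L[ℂ] F) (c C : ℝ) : Prop where
  cont : ContinuousOn R (Ici 0)
  bound : ∀ x, 0 ≤ x → ‖R x‖ ≤ C * Real.exp (-c * x)

theorem IsSol.sub {M : F →L[ℂ] F} {R : ℝ → F →L[ℂ] F} {z w : ℝ → F} (hz : IsSol M R z)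
    (hw : IsSol M R w) : IsSol M R (fun x => z x - w x) := fun x hx => by
  refine ((hz x hx).sub (hw x hx)).congr_deriv ?_
  simp only [map_sub]; abel

theorem IsSol.continuousOn {M : F →L[ℂ] F} {R : ℝ → F →L[ℂ] F} {z : ℝ → F} (hz : IsSol M R z) :
    ContinuousOn z (Ici 0) := fun x hx => (hz x hx).continuousWithinAt

theorem IsAsymptotic.tendsto {c : ℝ} (hc : 0 < c) {V : F} {z : ℝ → F} (h : IsAsymptotic c V z) :
    Tendsto z atTop (𝓝 V) := by
  obtain ⟨K, hK⟩ := h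
  rw [tendsto_iff_norm_sub_tendsto_zero]
  have h0 : Tendsto (fun t : ℝ => Real.exp (-(c / 2) * t)) atTop (𝓝 0) :=
    Real.tendsto_exp_atBot.comp ((tendsto_const_mul_atBot_of_neg (by linarith)).2 tendsto_id)
  refine squeeze_zero' (Eventually.of_forall fun _ => norm_nonneg _)
    ((eventually_ge_atTop 0).mono hK) ?_
  simpa using h0.const_mul K

/-- Data known only on `x ≥ 0` are extended constantly to the left, so that the fixed point can be
set up in bounded continuous functions on `ℝ`. -/
theorem continuous_comp_max {X : Type*} [TopologicalSpace X] {f : ℝ → X}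
    (hf : ContinuousOn f (Ici 0)) : Continuous fun x => f (max x 0) :=
  continuousOn_univ.1 (hf.comp (by fun_prop) fun x _ => le_max_right x 0)

theorem analyticAt_clm_apply {G H : Type*} [NormedAddCommGroup G] [NormedSpace ℂ G]
    [NormedAddCommGroup H] [NormedSpace ℂ H] {f : ℂ → G →L[ℂ] H} {g : ℂ → G} {z : ℂ}
    (hf : AnalyticAt ℂ f z) (hg : AnalyticAt ℂ g z) : AnalyticAt ℂ (fun z => f z (g z)) z :=
  AnalyticAt.fun_comp (f := fun z => (f z, g z))
    (ContinuousLinearMap.analyticAt_bilinear (ContinuousLinearMap.id ℂ (G →L[ℂ] H)) _)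
    (hf.prod hg)

theorem exists_volterraOp {M : F →L[ℂ] F} {c b C : ℝ} (hM : FlowBound M c C) (hc : 0 < c)
    (hb : 0 ≤ b) : ∃ J : (ℝ →ᵇ F) →L[ℂ] (ℝ →ᵇ F), ‖J‖ ≤ C ∧
      ∀ h x, J h x = (wt c b (max x 0))⁻¹ • volterra M c b h (max x 0) := by
  have hv : ∀ h, Continuous (volterra M c b h) := fun h =>
    continuous_iff_continuousAt.2 fun x => (hM.hasDerivAt_volterra hc hb h x).continuousAt
  have hb' : ∀ h x, ‖(wt c b (max x 0))⁻¹ • volterra M c b h (max x 0)‖ ≤ C * ‖h‖ := by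
    intro h x
    have hw := wt_pos c b (max x 0)
    rw [norm_smul, norm_inv, Real.norm_of_nonneg hw.le, inv_mul_le_iff₀ hw, mul_comm]
    exact hM.norm_volterra_le hc hb h
  let J0 : (ℝ →ᵇ F) →ₗ[ℂ] (ℝ →ᵇ F) :=
    { toFun := fun h => BoundedContinuousFunction.ofNormedAddCommGroup
        (fun x => (wt c b (max x 0))⁻¹ • volterra M c b h (max x 0))
        ((((continuous_wt c b).comp (by fun_prop)).inv₀ fun x => (wt_pos _ _ _).ne').smul
          ((hv h).comp (by fun_prop))) (C * ‖h‖) (hb' h)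
      map_add' := fun h k => by
        ext x
        simp [volterra_add hM hc hb]
      map_smul' := fun a h => by
        ext x
        simp [volterra_smul, smul_comm a] }
  have hJ0 : ∀ h, ‖J0 h‖ ≤ C * ‖h‖ := fun h =>
    BoundedContinuousFunction.norm_ofNormedAddCommGroup_le _ (mul_nonneg hM.nonneg (norm_nonneg _)) (hb' h)
  exact ⟨J0.mkContinuous C hJ0, LinearMap.mkContinuous_norm_le _ hM.nonneg _, fun h x => rfl⟩

theorem exists_pointwiseOp {f : ℝ → F →L[ℂ] F} (hf : Continuous f) {B : ℝ}
    (hB : ∀ x, ‖f x‖ ≤ B) : ∃ Q : (ℝ →ᵇ F) →L[ℂ] (ℝ →ᵇ F), ‖Q‖ ≤ B ∧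
      ∀ h x, Q h x = f x (h x) := by
  have hB0 : 0 ≤ B := (norm_nonneg _).trans (hB 0)
  have hb : ∀ (h : ℝ →ᵇ F) x, ‖f x (h x)‖ ≤ B * ‖h‖ := fun h x =>
    (ContinuousLinearMap.le_opNorm _ _).trans
      (mul_le_mul (hB x) (h.norm_coe_le_norm x) (norm_nonneg _) hB0)
  let Q0 : (ℝ →ᵇ F) →ₗ[ℂ] (ℝ →ᵇ F) :=
    { toFun := fun h => BoundedContinuousFunction.ofNormedAddCommGroup (fun x => f x (h x)) (hf.clm_apply h.continuous)
        (B * ‖h‖) (hb h)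
      map_add' := fun h k => by ext x; simp
      map_smul' := fun a h => by ext x; simp }
  exact ⟨Q0.mkContinuous B fun h => BoundedContinuousFunction.norm_ofNormedAddCommGroup_le _ (by positivity) (hb h),
    LinearMap.mkContinuous_norm_le _ hB0 _, fun h x => rfl⟩

/-- Bilinearity in `A` and `h` is the point: an operator family obtained by inserting `A = M z - M
z₀` is then analytic in `z` because `M` is. -/
theorem exists_scaledConstOp {g : ℝ → ℝ} (hg : Continuous g) {B : ℝ}
    (hB : ∀ x, ‖g x‖ ≤ B) : ∃ Q : (F →L[ℂ] F) →L[ℂ] (ℝ →ᵇ F) →L[ℂ] (ℝ →ᵇ F), 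
      ∀ A h x, Q A h x = g x • A (h x) := by
  have hB0 : 0 ≤ B := (norm_nonneg _).trans (hB 0)
  have hb : ∀ (A : F →L[ℂ] F) (h : ℝ →ᵇ F) x, ‖g x • A (h x)‖ ≤ B * ‖A‖ * ‖h‖ := fun A h x => by
    rw [norm_smul, mul_assoc]
    exact mul_le_mul (hB x) ((ContinuousLinearMap.le_opNorm _ _).trans
      (mul_le_mul_of_nonneg_left (h.norm_coe_le_norm x) (norm_nonneg _))) (norm_nonneg _) hB0
  let Q0 : (F →L[ℂ] F) →ₗ[ℂ] (ℝ →ᵇ F) →ₗ[ℂ] (ℝ →ᵇ F) := LinearMap.mk₂ ℂ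
    (fun A h => BoundedContinuousFunction.ofNormedAddCommGroup (fun x => g x • A (h x))
      (hg.smul (A.continuous.comp h.continuous)) (B * ‖A‖ * ‖h‖) (hb A h))
    (fun A A' h => by ext x; simp) (fun a A h => by ext x; simp [smul_comm a])
    (fun A h k => by ext x; simp) (fun a A h => by ext x; simp [smul_comm a])
  exact ⟨Q0.mkContinuous₂ B fun A h => BoundedContinuousFunction.norm_ofNormedAddCommGroup_le _ (by positivity) (hb A h),
    fun A h x => rfl⟩

theorem exists_forcingOp {f : ℝ → F →L[ℂ] F} (hf : Continuous f) {B : ℝ}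
    (hB : ∀ x, ‖f x‖ ≤ B) : ∃ Q : F →L[ℂ] (ℝ →ᵇ F), ∀ v x, Q v x = f x v := by
  have hB0 : 0 ≤ B := (norm_nonneg _).trans (hB 0)
  have hb : ∀ (v : F) x, ‖f x v‖ ≤ B * ‖v‖ := fun v x =>
    (ContinuousLinearMap.le_opNorm _ _).trans (mul_le_mul_of_nonneg_right (hB x) (norm_nonneg _))
  let Q0 : F →ₗ[ℂ] (ℝ →ᵇ F) :=
    { toFun := fun v => BoundedContinuousFunction.ofNormedAddCommGroup (fun x => f x v)
        (hf.clm_apply continuous_const) (B * ‖v‖) (hb v)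
      map_add' := fun h k => by ext x; simp
      map_smul' := fun a h => by ext x; simp }
  exact ⟨Q0.mkContinuous B fun h => BoundedContinuousFunction.norm_ofNormedAddCommGroup_le _ (by positivity) (hb h),
    fun h x => rfl⟩

/-- Local existence, uniqueness and analytic dependence on the parameter for the solution of an
asymptotically constant system that converges exponentially to a stationary vector of the
limiting system. -/
theorem exists_local_solution {R : ℝ → F →L[ℂ] F} {c C₁ C₀ : ℝ} (hc : 0 < c)
    (hR : IsDecaying R c C₁) {M : ℂ → F →L[ℂ] F} {V : ℂ → F} {z₀ : ℂ}
    (hM : AnalyticAt ℂ M z₀) (hV : AnalyticAt ℂ V z₀) (hMV : ∀ᶠ z in 𝓝 z₀, M z (V z) = 0)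
    (hM₀ : FlowBound (M z₀) c C₀) :
    ∃ W : ℂ → ℝ → F, AnalyticAt ℂ (fun z => W z 0) z₀ ∧
      ∀ᶠ z in 𝓝 z₀, IsSol (M z) R (W z) ∧ IsAsymptotic c (V z) (W z) ∧
        ∀ W', IsSol (M z) R W' → IsAsymptotic c (V z) W' → EqOn W' (W z) (Ici 0) := by
  have hC₀ := hM₀.nonneg
  have hC₁ : 0 ≤ C₁ := by
    have := (norm_nonneg _).trans (hR.bound 0 le_rfl); simpa using this
  -- Any `b > C₀ C₁` would do: the fixed-point operator at `z₀` has norm at most `C₀ * (C₁ / b)`.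
  set b : ℝ := 4 * (C₀ + 1) * (C₁ + 1) with hbdef
  have hb : 0 < b := by positivity
  set M₀ := M z₀
  obtain ⟨J, hJn, hJ⟩ := exists_volterraOp hM₀ hc hb.le
  have hRc : Continuous fun x => R (max x 0) := continuous_comp_max hR.cont
  have hrc : Continuous fun x => (rate c b (max x 0))⁻¹ :=
    ((continuous_rate c b).comp (by fun_prop)).inv₀ fun x => (rate_pos hc hb.le _).ne'
  have hwc : Continuous fun x => (wt c b (max x 0))⁻¹ :=
    ((continuous_wt c b).comp (by fun_prop)).inv₀ fun x => (wt_pos _ _ _).ne'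
  obtain ⟨QR, hQRn, hQR⟩ := exists_pointwiseOp (f := fun x => (rate c b (max x 0))⁻¹ • R (max x 0))
    (hrc.smul hRc) (B := C₁ / b) (fun x => by
    have hr := rate_pos hc hb.le (max x 0)
    have h1 := hR.bound (max x 0) (le_max_right _ _)
    have h2 : b * Real.exp (-c * max x 0) ≤ rate c b (max x 0) := by unfold rate; linarith
    rw [norm_smul, norm_inv, Real.norm_of_nonneg hr.le, inv_mul_le_iff₀ hr, mul_div_assoc',
      le_div_iff₀ hb]
    nlinarith)
  obtain ⟨Q, hQ⟩ := exists_scaledConstOp (F := F) hrc (B := 4 / c) (fun x => by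
    have hr := rate_pos hc hb.le (max x 0)
    have h2 := rate_ge (c := c) hb.le (max x 0)
    rw [norm_inv, Real.norm_of_nonneg hr.le, inv_le_comm₀ hr (by positivity), inv_div]
    exact h2)
  obtain ⟨r₀, hr₀⟩ := exists_forcingOp
    (f := fun x => ((rate c b (max x 0))⁻¹ * (wt c b (max x 0))⁻¹) • R (max x 0))
    ((hrc.mul hwc).smul hRc) (B := 4 * C₁ / c) (fun x => by
    have hr := rate_pos hc hb.le (max x 0)
    have hw := wt_pos c b (max x 0)
    have h1 := hR.bound (max x 0) (le_max_right _ _)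
    have h2 := rate_ge (c := c) hb.le (max x 0)
    have h3 := exp_le_wt hc hb.le (max x 0)
    have h4 : Real.exp (-c * max x 0) ≤ Real.exp (-(c / 2) * max x 0) :=
      Real.exp_le_exp.2 (by nlinarith [le_max_right x 0])
    rw [norm_smul, ← mul_inv, norm_inv, Real.norm_of_nonneg (by positivity),
      inv_mul_le_iff₀ (by positivity)]
    calc _ ≤ C₁ * wt c b (max x 0) := h1.trans (mul_le_mul_of_nonneg_left (h4.trans h3) hC₁)
      _ = (c / 4 * wt c b (max x 0)) * (4 * C₁ / c) := by field_simp
      _ ≤ _ := by gcongr)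
  -- With the ansatz `W = V + wt * η` the equation becomes `η = T η + J (r₀ V)`. The flow is frozen
  -- at `M₀`, and `M z - M₀` is treated as part of the perturbation; it need not decay in `x`, but
  -- it vanishes at `z₀`, so `‖T z‖ < 1` persists near `z₀`. The Neumann inverse then makes `η`
  -- analytic.
  let T : ℂ → (ℝ →ᵇ F) →L[ℂ] (ℝ →ᵇ F) := fun z => J ∘L (QR + Q (M z - M₀))
  have hT : AnalyticAt ℂ T z₀ := by
    have h1 : AnalyticAt ℂ (fun z => QR + Q (M z - M₀)) z₀ :=
      analyticAt_const.add ((Q.analyticAt _).comp (hM.sub analyticAt_const))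
    exact ((ContinuousLinearMap.compL ℂ _ _ _ J).analyticAt _).comp h1
  have hT₀ : ‖T z₀‖ < 1 := by
    have : T z₀ = J ∘L QR := by simp [T, M₀]
    rw [this]
    refine (ContinuousLinearMap.opNorm_comp_le _ _).trans_lt ?_
    refine (mul_le_mul hJn hQRn (norm_nonneg _) hC₀).trans_lt ?_
    rw [mul_div_assoc', div_lt_one hb, hbdef]
    nlinarith [mul_nonneg hC₀ hC₁]
  have hTev : ∀ᶠ z in 𝓝 z₀, ‖T z‖ < 1 :=
    hT.continuousAt.norm.eventually_lt continuousAt_const hT₀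
  let η : ℂ → (ℝ →ᵇ F) := fun z => Ring.inverse (1 - T z) (J (r₀ (V z)))
  have hη : AnalyticAt ℂ η z₀ := by
    have h1 : AnalyticAt ℂ (fun z => Ring.inverse (1 - T z)) z₀ :=
      AnalyticAt.fun_comp (f := fun z => 1 - T z)
        (analyticAt_inverse (𝕜 := ℂ) (Units.oneSub (T z₀) hT₀)) (analyticAt_const.sub hT)
    exact analyticAt_clm_apply h1 ((J.analyticAt _).comp ((r₀.analyticAt _).comp hV))
  have hηeq : ∀ z, ‖T z‖ < 1 → η z = T z (η z) + J (r₀ (V z)) := by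
    intro z hz
    have h1 : (1 - T z) * Ring.inverse (1 - T z) = 1 :=
      Ring.mul_inverse_cancel _ (Units.oneSub (T z) hz).isUnit
    have h2 := congrArg (fun A : (ℝ →ᵇ F) →L[ℂ] (ℝ →ᵇ F) => A (J (r₀ (V z)))) h1
    simp only [mul_apply_eq_comp, sub_apply, one_apply_eq_self] at h2
    rw [sub_eq_iff_eq_add'] at h2
    exact h2
  have hsc : ∀ x, 0 ≤ x → ∀ v : F, (rate c b x * wt c b x) • (rate c b x)⁻¹ • (wt c b x)⁻¹ • v = v := by
    intro x hx v
    have hr := (rate_pos hc hb.le x).ne'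
    have hw := (wt_pos c b x).ne'
    rw [smul_smul, smul_smul]
    rw [show rate c b x * wt c b x * (rate c b x)⁻¹ * (wt c b x)⁻¹ = 1 by field_simp, one_smul]
  refine ⟨fun z x => V z + wt c b x • η z x, ?_, ?_⟩
  · refine hV.add ?_
    have h1 : AnalyticAt ℂ (fun z => BoundedContinuousFunction.evalCLM ℂ (0 : ℝ) (η z)) z₀ :=
      ((BoundedContinuousFunction.evalCLM ℂ (0 : ℝ)).analyticAt _).fun_comp hη
    exact analyticAt_const.smul h1
  · filter_upwards [hTev, hMV] with z hz hzV
    have hVsol : ∀ W', IsAsymptotic c (V z) W' ↔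
        ∃ K, ∀ x, 0 ≤ x → ‖W' x - V z‖ ≤ K * wt c b x := by
      intro W'
      constructor
      · rintro ⟨K, hK⟩
        refine ⟨|K|, fun x hx => (hK x hx).trans ?_⟩
        exact mul_le_mul (le_abs_self _) (exp_le_wt hc hb.le x) (Real.exp_pos _).le (abs_nonneg _)
      · rintro ⟨K, hK⟩
        refine ⟨|K| * Real.exp (b / c), fun x hx => (hK x hx).trans ?_⟩
        rw [mul_assoc]
        exact mul_le_mul (le_abs_self _) (wt_le_exp hc hb.le hx) (wt_pos _ _ _).le (abs_nonneg _)
    have hA : IsAsymptotic c (V z) (fun x => V z + wt c b x • η z x) := by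
      rw [hVsol]
      refine ⟨‖η z‖, fun x _ => ?_⟩
      rw [add_sub_cancel_left, norm_smul, Real.norm_of_nonneg (wt_pos _ _ _).le, mul_comm]
      exact mul_le_mul_of_nonneg_right ((η z).norm_coe_le_norm x) (wt_pos _ _ _).le
    have hS : IsSol (M z) R (fun x => V z + wt c b x • η z x) := by
      let h : ℝ →ᵇ F := (QR + Q (M z - M₀)) (η z) + r₀ (V z)
      have h1 : η z = J h := by
        rw [map_add]; exact hηeq z hz
      have h2 : ∀ x ∈ Ici (0 : ℝ), V z + wt c b x • η z x = V z + volterra M₀ c b h x := by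
        intro x hx
        rw [h1, hJ, max_eq_left hx, smul_smul, mul_inv_cancel₀ (wt_pos _ _ _).ne', one_smul]
      intro x hx
      have h3 := ((hM₀.hasDerivAt_volterra hc hb.le h x).const_add (V z)).hasDerivWithinAt
        (s := Ici 0)
      refine (h3.congr h2 (h2 x hx)).congr_deriv ?_
      have h4 : volterra M₀ c b h x = wt c b x • η z x := by
        have := h2 x hx; exact (add_left_cancel this).symm
      have hw := (wt_pos c b x).ne'
      have h5 : (rate c b x * wt c b x) • h x =
          R x (wt c b x • η z x) + (M z - M₀) (wt c b x • η z x) + R x (V z) := by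
        have hr := (rate_pos hc hb.le x).ne'
        simp only [h, BoundedContinuousFunction.add_apply, add_apply, hQR, hQ, hr₀,
          smul_apply, max_eq_left (mem_Ici.1 hx), smul_add, smul_smul,
          ContinuousLinearMap.map_smul_of_tower]
        rw [show rate c b x * wt c b x * ((rate c b x)⁻¹ * (wt c b x)⁻¹) = 1 by field_simp,
          one_smul, show rate c b x * wt c b x * (rate c b x)⁻¹ = wt c b x by field_simp]
      rw [h4, h5]
      have hMz : M z (V z + wt c b x • η z x) = M z (wt c b x • η z x) := by
        rw [map_add, hzV, zero_add]
      simp only [hMz, sub_apply, map_add]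
      abel
    -- The difference of two such solutions, divided by the weight, is a bounded fixed point of the
    -- contraction `T z`, hence zero.
    refine ⟨hS, hA, fun W' hW' hAW' => ?_⟩
    have hd := hW'.sub hS
    set ζ : ℝ → F := fun x => W' x - (V z + wt c b x • η z x) with hζ
    obtain ⟨K, hK⟩ : ∃ K, ∀ x, 0 ≤ x → ‖ζ x‖ ≤ K * wt c b x := by
      obtain ⟨K₁, h₁⟩ := (hVsol _).1 hAW'
      obtain ⟨K₂, h₂⟩ := (hVsol _).1 hA
      refine ⟨K₁ + K₂, fun x hx => ?_⟩
      have : ζ x = (W' x - V z) - ((V z + wt c b x • η z x) - V z) := by simp [hζ]; abel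
      rw [this, add_mul]
      exact (norm_sub_le _ _).trans (add_le_add (h₁ x hx) (h₂ x hx))
    have hζc : Continuous fun x => ζ (max x 0) := continuous_comp_max hd.continuousOn
    let e : ℝ →ᵇ F := BoundedContinuousFunction.ofNormedAddCommGroup (fun x => (wt c b (max x 0))⁻¹ • ζ (max x 0))
      (hwc.smul hζc) K (fun x => by
        have hw := wt_pos c b (max x 0)
        rw [norm_smul, norm_inv, Real.norm_of_nonneg hw.le, inv_mul_le_iff₀ hw, mul_comm]
        exact hK _ (le_max_right _ _))
    have he : ∀ x, e x = (wt c b (max x 0))⁻¹ • ζ (max x 0) := fun x => rfl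
    have hvol : ∀ x, 0 ≤ x → ζ x = volterra M₀ c b ((QR + Q (M z - M₀)) e) x := by
      intro x hx
      refine hM₀.eq_volterra hc hb.le _ (fun y hy => ?_) hK hx
      refine (hd y hy).congr_deriv ?_
      have hr := (rate_pos hc hb.le y).ne'
      have hw := (wt_pos c b y).ne'
      have h5 : (rate c b y * wt c b y) • ((QR + Q (M z - M₀)) e) y =
          R y (ζ y) + (M z - M₀) (ζ y) := by
        simp only [BoundedContinuousFunction.add_apply, add_apply, hQR, hQ, he,
          smul_apply, max_eq_left (mem_Ici.1 hy), smul_add,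
          ContinuousLinearMap.map_smul_of_tower]
        rw [hsc y hy, hsc y hy]
      rw [h5, sub_apply]; abel
    have heT : e = T z e := by
      ext x
      change e x = J ((QR + Q (M z - M₀)) e) x
      rw [hJ, he, hvol _ (le_max_right _ _)]
    have hn : ‖e‖ ≤ ‖T z‖ * ‖e‖ := by
      conv_lhs => rw [heT]
      exact ContinuousLinearMap.le_opNorm _ _
    have he0 : e = 0 := by
      by_contra hne
      have := norm_pos_iff.2 hne
      nlinarith
    intro x hx
    have := congrArg (fun f : ℝ →ᵇ F => f x) he0
    simp only [he, max_eq_left (mem_Ici.1 hx), BoundedContinuousFunction.coe_zero, Pi.zero_apply,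
      smul_eq_zero, inv_eq_zero, (wt_pos c b x).ne', false_or] at this
    exact sub_eq_zero.1 this

end AsymptoticallyConstant

end BoundaryLayer

end

/-! ### Uniqueness among convergent solutions, and analytic families of modes -/

noncomputable section

namespace BoundaryLayer

section Uniqueness

variable {F : Type*} [NormedAddCommGroup F] [NormedSpace ℂ F] [CompleteSpace F]
  [FiniteDimensional ℂ F]

theorem NonnegSpectrum.exists_flowBound {M : F →L[ℂ] F} (hM : NonnegSpectrum M) {c : ℝ}
    (hc : 0 < c) : ∃ C, FlowBound M c C := by
  obtain ⟨C, -, h⟩ := hM.exists_flow_bound (ε := c / 4) (by positivity)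
  exact ⟨C, h⟩

theorem exists_bound_of_tendsto {z : ℝ → F} (hz : ContinuousOn z (Ici 0)) {V : F}
    (h : Tendsto z atTop (𝓝 V)) : ∃ B, ∀ x, 0 ≤ x → ‖z x‖ ≤ B := by
  obtain ⟨X, hX⟩ := eventually_atTop.1 (h.norm.eventually_lt_const (lt_add_one ‖V‖))
  obtain ⟨B, hB⟩ := (isCompact_Icc (a := (0 : ℝ)) (b := X)).exists_bound_of_continuousOn
    (hz.mono Icc_subset_Ici_self)
  refine ⟨max B (‖V‖ + 1), fun x hx => ?_⟩
  rcases le_total x X with h' | h'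
  · exact (hB x ⟨hx, h'⟩).trans (le_max_left _ _)
  · exact (hX x h').le.trans (le_max_right _ _)

/-- No rate of convergence is assumed; it is recovered. As `z` is bounded, `R z` decays
exponentially, and subtracting the Volterra solution with this forcing leaves an orbit of the
constant system tending to `0`, which is trivial by the spectral hypothesis. Hence `z` decays at the
rate `c / 2`, and the local uniqueness statement compares it with the zero solution. -/
theorem IsSol.eq_zero_of_tendsto {R : ℝ → F →L[ℂ] F} {c C₁ : ℝ} (hc : 0 < c)
    (hR : IsDecaying R c C₁) {M : F →L[ℂ] F} (hM : NonnegSpectrum M) {z : ℝ → F}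
    (hz : IsSol M R z) (h0 : Tendsto z atTop (𝓝 0)) {x : ℝ} (hx : 0 ≤ x) : z x = 0 := by
  obtain ⟨C, hC⟩ := hM.exists_flowBound hc
  obtain ⟨B, hB⟩ := exists_bound_of_tendsto hz.continuousOn h0
  have hB0 : 0 ≤ B := (norm_nonneg _).trans (hB 0 le_rfl)
  have hC₁ : 0 ≤ C₁ := by
    have := (norm_nonneg _).trans (hR.bound 0 le_rfl); simpa using this
  have hmul : ∀ x, 0 < rate c 0 (max x 0) * wt c 0 (max x 0) := fun x =>
    mul_pos (rate_pos hc le_rfl _) (wt_pos _ _ _)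
  let h : BoundedContinuousFunction ℝ F := BoundedContinuousFunction.ofNormedAddCommGroup
    (fun x => (rate c 0 (max x 0) * wt c 0 (max x 0))⁻¹ • R (max x 0) (z (max x 0)))
    (((((continuous_rate c 0).mul (continuous_wt c 0)).comp (by fun_prop)).inv₀
      fun x => (hmul x).ne').smul
      ((continuous_comp_max hR.cont).clm_apply (continuous_comp_max hz.continuousOn)))
    (4 * C₁ / c * B) (fun x => by
      have h1 := hR.bound (max x 0) (le_max_right _ _)
      have h3 := exp_le_wt hc (le_refl 0) (max x 0)
      have h2 := rate_ge (c := c) (le_refl 0) (max x 0)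
      have h4 : Real.exp (-c * max x 0) ≤ Real.exp (-(c / 2) * max x 0) :=
        Real.exp_le_exp.2 (by nlinarith [le_max_right x 0])
      have hw := wt_pos c 0 (max x 0)
      rw [norm_smul, norm_inv, Real.norm_of_nonneg (hmul x).le, inv_mul_le_iff₀ (hmul x)]
      calc _ ≤ (C₁ * wt c 0 (max x 0)) * B :=
            (ContinuousLinearMap.le_opNorm _ _).trans (mul_le_mul
              (h1.trans (mul_le_mul_of_nonneg_left (h4.trans h3) hC₁)) (hB _ (le_max_right _ _))
              (norm_nonneg _) (by positivity))
        _ = (c / 4 * wt c 0 (max x 0)) * (4 * C₁ / c * B) := by field_simp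
        _ ≤ _ := by gcongr)
  have hh : ∀ x, h x =
      (rate c 0 (max x 0) * wt c 0 (max x 0))⁻¹ • R (max x 0) (z (max x 0)) := fun x => rfl
  have hd : ∀ x ∈ Ici (0 : ℝ), HasDerivWithinAt (fun x => z x - volterra M c 0 h x)
      (M (z x - volterra M c 0 h x)) (Ici 0) x := by
    intro x hx
    refine ((hz x hx).sub (hC.hasDerivAt_volterra hc le_rfl h x).hasDerivWithinAt).congr_deriv ?_
    have := (hmul x).ne'
    rw [max_eq_left (mem_Ici.1 hx)] at this
    rw [hh, max_eq_left (mem_Ici.1 hx), smul_smul, mul_inv_cancel₀ this, one_smul, map_sub]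
    abel
  have hw0 : Tendsto (wt c 0) atTop (𝓝 0) := by
    have : wt c 0 = fun t : ℝ => Real.exp (-(c / 2) * t) := by funext t; simp [wt]
    rw [this]
    exact Real.tendsto_exp_atBot.comp
      ((tendsto_const_mul_atBot_of_neg (by linarith)).2 tendsto_id)
  have hv0 : Tendsto (volterra M c 0 h) atTop (𝓝 0) := by
    refine squeeze_zero_norm (fun x => hC.norm_volterra_le hc le_rfl h) ?_
    simpa using hw0.const_mul (C * ‖h‖)
  have hy0 := hM.eq_zero_of_tendsto (y := z 0 - volterra M c 0 h 0) (by
    have := h0.sub hv0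
    rw [sub_zero] at this
    refine this.congr' ((eventually_ge_atTop 0).mono fun t ht => ?_)
    exact flow_apply_of_hasDeriv hd ht)
  have hzv : ∀ x, 0 ≤ x → z x = volterra M c 0 h x := fun x hx => by
    have := flow_apply_of_hasDeriv hd hx
    rw [hy0, map_zero, sub_eq_zero] at this
    exact this
  have hasy : IsAsymptotic c 0 z := ⟨C * ‖h‖, fun x hx => by
    rw [sub_zero, hzv x hx]
    refine (hC.norm_volterra_le hc le_rfl h).trans (le_of_eq ?_)
    simp [wt]⟩
  obtain ⟨W, -, hW⟩ := exists_local_solution (M := fun _ => M) (V := fun _ => 0) (z₀ := 0) hc hR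
    analyticAt_const analyticAt_const (by simp) hC
  obtain ⟨-, -, hu⟩ := hW.self_of_nhds
  have h1 := hu z hz hasy hx
  have h2 := hu (fun _ => 0) (fun x _ => by simpa using hasDerivWithinAt_const x _ (0 : F))
    ⟨0, by simp⟩ hx
  rw [h1, ← h2]

theorem IsSol.eqOn_of_tendsto {R : ℝ → F →L[ℂ] F} {c C₁ : ℝ} (hc : 0 < c)
    (hR : IsDecaying R c C₁) {M : F →L[ℂ] F} (hM : NonnegSpectrum M) {z w : ℝ → F} {V : F}
    (hz : IsSol M R z) (hw : IsSol M R w) (hzV : Tendsto z atTop (𝓝 V))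
    (hwV : Tendsto w atTop (𝓝 V)) : EqOn z w (Ici 0) := fun x hx =>
  sub_eq_zero.1 ((hz.sub hw).eq_zero_of_tendsto hc hR hM (by simpa using hzV.sub hwV) hx)

/-- A family of solutions converging to stationary vectors of the limiting systems, analytic in
the parameter. -/
theorem exists_analytic_solution {R : ℝ → F →L[ℂ] F} {c C₁ : ℝ} (hc : 0 < c)
    (hR : IsDecaying R c C₁) {M : ℂ → F →L[ℂ] F} {V : ℂ → F} {S : Set ℂ}
    (hM : ∀ z ∈ S, AnalyticAt ℂ M z) (hV : ∀ z ∈ S, AnalyticAt ℂ V z)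
    (hMV : ∀ z₀ ∈ S, ∀ᶠ z in 𝓝 z₀, M z (V z) = 0) (hspec : ∀ z ∈ S, NonnegSpectrum (M z)) :
    ∃ W : ℂ → ℝ → F, ∀ z ∈ S, AnalyticAt ℂ (fun z => W z 0) z ∧ IsSol (M z) R (W z) ∧
      Tendsto (W z) atTop (𝓝 (V z)) := by
  classical
  -- The family is chosen pointwise, without regard to analyticity. Near each `z₀` uniqueness
  -- identifies its value at `x = 0` with that of the local analytic family.
  let W : ℂ → ℝ → F := fun z =>
    if h : ∃ w, IsSol (M z) R w ∧ IsAsymptotic c (V z) w then h.choose else 0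
  refine ⟨W, fun z₀ hz₀ => ?_⟩
  obtain ⟨C, hC⟩ := (hspec z₀ hz₀).exists_flowBound hc
  obtain ⟨U, hU, hUe⟩ := exists_local_solution hc hR (hM z₀ hz₀) (hV z₀ hz₀) (hMV z₀ hz₀) hC
  have key : ∀ᶠ z in 𝓝 z₀, IsSol (M z) R (W z) ∧ IsAsymptotic c (V z) (W z) ∧
      W z 0 = U z 0 := by
    filter_upwards [hUe] with z ⟨h1, h2, h3⟩
    have hex : ∃ w, IsSol (M z) R w ∧ IsAsymptotic c (V z) w := ⟨U z, h1, h2⟩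
    have hWz : W z = hex.choose := dif_pos hex
    rw [hWz]
    exact ⟨hex.choose_spec.1, hex.choose_spec.2,
      h3 _ hex.choose_spec.1 hex.choose_spec.2 self_mem_Ici⟩
  refine ⟨hU.congr (key.mono fun z h => h.2.2.symm), key.self_of_nhds.1,
    key.self_of_nhds.2.1.tendsto hc⟩

end Uniqueness

end BoundaryLayer

end

noncomputable section

namespace BoundaryLayer

/-! ### The eigenvalues of the limiting matrices -/

theorem cpow_inv_two_sq (a : ℂ) : (a ^ (2⁻¹ : ℂ)) ^ 2 = a := by
  have := Complex.cpow_nat_inv_pow a (n := 2) (by norm_num)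
  exact_mod_cast this

theorem le_re_cpow_inv_two {m : ℝ} {a : ℂ} (ha : m ^ 2 ≤ a.re) :
    m ≤ (a ^ (2⁻¹ : ℂ)).re := by
  rw [Complex.cpow_inv_two_re]
  apply Real.le_sqrt_of_sq_le
  have := Complex.re_le_norm a
  linarith

/-- The rational parametrization of the spectral parameter by `T`, where `T ^ 2` is the sum of the
spectral parameter, of the eigenvalue and of `h`. -/
def specParam (k h : ℝ) (T : ℂ) : ℂ := T ^ 2 - k * T - h + h * k / T

/-- Injectivity, continuity and the derivative of the inverse branch all rest on this divided
difference. -/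
theorem specParam_sub (k h : ℝ) {S T : ℂ} (hS : S ≠ 0) (hT : T ≠ 0) :
    specParam k h S - specParam k h T = (S - T) * (S + T - k - h * k / (S * T)) := by
  unfold specParam; field_simp; ring

section Branch

variable {k h m : ℝ}

theorem ne_zero_of_re_pos {T : ℂ} (hm : 0 < m) (hT : m ≤ T.re) : T ≠ 0 := by
  rintro rfl; simp at hT; linarith

theorem le_norm_of_le_re {T : ℂ} (hT : m ≤ T.re) : m ≤ ‖T‖ := hT.trans (Complex.re_le_norm T)

theorem norm_div_le_of_le_re {S T : ℂ} (hk : 0 < k) (hh : 0 ≤ h) (hm : 0 < m) (hS : m ≤ S.re)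
    (hT : m ≤ T.re) : ‖(h * k / (S * T) : ℂ)‖ ≤ h * k / m ^ 2 := by
  rw [norm_div, norm_mul, norm_mul, Complex.norm_real, Complex.norm_real, Real.norm_of_nonneg hh,
    Real.norm_of_nonneg hk.le, sq]
  have h1 := le_norm_of_le_re hS
  have h2 := le_norm_of_le_re hT
  gcongr

/-- The hypothesis `k (m² + h) < 2 m³` says exactly that `h k / m² < 2 m - k`: on `Re ≥ m` the term
`S + T - k` dominates the fraction. -/
theorem re_divided_difference_pos {S T : ℂ} (hk : 0 < k) (hh : 0 ≤ h) (hm : 0 < m)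
    (hc : k * (m ^ 2 + h) < 2 * m ^ 3) (hS : m ≤ S.re) (hT : m ≤ T.re) :
    0 < (S + T - k - h * k / (S * T)).re := by
  have h1 := (Complex.re_le_norm _).trans (norm_div_le_of_le_re hk hh hm hS hT)
  have h2 : h * k / m ^ 2 < 2 * m - k := by rw [div_lt_iff₀ (by positivity)]; nlinarith
  simp only [Complex.sub_re, Complex.add_re, Complex.ofReal_re]
  linarith

theorem specParam_injOn (hk : 0 < k) (hh : 0 ≤ h) (hm : 0 < m)
    (hc : k * (m ^ 2 + h) < 2 * m ^ 3) : InjOn (specParam k h) {T | m ≤ T.re} := by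
  intro S hS T hT heq
  have h1 := specParam_sub k h (ne_zero_of_re_pos hm hS) (ne_zero_of_re_pos hm hT)
  rw [heq, sub_self, eq_comm, mul_eq_zero] at h1
  rcases h1 with h1 | h1
  · exact sub_eq_zero.1 h1
  · have := re_divided_difference_pos hk hh hm hc hS hT
    rw [h1] at this; simp at this

theorem re_div_le {T : ℂ} (hh : 0 ≤ h) (hT : 0 < T.re) : ((h : ℂ) / T).re ≤ h / T.re := by
  have h1 : (((h : ℂ) / T).re) = h * T.re / Complex.normSq T := by
    rw [Complex.div_re]; simp
  have h2 : T.re * T.re ≤ Complex.normSq T := by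
    rw [Complex.normSq_apply]; nlinarith [mul_self_nonneg T.im]
  rw [h1]
  calc _ ≤ h * T.re / (T.re * T.re) := by gcongr
    _ = _ := by field_simp

/-- The equation is `T² = h + z + k (T - h / T)`, solved by iterating the principal square root `Φ`
of the right-hand side. The lower bound on `Re z` makes `Φ` preserve the half-plane `Re T ≥ m`, and
the inequality on `m` makes the Lipschitz constant `k (1 + h/m²) / (2 m)` less than `1`. -/
theorem exists_specParam_eq (hk : 0 < k) (hh : 0 ≤ h) (hm : 0 < m)
    (hc : k * (m ^ 2 + h) < 2 * m ^ 3) {z : ℂ} (hz : -((m ^ 2 - h) * (k - m) / m) ≤ z.re) :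
    ∃ T : ℂ, m ≤ T.re ∧ specParam k h T = z := by
  let Φ : ℂ → ℂ := fun T => (h + z + k * (T - h / T)) ^ (2⁻¹ : ℂ)
  let s : Set ℂ := {T | m ≤ T.re}
  have hs : IsClosed s := isClosed_le continuous_const Complex.continuous_re
  have hmap : MapsTo Φ s s := by
    intro T hT
    have hT' : m ≤ T.re := hT
    refine le_re_cpow_inv_two ?_
    have h1 := re_div_le (T := T) hh (hm.trans_le hT)
    have h2 : h / T.re ≤ h / m := by gcongr
    have h3 : k * (m - h / m) ≤ k * (T.re - ((h : ℂ) / T).re) :=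
      mul_le_mul_of_nonneg_left (by linarith) hk.le
    have h4 : -((m ^ 2 - h) * (k - m) / m) = m ^ 2 - h - k * (m - h / m) := by
      field_simp; ring
    simp only [Complex.add_re, Complex.ofReal_re, Complex.re_ofReal_mul, Complex.sub_re]
    linarith
  have hK1 : k * (1 + h / m ^ 2) / (2 * m) < 1 := by
    rw [div_lt_one (by positivity)]
    have : k * (1 + h / m ^ 2) = k * (m ^ 2 + h) / m ^ 2 := by field_simp
    rw [this, div_lt_iff₀ (by positivity)]; nlinarith
  have hK0 : 0 ≤ k * (1 + h / m ^ 2) / (2 * m) := by positivity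
  have hlip : LipschitzWith ⟨k * (1 + h / m ^ 2) / (2 * m), hK0⟩ (hmap.restrict Φ s s) := by
    refine LipschitzWith.of_dist_le_mul fun S T => ?_
    obtain ⟨S, hS⟩ := S
    obtain ⟨T, hT⟩ := T
    have hS0 := ne_zero_of_re_pos hm hS
    have hT0 := ne_zero_of_re_pos hm hT
    change dist (Φ S) (Φ T) ≤ k * (1 + h / m ^ 2) / (2 * m) * dist S T
    rw [dist_eq_norm, dist_eq_norm]
    -- Square roots are compared through their squares; the sum `Φ S + Φ T` has real part at least
    -- `2 m`.
    have e1 : (Φ S - Φ T) * (Φ S + Φ T) = (S - T) * (k + h * k / (S * T)) := by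
      have a1 : Φ S ^ 2 = _ := cpow_inv_two_sq _
      have a2 : Φ T ^ 2 = _ := cpow_inv_two_sq _
      have : (Φ S - Φ T) * (Φ S + Φ T) = Φ S ^ 2 - Φ T ^ 2 := by ring
      rw [this, a1, a2]; field_simp; ring
    have e2 : 2 * m ≤ ‖Φ S + Φ T‖ := by
      refine le_trans ?_ (Complex.re_le_norm _)
      have := hmap hS; have := hmap hT
      simp only [s, Set.mem_ofPred_eq] at *
      rw [Complex.add_re]; linarith
    have e3 : ‖(k + h * k / (S * T) : ℂ)‖ ≤ k * (1 + h / m ^ 2) := by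
      refine (norm_add_le _ _).trans ?_
      have := norm_div_le_of_le_re hk hh hm hS hT
      rw [Complex.norm_real, Real.norm_of_nonneg hk.le]
      calc _ ≤ k + h * k / m ^ 2 := by linarith
        _ = _ := by ring
    have e4 := congrArg norm e1
    rw [norm_mul, norm_mul] at e4
    rw [div_mul_eq_mul_div, le_div_iff₀ (by positivity)]
    calc _ ≤ ‖Φ S - Φ T‖ * ‖Φ S + Φ T‖ := mul_le_mul_of_nonneg_left e2 (norm_nonneg _)
      _ = _ := e4
      _ ≤ _ := by rw [mul_comm]; exact mul_le_mul_of_nonneg_right e3 (norm_nonneg _)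
  obtain ⟨T, hT, hfix, -⟩ := ContractingWith.exists_fixedPoint' hs.isComplete hmap
    ⟨by exact_mod_cast hK1, hlip⟩ (x := (m : ℂ)) (by simp [s]) (edist_ne_top _ _)
  refine ⟨T, hT, ?_⟩
  have hT0 := ne_zero_of_re_pos hm hT
  have h1 : T ^ 2 = h + z + k * (T - h / T) := by
    have a1 : Φ T ^ 2 = _ := cpow_inv_two_sq _
    rwa [hfix.eq] at a1
  unfold specParam
  rw [h1]; field_simp; ring

/-- Dropping `-(Im T)²` and using `Re (h / T) ≤ h / Re T` bounds `Re T * Re (specParam k h T)` above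
by the product on the right. -/
theorem le_re_of_specParam {T : ℂ} (hk : 0 < k) (hh : 0 ≤ h) (hT : 0 < T.re)
    (hz : 0 ≤ (specParam k h T).re) : 0 ≤ (T.re - k) * (T.re ^ 2 - h) := by
  have h1 := re_div_le (T := T) hh hT
  have h2 : (specParam k h T).re = T.re ^ 2 - T.im ^ 2 - k * T.re - h + k * ((h : ℂ) / T).re := by
    have : specParam k h T = T ^ 2 - k * T - h + k * ((h : ℂ) / T) := by unfold specParam; ring
    rw [this]
    simp only [Complex.add_re, Complex.sub_re, Complex.ofReal_re, sq, Complex.mul_re,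
      Complex.ofReal_im, zero_mul, sub_zero]
  rw [h2] at hz
  have h3 : k * ((h : ℂ) / T).re ≤ k * (h / T.re) := mul_le_mul_of_nonneg_left h1 hk.le
  have h4 : 0 ≤ T.re ^ 2 - k * T.re - h + k * (h / T.re) := by nlinarith [sq_nonneg T.im]
  have h5 : (T.re - k) * (T.re ^ 2 - h) = T.re * (T.re ^ 2 - k * T.re - h + k * (h / T.re)) := by
    field_simp; ring
  rw [h5]; positivity

/-- The characteristic polynomial of the limiting matrix in terms of `T`. -/
theorem exists_param_of_root {v : ℝ} (hv : v = k ^ 2) (hk : 0 < k) (hh : 0 ≤ h) {z r : ℂ}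
    (hz : 0 ≤ z.re) (hr : 0 < r.re)
    (hroot : r ^ 3 + (z - (v - h : ℝ)) * r ^ 2 - 2 * z * v * r - v * z ^ 2 = 0) :
    ∃ T : ℂ, h < T.re ^ 2 ∧ 0 < T.re ∧ specParam k h T = z ∧ r = k * (T - h / T) := by
  set T : ℂ := (z + r + h) ^ (2⁻¹ : ℂ)
  have hT2 : T ^ 2 = z + r + h := cpow_inv_two_sq _
  have hre : h < (z + r + h).re := by simp; linarith
  have hT2re : h < T.re ^ 2 := by
    have : (T ^ 2).re = T.re ^ 2 - T.im ^ 2 := by simp [sq]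
    rw [hT2] at this
    nlinarith [sq_nonneg T.im]
  have hTre : 0 < T.re := by
    have h0 : 0 ≤ T.re := by
      rw [show T = (z + r + h) ^ (2⁻¹ : ℂ) from rfl, Complex.cpow_inv_two_re]; positivity
    rcases h0.lt_or_eq with h1 | h1
    · exact h1
    · rw [← h1] at hT2re; simp at hT2re; linarith
  have hT0 : T ≠ 0 := by rintro h0; rw [h0] at hTre; simp at hTre
  -- The cubic is `r² (r + z + h) - v (r + z)²`, a difference of two squares once `r + z + h = T²`.
  have key : (r * T - k * (T ^ 2 - h)) * (r * T + k * (T ^ 2 - h)) = 0 := by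
    have : (r * T - k * (T ^ 2 - h)) * (r * T + k * (T ^ 2 - h)) =
      r ^ 2 * T ^ 2 - k ^ 2 * (T ^ 2 - h) ^ 2 := by ring
    rw [this, hT2, ← hroot, hv]; push_cast; ring
  rcases mul_eq_zero.1 key with h1 | h1
  · have hrT : r = k * (T - h / T) := by field_simp; linear_combination h1
    refine ⟨T, hT2re, hTre, ?_, hrT⟩
    have : specParam k h T = T ^ 2 - h - k * (T - h / T) := by unfold specParam; ring
    rw [this, ← hrT, hT2]; ring
  -- The other sign gives `Re r ≤ 0`, because `(Re T)² > h` makes `Re (T - h / T)` nonnegative.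
  · exfalso
    have hrT : r = -(k * (T - h / T)) := by field_simp; linear_combination h1
    have h2 := re_div_le (T := T) hh hTre
    have h3 : h / T.re ≤ T.re := by rw [div_le_iff₀ hTre]; nlinarith
    rw [hrT] at hr
    simp only [Complex.neg_re, Complex.re_ofReal_mul, Complex.sub_re] at hr
    nlinarith

end Branch

/-- `T` is the analytic branch of the parameter that belongs to the eigenvalue of positive real
part, on a neighborhood `Re z > -δ` of the nonstable half-plane. -/
structure IsBranch (v h : ℝ) (δ : ℝ) (T : ℂ → ℂ) : Prop where
  pos : 0 < δ
  re_pos : ∀ z : ℂ, -δ < z.re → 0 < (T z).re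
  eq : ∀ z : ℂ, -δ < z.re → specParam (√v) h (T z) = z
  analytic : ∀ z : ℂ, -δ < z.re → AnalyticAt ℂ T z
  conj : ∀ z : ℂ, -δ < z.re → T (starRingEnd ℂ z) = starRingEnd ℂ (T z)
  sqrt_le : ∀ z : ℂ, 0 ≤ z.re → √v ≤ (T z).re
  le_sq : ∀ z : ℂ, 0 ≤ z.re → h ≤ (T z).re ^ 2
  root : ∀ z r : ℂ, 0 ≤ z.re → 0 < r.re →
    r ^ 3 + (z - (v - h : ℝ)) * r ^ 2 - 2 * z * v * r - v * z ^ 2 = 0 →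
    r = √v * (T z - h / T z)

/-- The condition `h ≠ v` is what allows continuation past the imaginary axis: a vertical line
strictly between `√v` and `√h` leaves a strip of positive width `δ`. For `Re z ≥ 0` the value of `T`
lies to the right of both square roots. -/
theorem exists_isBranch {v h : ℝ} (hv : 0 < v) (hh : 0 ≤ h) (hne : h ≠ v) :
    ∃ δ T, IsBranch v h δ T := by
  set k := √v with hkdef
  have hk : 0 < k := Real.sqrt_pos.2 hv
  have hvk : v = k ^ 2 := (Real.sq_sqrt hv.le).symm
  set q := √h with hqdef
  have hq : 0 ≤ q := Real.sqrt_nonneg h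
  have hhq : h = q ^ 2 := (Real.sq_sqrt hh).symm
  have hqk : q ≠ k := fun h0 => hne (by rw [hhq, hvk, h0])
  -- Take `m` just below the larger of `k` and `q` and above the smaller. Lying strictly between
  -- them makes `(m² - h) (k - m)` positive; the cubic inequality holds strictly at the larger of
  -- the two, hence also slightly below it.
  obtain ⟨m, hm, hc, hδ, hcase⟩ : ∃ m : ℝ, 0 < m ∧ k * (m ^ 2 + h) < 2 * m ^ 3 ∧
      0 < (m ^ 2 - h) * (k - m) / m ∧ ((k < m ∧ m < q) ∨ (q < m ∧ m < k)) := by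
    have hcont : ∀ x : ℝ, ContinuousAt (fun m : ℝ => 2 * m ^ 3 - k * (m ^ 2 + h)) x :=
      fun x => by fun_prop
    rcases lt_or_gt_of_ne hqk with hlt | hlt
    · have h1 : 0 < 2 * k ^ 3 - k * (k ^ 2 + h) := by
        have : 0 < k * (k ^ 2 - h) := mul_pos hk (by rw [hhq]; nlinarith)
        nlinarith
      have h2 := ((hcont k).eventually (lt_mem_nhds h1)).filter_mono
        (nhdsWithin_le_nhds (s := Iio k))
      obtain ⟨m, h3, h4⟩ := (h2.and (Ioo_mem_nhdsLT hlt)).exists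
      have hm : 0 < m := hq.trans_lt h4.1
      refine ⟨m, hm, by linarith, ?_, Or.inr h4⟩
      have : 0 < m ^ 2 - h := by rw [hhq]; nlinarith [h4.1]
      have := h4.2
      have : 0 < k - m := by linarith
      positivity
    · have hq' : 0 < q := hk.trans hlt
      have h1 : 0 < 2 * q ^ 3 - k * (q ^ 2 + h) := by
        rw [hhq]
        have : 0 < q ^ 2 * (q - k) := mul_pos (by positivity) (by linarith)
        nlinarith
      have h2 := ((hcont q).eventually (lt_mem_nhds h1)).filter_mono
        (nhdsWithin_le_nhds (s := Iio q))
      obtain ⟨m, h3, h4⟩ := (h2.and (Ioo_mem_nhdsLT hlt)).exists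
      have hm : 0 < m := hk.trans h4.1
      refine ⟨m, hm, by linarith, ?_, Or.inl h4⟩
      have h5 : m ^ 2 - h < 0 := by rw [hhq]; nlinarith [h4.2, h4.1]
      have := h4.1
      exact div_pos (mul_pos_of_neg_of_neg h5 (by linarith)) hm
  set δ := (m ^ 2 - h) * (k - m) / m with hδdef
  have hex : ∀ z : ℂ, ∃ T : ℂ, -δ < z.re → m ≤ T.re ∧ specParam k h T = z := fun z => by
    by_cases hz : -δ < z.re
    · obtain ⟨T, hT⟩ := exists_specParam_eq hk hh hm hc hz.le
      exact ⟨T, fun _ => hT⟩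
    · exact ⟨0, fun h => absurd h hz⟩
  choose T hT using hex
  have hinj := specParam_injOn hk hh hm hc
  have hopen : IsOpen {z : ℂ | -δ < z.re} := isOpen_lt continuous_const Complex.continuous_re
  have hT0 : ∀ z : ℂ, -δ < z.re → T z ≠ 0 := fun z hz => ne_zero_of_re_pos hm (hT z hz).1
  let dd : ℂ → ℂ → ℂ := fun z w => T z + T w - k - h * k / (T z * T w)
  have hdd : ∀ z w : ℂ, -δ < z.re → -δ < w.re → z - w = (T z - T w) * dd z w := by
    intro z w hz hw
    have := specParam_sub k h (hT0 z hz) (hT0 w hw)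
    rwa [(hT z hz).2, (hT w hw).2] at this
  have hddre : ∀ z w : ℂ, -δ < z.re → -δ < w.re → 2 * m - k - h * k / m ^ 2 ≤ ‖dd z w‖ := by
    intro z w hz hw
    have h1 := (Complex.re_le_norm _).trans
      (norm_div_le_of_le_re hk hh hm (hT z hz).1 (hT w hw).1)
    refine le_trans ?_ (Complex.re_le_norm _)
    have := (hT z hz).1
    have := (hT w hw).1
    simp only [dd, Complex.sub_re, Complex.add_re, Complex.ofReal_re]
    linarith
  have hd0 : 0 < 2 * m - k - h * k / m ^ 2 := by
    have : h * k / m ^ 2 < 2 * m - k := by rw [div_lt_iff₀ (by positivity)]; nlinarith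
    linarith
  have hTc : ∀ z : ℂ, -δ < z.re → ContinuousAt T z := by
    intro z hz
    rw [ContinuousAt, tendsto_iff_norm_sub_tendsto_zero]
    have h1 : Tendsto (fun w => ‖w - z‖ / (2 * m - k - h * k / m ^ 2)) (𝓝 z) (𝓝 0) := by
      have := ((tendsto_iff_norm_sub_tendsto_zero (f := fun w : ℂ => w)).1
        (tendsto_id (x := 𝓝 z))).div_const (2 * m - k - h * k / m ^ 2)
      simpa using this
    refine squeeze_zero' (Eventually.of_forall fun _ => norm_nonneg _) ?_ h1
    filter_upwards [hopen.mem_nhds hz] with w hw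
    rw [le_div_iff₀ hd0, hdd w z hw hz, norm_mul]
    exact mul_le_mul_of_nonneg_left (hddre w z hw hz) (norm_nonneg _)
  have hTd : ∀ z : ℂ, -δ < z.re → DifferentiableAt ℂ T z := by
    intro z hz
    -- Difference quotients of the inverse are reciprocals of divided differences, which are
    -- continuous and bounded away from zero.
    have h1 : HasDerivAt T (dd z z)⁻¹ z := by
      rw [hasDerivAt_iff_tendsto_slope]
      have h2 : Tendsto (fun w => (dd w z)⁻¹) (𝓝[≠] z) (𝓝 (dd z z)⁻¹) := by
        have hne : dd z z ≠ 0 := norm_pos_iff.1 (hd0.trans_le (hddre z z hz hz))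
        have hT' := hTc z hz
        have hTT : T z * T z ≠ 0 := mul_ne_zero (hT0 z hz) (hT0 z hz)
        have : ContinuousAt (fun w => (dd w z)⁻¹) z := by
          refine ContinuousAt.inv₀ ?_ hne
          exact ((hT'.add continuousAt_const).sub continuousAt_const).sub
            (continuousAt_const.div (hT'.mul continuousAt_const) hTT)
        exact this.tendsto.mono_left nhdsWithin_le_nhds
      refine h2.congr' ?_
      filter_upwards [self_mem_nhdsWithin, nhdsWithin_le_nhds (hopen.mem_nhds hz)] with w hw hw'
      have hne : dd w z ≠ 0 := norm_pos_iff.1 (hd0.trans_le (hddre w z hw' hz))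
      have hwz : w - z ≠ 0 := sub_ne_zero.2 hw
      rw [slope_def_field, eq_div_iff hwz, hdd w z hw' hz]
      field_simp
    exact h1.differentiableAt
  refine ⟨δ, T, ⟨hδ, fun z hz => hm.trans_le (hT z hz).1, fun z hz => (hT z hz).2, ?_, ?_, ?_, ?_,
    ?_⟩⟩
  · intro z hz
    exact DifferentiableOn.analyticAt (s := {z : ℂ | -δ < z.re})
      (fun w hw => (hTd w hw).differentiableWithinAt) (hopen.mem_nhds hz)
  · intro z hz
    have hz' : -δ < (starRingEnd ℂ z).re := by simpa using hz
    refine hinj (hT _ hz').1 (by simpa using (hT z hz).1) ?_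
    rw [(hT _ hz').2]
    have := congrArg (starRingEnd ℂ) (hT z hz).2
    rw [← this]; simp [specParam]
  · intro z hz
    have hz' : -δ < z.re := by linarith
    have h1 := (hT z hz').1
    -- A product of two factors is nonnegative, and `Re T ≥ m` already makes one of them positive;
    -- the other factor is therefore nonnegative. The bound on `(Re T)²` below uses the same
    -- dichotomy.
    have h2 := le_re_of_specParam hk hh (hm.trans_le h1) (by rw [(hT z hz').2]; exact hz)
    rcases hcase with ⟨a, b⟩ | ⟨a, b⟩
    · linarith
    · by_contra! hlt
      have : 0 < (T z).re ^ 2 - h := by rw [hhq]; nlinarith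
      nlinarith
  · intro z hz
    have hz' : -δ < z.re := by linarith
    have h1 := (hT z hz').1
    have h2 := le_re_of_specParam hk hh (hm.trans_le h1) (by rw [(hT z hz').2]; exact hz)
    rcases hcase with ⟨a, b⟩ | ⟨a, b⟩
    · by_contra! hlt
      have : 0 < (T z).re - k := by linarith
      nlinarith
    · rw [hhq]; nlinarith
  · intro z r hz hr hroot
    have hz' : -δ < z.re := by linarith
    obtain ⟨S, hS1, hS2, hS3, hS4⟩ := exists_param_of_root hvk hk hh hz hr hroot
    have h2 := le_re_of_specParam hk hh hS2 (by rw [hS3]; exact hz)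
    have hkS : k ≤ S.re := by
      by_contra! hlt; nlinarith
    have hqS : q < S.re := by rw [hhq] at hS1; exact lt_of_pow_lt_pow_left₀ 2 hS2.le hS1
    have hmS : m ≤ S.re := by
      rcases hcase with ⟨a, b⟩ | ⟨a, b⟩ <;> linarith
    have : S = T z := hinj hmS (hT z hz').1 (by rw [hS3, (hT z hz').2])
    rw [hS4, this]

end BoundaryLayer

end

noncomputable section

namespace BoundaryLayer

/-! ### Parity of the number of roots -/

/-- Moving in the positive real direction stays in the half-plane and eventually avoids `0`. Hence
identities known only on the closed half-plane minus the origin propagate to full neighborhoods,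
boundary points and `0` included. -/
theorem frequently_mem_nonstable {z : ℂ} (hz : z ∈ nonstable) :
    ∃ᶠ w in 𝓝[≠] z, w ∈ nonstable \ {0} := by
  have h1 : Tendsto (fun t : ℝ => z + t) (𝓝[>] 0) (𝓝[≠] z) := by
    refine tendsto_nhdsWithin_iff.2 ⟨?_, ?_⟩
    · have : ContinuousAt (fun t : ℝ => z + t) 0 := by fun_prop
      simpa [ContinuousAt] using this.tendsto.mono_left (nhdsWithin_le_nhds (s := Ioi 0))
    · filter_upwards [self_mem_nhdsWithin] with t ht
      have : (t : ℂ) ≠ 0 := by exact_mod_cast (ne_of_gt ht)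
      simpa using this
  refine h1.frequently (Eventually.frequently ?_)
  filter_upwards [self_mem_nhdsWithin] with t (ht : 0 < t)
  have hz' : 0 ≤ z.re := hz
  have hre : 0 < (z + t).re := by simp; linarith
  exact ⟨hre.le, fun h => by rw [mem_singleton_iff] at h; rw [h] at hre; simp at hre⟩

theorem eventuallyEq_of_eqOn_nonstable {f g : ℂ → ℂ} {z : ℂ} (hz : z ∈ nonstable)
    (hf : AnalyticAt ℂ f z) (hg : AnalyticAt ℂ g z) (h : EqOn f g (nonstable \ {0})) :
    f =ᶠ[𝓝 z] g :=
  (hf.frequently_eq_iff_eventually_eq hg).1 ((frequently_mem_nonstable hz).mono fun _ hw => h hw)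

theorem isPreconnected_nonstable : IsPreconnected nonstable :=
  (convex_halfSpace_re_ge 0).isPreconnected

theorem zero_mem_nonstable : (0 : ℂ) ∈ nonstable := le_refl (0 : ℝ)

theorem conj_mem_nonstable {z : ℂ} (hz : z ∈ nonstable) : starRingEnd ℂ z ∈ nonstable := by
  change 0 ≤ (starRingEnd ℂ z).re
  rw [Complex.conj_re]
  exact hz

theorem analyticAt_conj_conj {f : ℂ → ℂ} {z : ℂ} (hf : AnalyticAt ℂ f (starRingEnd ℂ z)) :
    AnalyticAt ℂ (fun w => starRingEnd ℂ (f (starRingEnd ℂ w))) z := by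
  rw [Complex.analyticAt_iff_eventually_differentiableAt] at hf ⊢
  have := (Complex.continuous_conj.tendsto z).eventually hf
  filter_upwards [this] with w hw
  have := hw.conj_conj
  simpa [Function.comp_def] using this

/-- The symmetry is given only on the half-plane, while orders at boundary points see a full
neighborhood. The identity theorem extends the symmetry, and a local factorization is then
conjugated. -/
theorem analyticOrderNatAt_conj {g : ℂ → ℂ} (hg : AnalyticOnNhd ℂ g nonstable)
    (hsym : ∀ z ∈ nonstable, g (starRingEnd ℂ z) = starRingEnd ℂ (g z))
    (htop : ∀ z ∈ nonstable, analyticOrderAt g z ≠ ⊤) {z : ℂ} (hz : z ∈ nonstable) :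
    analyticOrderNatAt g (starRingEnd ℂ z) = analyticOrderNatAt g z := by
  have hz' := conj_mem_nonstable hz
  obtain ⟨k, hk, hk0, hke⟩ := ((hg _ hz).analyticOrderAt_ne_top).1 (htop z hz)
  rw [(hg _ hz').analyticOrderNatAt_eq_iff (htop _ hz')]
  have hk' : AnalyticAt ℂ (fun w => starRingEnd ℂ (k (starRingEnd ℂ w))) (starRingEnd ℂ z) :=
    analyticAt_conj_conj (by simpa using hk)
  refine ⟨_, hk', by simpa using hk0, ?_⟩
  have h1 : g =ᶠ[𝓝 (starRingEnd ℂ z)] fun w => starRingEnd ℂ (g (starRingEnd ℂ w)) := by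
    refine eventuallyEq_of_eqOn_nonstable hz' (hg _ hz')
      (analyticAt_conj_conj (by simpa using hg _ hz)) fun w hw => ?_
    rw [hsym w hw.1]; simp
  have h2 : Tendsto (starRingEnd ℂ) (𝓝 (starRingEnd ℂ z)) (𝓝 z) := by
    simpa using Complex.continuous_conj.tendsto (starRingEnd ℂ z)
  filter_upwards [h1, h2.eventually hke] with w hw1 hw2
  rw [hw1, hw2]; simp

/-- Induction on the zeros: dividing by `(z - a)^n` with `0 < a < b` changes the relative sign of
the two endpoint values by `(-1)^n`. When no zero is left, the intermediate value theorem gives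
equal signs. -/
theorem sign_mul_pos_of_zeros (b : ℝ) (hb : 0 ≤ b) (s : Finset ℝ) : ∀ g : ℂ → ℂ,
    (∀ x ∈ Icc 0 b, AnalyticAt ℂ g (x : ℂ)) →
    (∀ x ∈ Icc 0 b, analyticOrderAt g (x : ℂ) ≠ ⊤) → (∀ x ∈ Icc 0 b, (g x).im = 0) →
    (∀ x ∈ s, 0 < x ∧ x < b) → (∀ x ∈ Icc 0 b, g x = 0 ↔ x ∈ s) →
    0 < (-1 : ℝ) ^ (∑ x ∈ s, analyticOrderNatAt g (x : ℂ)) * ((g 0).re * (g b).re) := by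
  classical
  induction s using Finset.induction_on with
  | empty =>
    intro g hg _ him _ hzero
    have hne : ∀ x ∈ Icc 0 b, (g x).re ≠ 0 := fun x hx h => by
      have : g x = 0 := Complex.ext h (him x hx)
      simpa using (hzero x hx).1 this
    have hcont : ContinuousOn (fun x : ℝ => (g x).re) (Icc 0 b) := fun x hx =>
      (Complex.continuous_re.continuousAt.comp ((hg x hx).continuousAt.comp
        Complex.continuous_ofReal.continuousAt)).continuousWithinAt
    simp only [Finset.sum_empty, pow_zero, one_mul]
    by_contra! hle
    have h0 := hne 0 ⟨le_rfl, hb⟩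
    have h1 := hne b ⟨hb, le_rfl⟩
    simp only [Complex.ofReal_zero] at h0
    have : (0 : ℝ) ∈ (fun x : ℝ => (g x).re) '' Icc 0 b := by
      rcases lt_or_gt_of_ne h0 with h2 | h2
      · refine intermediate_value_Icc hb hcont ⟨by simpa using h2.le, ?_⟩
        by_contra! h3
        nlinarith [mul_pos_of_neg_of_neg h2 h3]
      · refine intermediate_value_Icc' hb hcont ⟨?_, by simpa using h2.le⟩
        by_contra! h3
        nlinarith [mul_pos h2 h3]
    obtain ⟨x, hx, hx0⟩ := this
    exact hne x hx hx0
  | insert a s ha ih =>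
    intro g hg htop him hs hzero
    obtain ⟨ha0, hab⟩ := hs a (Finset.mem_insert_self _ _)
    have haI : a ∈ Icc 0 b := ⟨ha0.le, hab.le⟩
    obtain ⟨k, hk, hk0, hke⟩ := ((hg a haI).analyticOrderAt_ne_top).1 (htop a haI)
    set n := analyticOrderNatAt g (a : ℂ)
    -- The quotient takes its removable value at `a`; division by zero would give the wrong one when
    -- `n > 0`.
    let g₁ : ℂ → ℂ := fun z => if z = a then k a else g z / (z - a) ^ n
    have hg₁ne : ∀ z : ℂ, z ≠ a → g₁ z = g z / (z - a) ^ n := fun z hz => if_neg hz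
    have hg₁a : g₁ a = k a := if_pos rfl
    have hsub : ∀ x : ℝ, x ≠ a → ((x : ℂ) - a) ≠ 0 := fun x hx => by
      rw [sub_ne_zero]; exact_mod_cast hx
    have hnear : g₁ =ᶠ[𝓝 (a : ℂ)] k := by
      filter_upwards [hke] with z hz
      by_cases h : z = a
      · rw [h, hg₁a]
      · have : z - a ≠ 0 := sub_ne_zero.2 h
        rw [hg₁ne z h, hz, smul_eq_mul]; field_simp
    have hfar : ∀ x : ℝ, x ≠ a → g₁ =ᶠ[𝓝 (x : ℂ)] fun z => g z / (z - a) ^ n := fun x hx => by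
      have : ∀ᶠ z : ℂ in 𝓝 (x : ℂ), z ≠ (a : ℂ) := isOpen_ne.mem_nhds (show (x : ℂ) ≠ a by exact_mod_cast hx)
      exact this.mono fun z hz => hg₁ne z hz
    have han : ∀ x ∈ Icc 0 b, AnalyticAt ℂ g₁ (x : ℂ) := fun x hx => by
      by_cases h : x = a
      · rw [h]; exact hk.congr hnear.symm
      · refine AnalyticAt.congr ?_ (hfar x h).symm
        exact (hg x hx).div (by fun_prop) (pow_ne_zero _ (hsub x h))
    have hprod : ∀ z : ℂ, g z = (z - a) ^ n * g₁ z := fun z => by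
      by_cases h : z = a
      · have h1 := hke.self_of_nhds
        rw [h, hg₁a]; simpa using h1
      · have : z - a ≠ 0 := sub_ne_zero.2 h
        rw [hg₁ne z h]; field_simp
    have hprod' : g = (fun z : ℂ => (z - a) ^ n) * g₁ := funext hprod
    have hpan : ∀ x : ℂ, AnalyticAt ℂ (fun z : ℂ => (z - a) ^ n) x := fun x => by fun_prop
    have hord : ∀ x ∈ Icc 0 b, analyticOrderAt g (x : ℂ) =
        analyticOrderAt (fun z : ℂ => (z - a) ^ n) x + analyticOrderAt g₁ x := fun x hx => by
      conv_lhs => rw [hprod']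
      exact analyticOrderAt_mul (hpan x) (han x hx)
    have hord' : ∀ x ∈ Icc 0 b, x ≠ a → analyticOrderAt g (x : ℂ) = analyticOrderAt g₁ x :=
      fun x hx h => by
        rw [hord x hx, (hpan x).analyticOrderAt_eq_zero.2 (pow_ne_zero _ (hsub x h)), zero_add]
    have him₁ : ∀ x ∈ Icc 0 b, (g₁ x).im = 0 := by
      have h1 : ∀ x ∈ Icc 0 b, x ≠ a → (g₁ x).im = 0 := fun x hx h => by
        rw [hg₁ne x (by exact_mod_cast h)]
        have h2 : g x = ((g x).re : ℂ) := Complex.ext rfl (by simpa using him x hx)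
        rw [h2]
        have : (((g x).re : ℂ) / ((x : ℂ) - a) ^ n) = (((g x).re / (x - a) ^ n : ℝ) : ℂ) := by
          push_cast; rfl
        rw [this, Complex.ofReal_im]
      intro x hx
      by_cases h : x = a
      · rw [h]
        -- Reality of the quotient at `a` itself follows by continuity from neighboring real points.
        have hc : Tendsto (fun x : ℝ => (g₁ x).im) (𝓝[≠] a) (𝓝 (g₁ a).im) := by
          have : ContinuousAt (fun x : ℝ => (g₁ x).im) a :=
            Complex.continuous_im.continuousAt.comp ((han a haI).continuousAt.comp
              Complex.continuous_ofReal.continuousAt)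
          exact this.tendsto.mono_left nhdsWithin_le_nhds
        refine tendsto_nhds_unique hc (tendsto_const_nhds.congr' ?_)
        filter_upwards [self_mem_nhdsWithin, nhdsWithin_le_nhds (Icc_mem_nhds ha0 hab)] with y hy hyI
        exact (h1 y hyI hy).symm
      · exact h1 x hx h
    have hzero₁ : ∀ x ∈ Icc 0 b, g₁ x = 0 ↔ x ∈ s := fun x hx => by
      by_cases h : x = a
      · rw [h, hg₁a]; simp [hk0, ha]
      · have := hzero x hx
        rw [hprod, mul_eq_zero, Finset.mem_insert] at this
        simpa [pow_ne_zero _ (hsub x h), h] using this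
    have htop₁ : ∀ x ∈ Icc 0 b, analyticOrderAt g₁ (x : ℂ) ≠ ⊤ := fun x hx h => by
      apply htop x hx; rw [hord x hx, h, add_top]
    have key := ih g₁ han htop₁ him₁ (fun x hx => hs x (Finset.mem_insert_of_mem hx)) hzero₁
    rw [Finset.sum_insert ha]
    have hsum : ∑ x ∈ s, analyticOrderNatAt g (x : ℂ) = ∑ x ∈ s, analyticOrderNatAt g₁ (x : ℂ) := by
      refine Finset.sum_congr rfl fun x hx => ?_
      have h1 := hs x (Finset.mem_insert_of_mem hx)
      unfold analyticOrderNatAt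
      rw [hord' x ⟨h1.1.le, h1.2.le⟩ (fun h => ha (h ▸ hx))]
    rw [hsum, pow_add]
    have e0 : (g 0).re = (0 - a) ^ n * (g₁ 0).re := by
      rw [hprod]
      have : ((0 : ℂ) - a) ^ n = (((0 - a) ^ n : ℝ) : ℂ) := by push_cast; rfl
      rw [this, Complex.re_ofReal_mul]
    have eb : (g b).re = (b - a) ^ n * (g₁ b).re := by
      rw [hprod]
      have : ((b : ℂ) - a) ^ n = (((b - a) ^ n : ℝ) : ℂ) := by push_cast; rfl
      rw [this, Complex.re_ofReal_mul]
    rw [e0, eb]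
    have e1 : (0 - a) ^ n = (-1) ^ n * a ^ n := by rw [← mul_pow]; simp
    have e2 : ((-1 : ℝ) ^ n) * (-1) ^ n = 1 := by rw [← mul_pow]; simp
    have hpos : 0 < a ^ n * (b - a) ^ n := by
      have : 0 < b - a := by linarith
      positivity
    have := mul_pos hpos key
    rw [e1]
    calc _ < _ := this
      _ = ((-1 : ℝ) ^ n * (-1) ^ n) * (a ^ n * (b - a) ^ n *
        ((-1) ^ (∑ x ∈ s, analyticOrderNatAt g₁ (x : ℂ)) * ((g₁ 0).re * (g₁ b).re))) := by
          rw [e2, one_mul]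
      _ = _ := by ring

/-- Zeros cannot accumulate, since they lie in a compact half-disc and `g 0 ≠ 0`. Zeros off the real
axis pair with their conjugates at equal order. Those on the real axis lie in `(0, b)`, and equal
endpoint signs force an even count. -/
theorem evenRootCount_of_sign {g : ℂ → ℂ} (hg : AnalyticOnNhd ℂ g nonstable)
    (hsym : ∀ z ∈ nonstable, g (starRingEnd ℂ z) = starRingEnd ℂ (g z)) {b : ℝ} (hb : 0 ≤ b)
    (hbig : ∀ z ∈ nonstable, b ≤ ‖z‖ → g z ≠ 0) (hsign : 0 < (g 0).re * (g b).re) :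
    EvenRootCount g nonstable := by
  classical
  have h0 : g 0 ≠ 0 := fun h => by simp [h] at hsign
  have htop : ∀ z ∈ nonstable, analyticOrderAt g z ≠ ⊤ := fun z hz h => by
    rw [analyticOrderAt_eq_top] at h
    exact h0 (hg.eqOn_zero_of_preconnected_of_eventuallyEq_zero isPreconnected_nonstable hz h
      zero_mem_nonstable)
  have hfin : {z | z ∈ nonstable ∧ g z = 0}.Finite := by
    by_contra hinf
    obtain ⟨z, hzK, hz⟩ := Set.Infinite.exists_accPt_of_subset_isCompact hinf
      ((isCompact_closedBall (0 : ℂ) b).inter_left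
        (isClosed_le continuous_const Complex.continuous_re : IsClosed nonstable))
      (fun z hz => ⟨hz.1, by
        rw [mem_closedBall_zero_iff]
        by_contra! h
        exact hbig z hz.1 h.le hz.2⟩)
    refine h0 (hg.eqOn_zero_of_preconnected_of_frequently_eq_zero isPreconnected_nonstable hzK.1 ?_
      zero_mem_nonstable)
    rw [accPt_iff_frequently_nhdsNE] at hz
    exact hz.mono fun w hw => hw.2
  refine ⟨hfin, ?_⟩
  rw [finsum_mem_eq_finite_toFinset_sum _ hfin]
  set s := hfin.toFinset
  have hs : ∀ z, z ∈ s ↔ z ∈ nonstable ∧ g z = 0 := fun z => by simp [s]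
  have hconj : ∀ z ∈ s, starRingEnd ℂ z ∈ s := fun z hz => by
    rw [hs] at hz ⊢
    exact ⟨conj_mem_nonstable hz.1, by rw [hsym z hz.1, hz.2, map_zero]⟩
  rw [← Finset.sum_filter_add_sum_filter_not s (fun z => z.im = 0),
    ← Finset.sum_filter_add_sum_filter_not (s.filter fun z => ¬ z.im = 0) (fun z => 0 < z.im)]
  have hpair : ∑ z ∈ (s.filter fun z => ¬ z.im = 0).filter (fun z => ¬ 0 < z.im),
      analyticOrderNatAt g z =
      ∑ z ∈ (s.filter fun z => ¬ z.im = 0).filter (fun z => 0 < z.im), analyticOrderNatAt g z := by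
    refine Finset.sum_nbij' (starRingEnd ℂ) (starRingEnd ℂ) ?_ ?_ (by simp) (by simp) ?_
    · intro z hz
      simp only [Finset.mem_filter, not_lt] at hz ⊢
      exact ⟨⟨hconj z hz.1.1, by simpa using hz.1.2⟩,
        by simpa using lt_of_le_of_ne hz.2 hz.1.2⟩
    · intro z hz
      simp only [Finset.mem_filter, not_lt] at hz ⊢
      exact ⟨⟨hconj z hz.1.1, by simpa using hz.1.2⟩, by simpa using hz.2.le⟩
    · intro z hz
      simp only [Finset.mem_filter] at hz
      exact (analyticOrderNatAt_conj hg hsym htop ((hs z).1 hz.1.1).1).symm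
  rw [hpair]
  refine Even.add ?_ (Even.add_self _)
  have hreal : ∀ x ∈ Icc (0 : ℝ) b, (x : ℂ) ∈ nonstable := fun x hx => by
    change 0 ≤ (x : ℂ).re; simpa using hx.1
  let t : Finset ℝ := (s.filter fun z => z.im = 0).image Complex.re
  have ht : ∀ x : ℝ, x ∈ t ↔ (x : ℂ) ∈ s := fun x => by
    simp only [t, Finset.mem_image, Finset.mem_filter]
    constructor
    · rintro ⟨z, ⟨hz, hzi⟩, rfl⟩
      have : ((z.re : ℝ) : ℂ) = z := Complex.ext rfl (by simp [hzi])
      rwa [this]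
    · intro hx; exact ⟨x, ⟨hx, by simp⟩, by simp⟩
  have hsum : ∑ z ∈ s.filter (fun z => z.im = 0), analyticOrderNatAt g z =
      ∑ x ∈ t, analyticOrderNatAt g (x : ℂ) := by
    rw [Finset.sum_image]
    · refine Finset.sum_congr rfl fun z hz => ?_
      have : ((z.re : ℝ) : ℂ) = z := Complex.ext rfl (by simp [(Finset.mem_filter.1 hz).2])
      rw [this]
    · intro z hz w hw h
      exact Complex.ext h (by rw [(Finset.mem_filter.1 hz).2, (Finset.mem_filter.1 hw).2])
  have key := sign_mul_pos_of_zeros b hb t g (fun x hx => hg _ (hreal x hx))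
    (fun x hx => htop _ (hreal x hx)) (fun x hx => by
      have := hsym x (hreal x hx)
      rw [Complex.conj_ofReal] at this
      exact Complex.conj_eq_iff_im.1 this.symm)
    (fun x hx => by
      rw [ht, hs] at hx
      have h1 : 0 ≤ x := by simpa using (show 0 ≤ (x : ℂ).re from hx.1)
      refine ⟨lt_of_le_of_ne h1 fun h => h0 ?_, ?_⟩
      · have := hx.2; rwa [← h, Complex.ofReal_zero] at this
      · by_contra! h
        exact hbig x hx.1 (by rwa [Complex.norm_real, Real.norm_of_nonneg h1]) hx.2)
    (fun x hx => by rw [ht, hs]; simp [hreal x hx])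
  rw [hsum]
  by_contra hodd
  rw [Nat.not_even_iff_odd] at hodd
  rw [hodd.neg_one_pow] at key
  linarith

/-- The origin is excluded because `a` may vanish there, as it does when the Evans function has a
zero at `0`; `g 0 ≠ 0` ensures that removing it loses no zero of `g`. -/
theorem EvenRootCount.of_factor {g D a : ℂ → ℂ} (hg : AnalyticOnNhd ℂ g nonstable)
    (hD : AnalyticOnNhd ℂ D nonstable) (ha : AnalyticOnNhd ℂ a nonstable)
    (ha0 : ∀ z ∈ nonstable \ {0}, a z ≠ 0) (hDg : EqOn D (fun z => a z * g z) (nonstable \ {0}))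
    (h0 : g 0 ≠ 0) (h : EvenRootCount g nonstable) : EvenRootCount D (nonstable \ {0}) := by
  have hset : {z | z ∈ nonstable \ {0} ∧ D z = 0} = {z | z ∈ nonstable ∧ g z = 0} := by
    ext z
    constructor
    · rintro ⟨hz, hz0⟩
      rw [hDg hz, mul_eq_zero] at hz0
      exact ⟨hz.1, hz0.resolve_left (ha0 z hz)⟩
    · rintro ⟨hz, hz0⟩
      have hz' : z ∈ nonstable \ {0} := ⟨hz, fun h => h0 (by rwa [mem_singleton_iff.1 h] at hz0)⟩
      exact ⟨hz', by rw [hDg hz']; simp [hz0]⟩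
  unfold EvenRootCount
  rw [hset]
  refine ⟨h.1, ?_⟩
  convert h.2 using 1
  refine finsum_mem_congr rfl fun z hz => ?_
  have hz' : z ∈ nonstable \ {0} := by
    refine ⟨hz.1, fun h => h0 ?_⟩
    have := hz.2
    rwa [mem_singleton_iff.1 h] at this
  unfold analyticOrderNatAt
  rw [analyticOrderAt_congr (eventuallyEq_of_eqOn_nonstable hz.1 (hD z hz.1)
    ((ha z hz.1).mul (hg z hz.1)) hDg)]
  have : analyticOrderAt (a * g) z = analyticOrderAt a z + analyticOrderAt g z :=
    analyticOrderAt_mul (ha z hz.1) (hg z hz.1)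
  rw [this, (ha z hz.1).analyticOrderAt_eq_zero.2 (ha0 z hz'), zero_add]

theorem EvenRootCount.of_diff {D : ℂ → ℂ} (h0 : D 0 ≠ 0) (h : EvenRootCount D (nonstable \ {0})) :
    EvenRootCount D nonstable := by
  have : {z | z ∈ nonstable \ {0} ∧ D z = 0} = {z | z ∈ nonstable ∧ D z = 0} := by
    ext z
    exact ⟨fun h => ⟨h.1.1, h.2⟩, fun h => ⟨⟨h.1, fun h' => h0 (by
      have := h.2; rwa [mem_singleton_iff.1 h'] at this)⟩, h.2⟩⟩
  unfold EvenRootCount at h ⊢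
  rwa [this] at h

theorem deriv_eq_of_factor {g D a : ℂ → ℂ} (hg : AnalyticOnNhd ℂ g nonstable)
    (hD : AnalyticOnNhd ℂ D nonstable) (ha : AnalyticOnNhd ℂ a nonstable)
    (hDg : EqOn D (fun z => z * a z * g z) (nonstable \ {0})) : deriv D 0 = a 0 * g 0 := by
  have h0 := zero_mem_nonstable
  have ha' := ha 0 h0
  have hg' := hg 0 h0
  have h1 := eventuallyEq_of_eqOn_nonstable h0 (hD 0 h0)
    ((analyticAt_id.mul ha').mul hg') hDg
  rw [h1.deriv_eq]
  have := (((hasDerivAt_id (0 : ℂ)).mul ha'.differentiableAt.hasDerivAt).mul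
    hg'.differentiableAt.hasDerivAt).deriv
  simpa using this

end BoundaryLayer

end

noncomputable section

namespace BoundaryLayer

/-! ### Lyapunov functions for large spectral parameters -/

/-- A nondecreasing function with limit `0` is nonpositive, and a zero would force it to vanish
identically from there on, contradicting a nonzero derivative somewhere beyond. -/
theorem neg_of_deriv_nonneg {N dN : ℝ → ℝ}
    (hd : ∀ x ∈ Ici (0 : ℝ), HasDerivWithinAt N (dN x) (Ici 0) x) (h0 : ∀ x, 0 ≤ x → 0 ≤ dN x)
    (hlim : Tendsto N atTop (𝓝 0)) (hstrict : ∀ X, 0 ≤ X → ∃ x, X < x ∧ dN x ≠ 0) {x : ℝ}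
    (hx : 0 ≤ x) : N x < 0 := by
  have hmono : MonotoneOn N (Ici 0) := by
    refine monotoneOn_of_hasDerivWithinAt_nonneg (f' := dN) (convex_Ici 0)
      (fun x hx => (hd x hx).continuousWithinAt) ?_ ?_
    · intro x hx
      exact (hd x (interior_subset hx)).mono interior_subset
    · intro x hx
      exact h0 x (interior_subset hx)
  have hle : ∀ y, 0 ≤ y → N y ≤ 0 := fun y hy => by
    refine ge_of_tendsto hlim ((eventually_ge_atTop y).mono fun t ht => ?_)
    exact hmono hy (hy.trans ht) ht
  refine lt_of_le_of_ne (hle x hx) fun hN => ?_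
  obtain ⟨y, hxy, hy⟩ := hstrict x hx
  have hy0 : 0 < y := hx.trans_lt hxy
  have h1 : HasDerivAt N (dN y) y := (hd y hy0.le).hasDerivAt (Ici_mem_nhds hy0)
  have h2 : N =ᶠ[𝓝 y] fun _ => 0 := by
    filter_upwards [Ioi_mem_nhds hxy] with t ht
    have ht' : x < t := ht
    refine le_antisymm (hle t (hx.trans ht'.le)) ?_
    rw [← hN]; exact hmono hx (hx.trans ht'.le) ht'.le
  exact hy (h1.unique ((hasDerivAt_const y (0 : ℝ)).congr_of_eventuallyEq h2))

/-- A rotation that makes a nonstable number comparable to its real part. -/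
structure IsRotation (z η : ℂ) : Prop where
  re_eq : η.re = 1
  norm_le : ‖η‖ ≤ 2
  le_re : ‖z‖ ≤ (η * z).re

/-- With `η = 1 ∓ i`, according to the sign of `Im z`, the real part of `η z` is `Re z + |Im z|`,
which is at least `|z|`. -/
theorem exists_isRotation {z : ℂ} (hz : 0 ≤ z.re) : ∃ η, IsRotation z η := by
  have h1 := Complex.norm_le_abs_re_add_abs_im z
  rw [abs_of_nonneg hz] at h1
  have h2 : ‖(1 : ℂ) - Complex.I‖ ≤ 2 := (norm_sub_le _ _).trans (by norm_num)
  have h3 : ‖(1 : ℂ) + Complex.I‖ ≤ 2 := (norm_add_le _ _).trans (by norm_num)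
  rcases le_total 0 z.im with h | h
  · rw [abs_of_nonneg h] at h1
    exact ⟨1 - Complex.I, by simp, h2, by simp; linarith⟩
  · rw [abs_of_nonpos h] at h1
    exact ⟨1 + Complex.I, by simp, h3, by simp; linarith⟩

theorem IsRotation.neg_le_re {z η : ℂ} (h : IsRotation z η) (w : ℂ) : -(2 * ‖w‖) ≤ (η * w).re := by
  have h1 := neg_le_of_abs_le ((Complex.abs_re_le_norm (η * w)).trans_eq (norm_mul _ _))
  have := mul_le_mul_of_nonneg_right h.norm_le (norm_nonneg w)
  linarith

theorem IsRotation.re_le {z η : ℂ} (h : IsRotation z η) (w : ℂ) : (η * w).re ≤ 2 * ‖w‖ := by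
  have h1 := (Complex.re_le_norm (η * w)).trans_eq (norm_mul _ _)
  have := mul_le_mul_of_nonneg_right h.norm_le (norm_nonneg w)
  linarith

theorem mul_conj_eq (w : ℂ) : w * starRingEnd ℂ w = ((‖w‖ ^ 2 : ℝ) : ℂ) := by
  rw [Complex.mul_conj, Complex.normSq_eq_norm_sq]

theorem IsRotation.re_mul_conj_self {z η : ℂ} (h : IsRotation z η) (w : ℂ) :
    (η * (w * starRingEnd ℂ w)).re = ‖w‖ ^ 2 := by
  rw [mul_conj_eq, Complex.re_mul_ofReal, h.re_eq, one_mul]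

theorem neg_norm_le_re (w : ℂ) : -‖w‖ ≤ w.re := neg_le_of_abs_le (Complex.abs_re_le_norm w)

theorem hasDerivWithinAt_re_mul_conj {f g : ℝ → ℂ} {f' g' η : ℂ} {s : Set ℝ} {x : ℝ}
    (hf : HasDerivWithinAt f f' s x) (hg : HasDerivWithinAt g g' s x) :
    HasDerivWithinAt (fun x => (η * (f x * starRingEnd ℂ (g x))).re)
      (η * (f' * starRingEnd ℂ (g x) + f x * starRingEnd ℂ g')).re s x := by
  have h1 := (hf.mul hg.star).const_mul η
  exact Complex.reCLM.hasFDerivAt.comp_hasDerivWithinAt x h1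

/-- The cross terms are absorbed by completing squares. Among the summands required of `L`, `4` pays
for `v a b`, `2 (h₁ + 1)` for `v b²`, `2 m² / h₀²` for the combined `v ω b` terms, and the final `1`
is the surplus kept on the left. -/
theorem inflow_rate_bound_aux {h₀ h₁ C v a b ω L m : ℝ} (hh₀ : 0 < h₀) (hv : 0 < v) (hv1 : v ≤ 1)
    (hL : 4 + 2 * (h₁ + 1) + 2 * m ^ 2 / h₀ ^ 2 + 1 ≤ L) (hm : m = 2 + h₀ * C / 2) :
    a ^ 2 / 4 + h₀ ^ 2 * ω ^ 2 / 4 + v * b ^ 2 ≤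
      a ^ 2 + v * b ^ 2 * L - 2 * (v * a * b) - 2 * (v * (h₁ + 1) * b * b) - 2 * (v * ω * b) +
        h₀ / 2 * (h₀ * ω ^ 2 - C * v * b * ω - a * ω) := by
  have b8 : v * b ^ 2 * (4 + 2 * (h₁ + 1) + 2 * m ^ 2 / h₀ ^ 2 + 1) ≤ v * b ^ 2 * L :=
    mul_le_mul_of_nonneg_left hL (by positivity)
  have hvb : (v * b) ^ 2 ≤ v * b ^ 2 := by
    rw [mul_pow]
    exact mul_le_mul_of_nonneg_right (by nlinarith) (sq_nonneg b)
  have c1 : h₀ / 2 * (a * ω) ≤ a ^ 2 / 2 + h₀ ^ 2 * ω ^ 2 / 8 := by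
    have := sq_nonneg (a - h₀ * ω / 2)
    have h2 : (a - h₀ * ω / 2) ^ 2 = a ^ 2 - h₀ * (a * ω) + h₀ ^ 2 * ω ^ 2 / 4 := by ring
    linarith
  have c2 : 2 * (v * a * b) ≤ a ^ 2 / 4 + 4 * (v * b ^ 2) := by
    have h1 := sq_nonneg (a / 2 - 2 * (v * b))
    have h2 : (a / 2 - 2 * (v * b)) ^ 2 = a ^ 2 / 4 - 2 * (v * a * b) + 4 * (v * b) ^ 2 := by ring
    linarith
  have c3 : m * (v * ω * b) ≤ h₀ ^ 2 * ω ^ 2 / 8 + v * b ^ 2 * (2 * m ^ 2 / h₀ ^ 2) := by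
    have h1 : h₀ ^ 2 * ω ^ 2 / 8 + (v * b) ^ 2 * (2 * m ^ 2 / h₀ ^ 2) - m * (v * ω * b) =
        2 * (h₀ * ω / 4 - m * (v * b) / h₀) ^ 2 := by field_simp; ring
    have h2 := sq_nonneg (h₀ * ω / 4 - m * (v * b) / h₀)
    have h3 := mul_le_mul_of_nonneg_right hvb (by positivity : 0 ≤ 2 * m ^ 2 / h₀ ^ 2)
    linarith
  have c4 : m * (v * ω * b) = 2 * (v * ω * b) + h₀ / 2 * (C * v * b * ω) := by rw [hm]; ring
  have c5 : h₀ / 2 * (h₀ * ω ^ 2 - C * v * b * ω - a * ω) =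
    h₀ ^ 2 * ω ^ 2 / 2 - h₀ / 2 * (C * v * b * ω) - h₀ / 2 * (a * ω) := by ring
  rw [c5]
  have c6 : 0 ≤ a ^ 2 := sq_nonneg a
  linarith

/-- The gain has three sources: rotation turns `v z |P|²` into at least `v |z| |P|²`; the term `p *
conj p` gives exactly `|p|²` because `Re η = 1`; and `|w|²` grows at a rate at least `2 h₀`. The
factor `v` in the bound on `E` lets `|z|` absorb its coupling to `P`. -/
theorem inflow_rate_bound {h₀ h₁ C : ℝ} (hh₀ : 0 < h₀) {z η θ E p P w : ℂ} {v h : ℝ}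
    (hη : IsRotation z η) (hz : 0 ≤ z.re)
    (hL : 4 + 2 * (h₁ + 1) + 2 * (2 + h₀ * C / 2) ^ 2 / h₀ ^ 2 + 1 ≤ ‖z‖)
    (hv : 0 < v) (hv1 : v ≤ 1) (hh : h₀ ≤ h) (hh' : h ≤ h₁) (hθ : ‖θ‖ ≤ 1) (hE : ‖E‖ ≤ C * v) :
    ‖p‖ ^ 2 / 4 + h₀ ^ 2 * ‖w‖ ^ 2 / 4 + v * ‖P‖ ^ 2 ≤
      (η * ((v * z * P - v * p - v * (h - θ) * P - v * w) * starRingEnd ℂ P +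
        p * starRingEnd ℂ p)).re +
      h₀ / 4 * (1 * (((z + h) * w + E * P + θ * p) * starRingEnd ℂ w +
        w * starRingEnd ℂ ((z + h) * w + E * P + θ * p))).re := by
  have e1 : (η * ((v * z * P - v * p - v * (h - θ) * P - v * w) * starRingEnd ℂ P +
        p * starRingEnd ℂ p)).re = ‖p‖ ^ 2 + v * ‖P‖ ^ 2 * (η * z).re +
        (η * (-(v * p * starRingEnd ℂ P))).re +
        (η * (-(v * (h - θ) * P * starRingEnd ℂ P))).re +
        (η * (-(v * w * starRingEnd ℂ P))).re := by
    have : η * ((v * z * P - v * p - v * (h - θ) * P - v * w) * starRingEnd ℂ P +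
        p * starRingEnd ℂ p) = η * (p * starRingEnd ℂ p) + (v : ℂ) * (P * starRingEnd ℂ P) * (η * z) +
        η * (-(v * p * starRingEnd ℂ P)) + η * (-(v * (h - θ) * P * starRingEnd ℂ P)) +
        η * (-(v * w * starRingEnd ℂ P)) := by ring
    rw [this, mul_conj_eq P]
    simp only [Complex.add_re, hη.re_mul_conj_self]
    congr 3
    rw [← Complex.ofReal_mul, Complex.re_ofReal_mul]
  have e2 : (1 * (((z + h) * w + E * P + θ * p) * starRingEnd ℂ w +
        w * starRingEnd ℂ ((z + h) * w + E * P + θ * p))).re =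
        2 * ((z.re + h) * ‖w‖ ^ 2 + (E * P * starRingEnd ℂ w).re +
          (θ * p * starRingEnd ℂ w).re) := by
    have h1 : ∀ a : ℂ, (1 * (a * starRingEnd ℂ w + w * starRingEnd ℂ a)).re =
        2 * (a * starRingEnd ℂ w).re := fun a => by
      simp only [one_mul, Complex.add_re, Complex.mul_re, Complex.conj_re, Complex.conj_im]; ring
    rw [h1]
    have : ((z + h) * w + E * P + θ * p) * starRingEnd ℂ w =
      (z + h) * (w * starRingEnd ℂ w) + E * P * starRingEnd ℂ w + θ * p * starRingEnd ℂ w := by ring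
    rw [this, mul_conj_eq, Complex.add_re, Complex.add_re, Complex.re_mul_ofReal]
    simp
  rw [e1, e2]
  have b1 : -(2 * (v * ‖p‖ * ‖P‖)) ≤ (η * (-(v * p * starRingEnd ℂ P))).re := by
    have := hη.neg_le_re (-(v * p * starRingEnd ℂ P))
    rwa [norm_neg, norm_mul, norm_mul, Complex.norm_real, Real.norm_of_nonneg hv.le,
      RCLike.norm_conj] at this
  have b2 : -(2 * (v * (h₁ + 1) * ‖P‖ * ‖P‖)) ≤
      (η * (-(v * (h - θ) * P * starRingEnd ℂ P))).re := by
    have := hη.neg_le_re (-(v * (h - θ) * P * starRingEnd ℂ P))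
    refine le_trans ?_ this
    have hn : ‖(h - θ : ℂ)‖ ≤ h₁ + 1 := by
      refine (norm_sub_le _ _).trans (add_le_add ?_ hθ)
      rw [Complex.norm_real, Real.norm_of_nonneg (by linarith)]; exact hh'
    rw [norm_neg, norm_mul, norm_mul, norm_mul, Complex.norm_real, Real.norm_of_nonneg hv.le,
      RCLike.norm_conj]
    gcongr
  have b3 : -(2 * (v * ‖w‖ * ‖P‖)) ≤ (η * (-(v * w * starRingEnd ℂ P))).re := by
    have := hη.neg_le_re (-(v * w * starRingEnd ℂ P))
    rwa [norm_neg, norm_mul, norm_mul, Complex.norm_real, Real.norm_of_nonneg hv.le,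
      RCLike.norm_conj] at this
  have b4 : -(C * v * ‖P‖ * ‖w‖) ≤ (E * P * starRingEnd ℂ w).re := by
    refine le_trans ?_ (neg_norm_le_re _)
    rw [norm_mul, norm_mul, RCLike.norm_conj]
    gcongr
  have b5 : -(‖p‖ * ‖w‖) ≤ (θ * p * starRingEnd ℂ w).re := by
    refine le_trans ?_ (neg_norm_le_re _)
    rw [norm_mul, norm_mul, RCLike.norm_conj, mul_assoc]
    exact neg_le_neg (mul_le_of_le_one_left (by positivity) hθ)
  have b6 : v * ‖P‖ ^ 2 * ‖z‖ ≤ v * ‖P‖ ^ 2 * (η * z).re :=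
    mul_le_mul_of_nonneg_left hη.le_re (by positivity)
  have b7 : h₀ * ‖w‖ ^ 2 ≤ (z.re + h) * ‖w‖ ^ 2 :=
    mul_le_mul_of_nonneg_right (by linarith) (by positivity)
  have b8 := inflow_rate_bound_aux (a := ‖p‖) (b := ‖P‖) (ω := ‖w‖) hh₀ hv hv1 hL rfl
  have b9 := mul_le_mul_of_nonneg_left (add_le_add (add_le_add b7 b4) b5)
    (by positivity : 0 ≤ h₀ / 2)
  have b10 : h₀ / 4 * (2 * ((z.re + h) * ‖w‖ ^ 2 + (E * P * starRingEnd ℂ w).re +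
      (θ * p * starRingEnd ℂ w).re)) = h₀ / 2 * ((z.re + h) * ‖w‖ ^ 2 +
      (E * P * starRingEnd ℂ w).re + (θ * p * starRingEnd ℂ w).re) := by ring
  rw [b10]
  have b11 : h₀ * ‖w‖ ^ 2 - C * v * ‖P‖ * ‖w‖ - ‖p‖ * ‖w‖ =
    h₀ * ‖w‖ ^ 2 + -(C * v * ‖P‖ * ‖w‖) + -(‖p‖ * ‖w‖) := by ring
  rw [b11] at b8
  linarith

/-- The coefficients of an inflow problem on the half-line `x ≥ 0`. -/
structure InflowCoeff (v h dh : ℝ → ℝ) (h₀ h₁ : ℝ) : Prop where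
  h₀_pos : 0 < h₀
  v_pos : ∀ x, 0 ≤ x → 0 < v x
  v_le : ∀ x, 0 ≤ x → v x ≤ 1
  le_h : ∀ x, 0 ≤ x → h₀ ≤ h x
  h_le : ∀ x, 0 ≤ x → h x ≤ h₁
  deriv : ∀ x ∈ Ici (0 : ℝ), HasDerivWithinAt h (dh x) (Ici 0) x

/-- The adjoint eigenvalue system, conjugated and written in components. -/
structure InflowSystem (v h : ℝ → ℝ) (z : ℂ) (p q s : ℝ → ℂ) : Prop where
  dp : ∀ x ∈ Ici (0 : ℝ), HasDerivWithinAt p (-(v x * s x)) (Ici 0) x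
  dq : ∀ x ∈ Ici (0 : ℝ), HasDerivWithinAt q (-(z * p x) - v x * s x) (Ici 0) x
  ds : ∀ x ∈ Ici (0 : ℝ),
    HasDerivWithinAt s (-(z * (p x + q x)) + (z - (v x - h x)) * s x) (Ici 0) x

/-- The variable `P = (p - q) / z` satisfies `P' = p`, and `w` is `s` corrected so that `w' = (z +
h) w + E P + θ p`. The number `θ` is free. Where `v` is bounded below, `θ = 0` is enough; where `v →
0` it must be tuned so that `E` vanishes along with `v`. -/
theorem InflowSystem.re_neg {v h dh : ℝ → ℝ} {h₀ h₁ C : ℝ} (hc : InflowCoeff v h dh h₀ h₁)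
    {z η θ : ℂ} (hη : IsRotation z η) (hz : 0 ≤ z.re)
    (hL : 4 + 2 * (h₁ + 1) + 2 * (2 + h₀ * C / 2) ^ 2 / h₀ ^ 2 + 1 ≤ ‖z‖) (hθ : ‖θ‖ ≤ 1)
    (hE : ∀ x, 0 ≤ x → ‖((h x ^ 2 - dh x : ℝ) - (z + h x) * θ : ℂ)‖ ≤ C * v x)
    {p q s : ℝ → ℂ} (hs : InflowSystem v h z p q s)
    (hlim₁ : Tendsto (fun x => p x * starRingEnd ℂ ((p x - q x) / z)) atTop (𝓝 0))
    (hlim₂ : Tendsto (fun x => s x - q x - (h x - θ) * ((p x - q x) / z)) atTop (𝓝 0))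
    (hne : ∀ X : ℝ, ∃ x, X < x ∧ ¬ (p x = 0 ∧ q x = 0 ∧ s x = 0)) {x : ℝ} (hx : 0 ≤ x) :
    (η * (p x * starRingEnd ℂ ((p x - q x) / z))).re < 0 := by
  have hz0 : z ≠ 0 := by
    rintro rfl
    have h1 := (hc.h₀_pos.le.trans (hc.le_h 0 le_rfl)).trans (hc.h_le 0 le_rfl)
    have h2 : 0 ≤ 2 * (2 + h₀ * C / 2) ^ 2 / h₀ ^ 2 := by positivity
    rw [norm_zero] at hL
    linarith
  set P : ℝ → ℂ := fun x => (p x - q x) / z with hP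
  set w : ℝ → ℂ := fun x => s x - q x - (h x - θ) * P x with hw
  have hzP : ∀ x, q x = p x - z * P x := fun x => by simp only [hP]; field_simp; ring
  have dP : ∀ x ∈ Ici (0 : ℝ), HasDerivWithinAt P (p x) (Ici 0) x := fun x hx => by
    refine (((hs.dp x hx).sub (hs.dq x hx)).div_const z).congr_deriv ?_
    field_simp; ring
  have dw : ∀ x ∈ Ici (0 : ℝ), HasDerivWithinAt w
      ((z + h x) * w x + ((h x ^ 2 - dh x : ℝ) - (z + h x) * θ) * P x + θ * p x) (Ici 0) x :=
    fun x hx => by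
      have h1 := (((hs.ds x hx).sub (hs.dq x hx)).sub
        (((hc.deriv x hx).ofReal_comp.sub_const θ).mul (dP x hx)))
      refine h1.congr_deriv ?_
      have : s x = w x + q x + (h x - θ) * P x := by simp only [hw]; ring
      rw [this, hzP]; push_cast; ring
  have dp : ∀ x ∈ Ici (0 : ℝ), HasDerivWithinAt p
      (v x * z * P x - v x * p x - v x * (h x - θ) * P x - v x * w x) (Ici 0) x := fun x hx => by
    refine (hs.dp x hx).congr_deriv ?_
    have : s x = w x + q x + (h x - θ) * P x := by simp only [hw]; ring
    rw [this, hzP]; ring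
  -- The Lyapunov function is `Re (η p conj P) + (h₀ / 4) |w|²`. Its negativity yields the claim
  -- since the second summand is nonnegative.
  have hN := fun x (hx : x ∈ Ici (0 : ℝ)) =>
    (hasDerivWithinAt_re_mul_conj (η := η) (dp x hx) (dP x hx)).add
      ((hasDerivWithinAt_re_mul_conj (η := 1) (dw x hx) (dw x hx)).const_mul (h₀ / 4))
  have hbound := fun x (hx : (0 : ℝ) ≤ x) =>
    inflow_rate_bound (p := p x) (P := P x) (w := w x) hc.h₀_pos hη hz hL (hc.v_pos x hx)
      (hc.v_le x hx) (hc.le_h x hx) (hc.h_le x hx) hθ (hE x hx)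
  have key := neg_of_deriv_nonneg hN (fun x hx => by
      refine le_trans ?_ (hbound x hx)
      have := hc.v_pos x hx
      positivity) (by
      have h1 : Tendsto (fun x => (η * (p x * starRingEnd ℂ (P x))).re) atTop (𝓝 0) := by
        have := (Complex.continuous_re.tendsto _).comp (hlim₁.const_mul η)
        rw [mul_zero, Complex.zero_re] at this
        exact this
      have h2 : Tendsto (fun x => h₀ / 4 * (1 * (w x * starRingEnd ℂ (w x))).re) atTop (𝓝 0) := by
        have hcw := (Complex.continuous_conj.tendsto _).comp hlim₂
        have := ((Complex.continuous_re.tendsto _).comp ((hlim₂.mul hcw).const_mul 1)).const_mul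
          (h₀ / 4)
        rw [zero_mul, mul_zero, Complex.zero_re, mul_zero] at this
        exact this
      have h3 := h1.add h2
      rw [add_zero] at h3
      exact h3) (fun X hX => by
      obtain ⟨x, hXx, hx⟩ := hne X
      refine ⟨x, hXx, fun h0 => hx ?_⟩
      have hx0 : 0 ≤ x := hX.trans hXx.le
      have h1 := hbound x hx0
      rw [h0] at h1
      have hv := hc.v_pos x hx0
      have hh := hc.h₀_pos
      have a1 : ‖p x‖ = 0 := by
        by_contra hne
        have : 0 < ‖p x‖ ^ 2 / 4 := by positivity
        have : 0 ≤ h₀ ^ 2 * ‖w x‖ ^ 2 / 4 + v x * ‖P x‖ ^ 2 := by positivity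
        linarith
      have a2 : ‖w x‖ = 0 := by
        by_contra hne
        have : 0 < h₀ ^ 2 * ‖w x‖ ^ 2 / 4 := by positivity
        have : 0 ≤ ‖p x‖ ^ 2 / 4 + v x * ‖P x‖ ^ 2 := by positivity
        linarith
      have a3 : ‖P x‖ = 0 := by
        by_contra hne
        have : 0 < v x * ‖P x‖ ^ 2 := by positivity
        have : 0 ≤ ‖p x‖ ^ 2 / 4 + h₀ ^ 2 * ‖w x‖ ^ 2 / 4 := by positivity
        linarith
      rw [norm_eq_zero] at a1 a2 a3
      have a4 : q x = 0 := by rw [hzP, a1, a3]; simp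
      refine ⟨a1, a4, ?_⟩
      have : s x = w x + q x + (h x - θ) * P x := by simp only [hw]; ring
      rw [this, a2, a3, a4]; simp) hx
  have : 0 ≤ h₀ / 4 * (1 * (w x * starRingEnd ℂ (w x))).re := by
    rw [one_mul, mul_conj_eq, Complex.ofReal_re]
    have := hc.h₀_pos
    positivity
  simp only [Pi.add_apply] at key
  linarith

end BoundaryLayer

end

/-! ### The Lyapunov function of the outflow problem -/

noncomputable section

namespace BoundaryLayer

/-- Here `q` stands for `|z|^{-1/2}`. Terms with a factor `q` are collected into `S q` times the sum
of squares and disappear for large `|z|`. The remaining cross terms are absorbed using `ν ≤ 1` and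
the choice `K ε = 16 B²`; each square keeps a quarter of its coefficient. -/
theorem outflow_rate_bound_aux {ν B K ε S q a β w : ℝ} (hν : 0 < ν) (hν1 : ν ≤ 1) (hB : 1 ≤ B)
    (hε : 0 < ε) (hK : K * ε = 16 * B ^ 2) (hq : 0 ≤ q) (hq1 : q ≤ 1)
    (hS : S = 2 + 5 * B + 2 * K * (3 * B + 2)) (h₁ : S * q ≤ 1 / 4) (h₂ : S * q ≤ ν / 4)
    (h₃ : S * q ≤ ε * K / 4) (ha : 0 ≤ a) (hβ : 0 ≤ β) (hw : 0 ≤ w) :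
    a ^ 2 / 4 + ν * β ^ 2 / 4 + ε * K * w ^ 2 / 4 ≤
      a ^ 2 + ν * β ^ 2 + ε * K * w ^ 2 - (4 * a * (q * β) + 2 * B * (w + q ^ 2 * a) * (q * β) +
        2 * B * a * (w + q ^ 2 * a) + ν / 2 * (a + B * (w + q ^ 2 * a)) * β +
        2 * K * ((B + 1) * (q ^ 2 * a) + q * β + B * q ^ 2 * (w + q ^ 2 * a)) * w) := by
  have hK0 : 0 ≤ K := by
    by_contra h
    push Not at h
    nlinarith [mul_neg_of_neg_of_pos h hε]
  have hB0 : 0 ≤ B := by linarith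
  have q2 : q ^ 2 ≤ q := by nlinarith
  have q3 : q ^ 3 ≤ q := by nlinarith [mul_nonneg hq hq]
  have q4 : q ^ 4 ≤ q := by nlinarith [mul_nonneg hq hq]
  have haβ : 0 ≤ a * β := mul_nonneg ha hβ
  have haw : 0 ≤ a * w := mul_nonneg ha hw
  have hwβ : 0 ≤ w * β := mul_nonneg hw hβ
  have s1 : 2 * (a * β) ≤ a ^ 2 + β ^ 2 := by nlinarith [sq_nonneg (a - β)]
  have s2 : 2 * (a * w) ≤ a ^ 2 + w ^ 2 := by nlinarith [sq_nonneg (a - w)]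
  have s3 : 2 * (w * β) ≤ w ^ 2 + β ^ 2 := by nlinarith [sq_nonneg (w - β)]
  have pa := sq_nonneg a
  have pβ := sq_nonneg β
  have pw := sq_nonneg w
  set T := a ^ 2 + β ^ 2 + w ^ 2 with hT
  have t1 : 4 * a * (q * β) ≤ 2 * T * q := by
    have := mul_le_mul_of_nonneg_right (show 2 * (a * β) ≤ T by linarith) hq
    nlinarith
  have t2 : 2 * B * (w + q ^ 2 * a) * (q * β) ≤ 2 * B * T * q := by
    have h1 : q ^ 3 * (a * β) ≤ q * (a * β) := mul_le_mul_of_nonneg_right q3 haβ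
    have h2 : w * β + a * β ≤ T := by linarith
    have h3 := mul_le_mul_of_nonneg_left h2 hq
    have h4 : (w + q ^ 2 * a) * (q * β) ≤ T * q := by nlinarith
    have := mul_le_mul_of_nonneg_left h4 (by positivity : 0 ≤ 2 * B)
    linarith
  have t3 : 2 * B * a * (w + q ^ 2 * a) ≤ a ^ 2 / 4 + ε * K * w ^ 2 / 4 + 2 * B * T * q := by
    have h1 : 2 * B * a * w ≤ a ^ 2 / 4 + 4 * B ^ 2 * w ^ 2 := by
      have := sq_nonneg (a / 2 - 2 * B * w)
      have h : (a / 2 - 2 * B * w) ^ 2 = a ^ 2 / 4 - 2 * B * a * w + 4 * B ^ 2 * w ^ 2 := by ring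
      linarith
    have h2 : ε * K * w ^ 2 / 4 = 4 * B ^ 2 * w ^ 2 := by rw [mul_comm ε, hK]; ring
    have h3 : q ^ 2 * a ^ 2 ≤ T * q := by
      have := mul_le_mul q2 (show a ^ 2 ≤ T by linarith) pa hq
      linarith
    have := mul_le_mul_of_nonneg_left h3 (by positivity : 0 ≤ 2 * B)
    have e : 2 * B * a * (w + q ^ 2 * a) = 2 * B * a * w + 2 * B * (q ^ 2 * a ^ 2) := by ring
    linarith
  have t4 : ν / 2 * (a + B * (w + q ^ 2 * a)) * β ≤
      a ^ 2 / 4 + ν * β ^ 2 / 2 + ε * K * w ^ 2 / 4 + B * T * q := by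
    have h1 : ν / 2 * (a * β) ≤ a ^ 2 / 4 + ν * β ^ 2 / 4 := by
      have h := mul_le_mul_of_nonneg_left s1 (by positivity : 0 ≤ ν / 4)
      have h' := mul_le_mul_of_nonneg_right hν1 pa
      linarith
    have h2 : ν / 2 * (B * w * β) ≤ ν * β ^ 2 / 4 + ε * K * w ^ 2 / 4 := by
      have h := sq_nonneg (B * w - β)
      have h0 : (B * w - β) ^ 2 = B ^ 2 * w ^ 2 - 2 * (B * w * β) + β ^ 2 := by ring
      have h' := mul_le_mul_of_nonneg_left (show 2 * (B * w * β) ≤ B ^ 2 * w ^ 2 + β ^ 2 by linarith)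
        (by positivity : 0 ≤ ν / 4)
      have h3 := mul_le_mul_of_nonneg_right hν1 (by positivity : 0 ≤ B ^ 2 * w ^ 2)
      have h4 : ε * K * w ^ 2 / 4 = 4 * B ^ 2 * w ^ 2 := by rw [mul_comm ε, hK]; ring
      have h5 : 0 ≤ B ^ 2 * w ^ 2 := by positivity
      linarith
    have h3 : ν / 2 * (B * (q ^ 2 * (a * β))) ≤ B * T * q := by
      have h4 : q ^ 2 * (a * β) ≤ q * T := mul_le_mul q2 (by linarith) haβ hq
      have h5 := mul_le_mul_of_nonneg_left h4 hB0
      have h6 : 0 ≤ B * (q ^ 2 * (a * β)) := by positivity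
      nlinarith
    have e : ν / 2 * (a + B * (w + q ^ 2 * a)) * β =
      ν / 2 * (a * β) + ν / 2 * (B * w * β) + ν / 2 * (B * (q ^ 2 * (a * β))) := by ring
    linarith
  have t5 : 2 * K * ((B + 1) * (q ^ 2 * a) + q * β + B * q ^ 2 * (w + q ^ 2 * a)) * w ≤
      2 * K * (3 * B + 2) * T * q := by
    have h1 : q ^ 2 * (a * w) ≤ q * T := mul_le_mul q2 (by linarith) haw hq
    have h2 : q ^ 4 * (a * w) ≤ q * T := mul_le_mul q4 (by linarith) haw hq
    have h3 : q * (w * β) ≤ q * T := mul_le_mul_of_nonneg_left (by linarith) hq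
    have h4 : q ^ 2 * w ^ 2 ≤ q * T := mul_le_mul q2 (by linarith) pw hq
    have h5 := mul_le_mul_of_nonneg_left h1 (by positivity : 0 ≤ B + 1)
    have h6 := mul_le_mul_of_nonneg_left h2 hB0
    have h7 := mul_le_mul_of_nonneg_left h4 hB0
    have h8 := mul_le_mul_of_nonneg_left (add_le_add (add_le_add h5 h3) (add_le_add h6 h7))
      (by positivity : 0 ≤ 2 * K)
    have e1 : 2 * K * ((B + 1) * (q ^ 2 * a) + q * β + B * q ^ 2 * (w + q ^ 2 * a)) * w =
      2 * K * ((B + 1) * (q ^ 2 * (a * w)) + q * (w * β) +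
        (B * (q ^ 4 * (a * w)) + B * (q ^ 2 * w ^ 2))) := by ring
    have e2 : 2 * K * ((B + 1) * (q * T) + q * T + (B * (q * T) + B * (q * T))) =
      2 * K * (3 * B + 2) * T * q := by ring
    linarith
  have f1 := mul_le_mul_of_nonneg_right h₁ pa
  have f2 := mul_le_mul_of_nonneg_right h₂ pβ
  have f3 := mul_le_mul_of_nonneg_right h₃ pw
  have e : 2 * T * q + 2 * B * T * q + 2 * B * T * q + B * T * q + 2 * K * (3 * B + 2) * T * q =
    S * q * a ^ 2 + S * q * β ^ 2 + S * q * w ^ 2 := by rw [hS, hT]; ring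
  linarith

theorem re_one_mul_add_conj (a w : ℂ) :
    (1 * (a * starRingEnd ℂ w + w * starRingEnd ℂ a)).re = 2 * (a * starRingEnd ℂ w).re := by
  simp only [one_mul, Complex.add_re, Complex.mul_re, Complex.conj_re, Complex.conj_im]; ring

/-- The rotated product supplies `|U|²` and `v |z| |Y|²`, so `Y` is naturally measured as `r |Y|`
with `r² = |z|`. The variable `x` grows at the rate `Re z + h + κ`; since `Re z + h` may vanish,
only the factor `e^{κ t}` guarantees a positive share `ε K |x|²`. -/
theorem outflow_rate_bound {ν B K ε S v h g κ c : ℝ} (hν : 0 < ν) (hν1 : ν ≤ 1) (hB : 1 ≤ B)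
    (hε : 0 < ε) (hε1 : ε ≤ 1) (hK : K * ε = 16 * B ^ 2) (hS : S = 2 + 5 * B + 2 * K * (3 * B + 2))
    (hκ : 2 * κ = ε) (hc : c = ν / 4) {z η U Y x X : ℂ} (hη : IsRotation z η) (hz : 0 ≤ z.re)
    {r : ℝ} (hr : 1 ≤ r) (hzr : ‖z‖ = r ^ 2) (h₁ : S / r ≤ 1 / 4) (h₂ : S / r ≤ ν / 4)
    (h₃ : S / r ≤ ε * K / 4) (hv : ν ≤ v) (hv1 : v ≤ 1) (hh : 0 ≤ h) (hhB : h ≤ B) (hg : |g| ≤ B)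
    (hX : X = x + U / z) :
    ‖U‖ ^ 2 / 4 + ν * (r * ‖Y‖) ^ 2 / 4 + ε * K * ‖x‖ ^ 2 / 4 ≤
      -((η * ((κ * U - (v * z * Y + v * U + g * X)) * starRingEnd ℂ Y +
          U * starRingEnd ℂ (κ * Y - (U - h * X)))).re -
        c * r * (1 * ((κ * Y - (U - h * X)) * starRingEnd ℂ Y +
          Y * starRingEnd ℂ (κ * Y - (U - h * X)))).re -
        K * (1 * ((κ * x + (z + h) * x + (h * U / z + v * Y + v / z * U + g / z * X)) *
          starRingEnd ℂ x + x * starRingEnd ℂ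
            (κ * x + (z + h) * x + (h * U / z + v * Y + v / z * U + g / z * X)))).re) := by
  have hr0 : 0 < r := by linarith
  have hz0 : 0 < ‖z‖ := by rw [hzr]; positivity
  have hK0 : 0 ≤ K := by
    by_contra h
    push Not at h
    nlinarith [mul_neg_of_neg_of_pos h hε]
  have hB0 : 0 ≤ B := by linarith
  have hv0 : 0 < v := by linarith
  rw [re_one_mul_add_conj, re_one_mul_add_conj]
  have e1 : (η * ((κ * U - (v * z * Y + v * U + g * X)) * starRingEnd ℂ Y +
      U * starRingEnd ℂ (κ * Y - (U - h * X)))).re =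
      (η * (((ε : ℝ) - v) * U * starRingEnd ℂ Y)).re - v * ‖Y‖ ^ 2 * (η * z).re -
      (η * (g * X * starRingEnd ℂ Y)).re - ‖U‖ ^ 2 + (η * (h * U * starRingEnd ℂ X)).re := by
    have : η * ((κ * U - (v * z * Y + v * U + g * X)) * starRingEnd ℂ Y +
        U * starRingEnd ℂ (κ * Y - (U - h * X))) =
        η * (((ε : ℝ) - v) * U * starRingEnd ℂ Y) -
        v * (Y * starRingEnd ℂ Y) * (η * z) - η * (g * X * starRingEnd ℂ Y) -
        η * (U * starRingEnd ℂ U) + η * (h * U * starRingEnd ℂ X) := by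
      rw [← hκ]
      simp only [map_sub, map_mul, Complex.conj_ofReal]
      push_cast
      ring
    rw [this, mul_conj_eq Y, Complex.add_re, Complex.sub_re, Complex.sub_re, Complex.sub_re,
      hη.re_mul_conj_self, ← Complex.ofReal_mul, Complex.re_ofReal_mul]
  have e2 : ((κ * Y - (U - h * X)) * starRingEnd ℂ Y).re =
      κ * ‖Y‖ ^ 2 - ((U - h * X) * starRingEnd ℂ Y).re := by
    have : (κ * Y - (U - h * X)) * starRingEnd ℂ Y = κ * (Y * starRingEnd ℂ Y) -
      (U - h * X) * starRingEnd ℂ Y := by ring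
    rw [this, mul_conj_eq, Complex.sub_re, ← Complex.ofReal_mul, Complex.ofReal_re]
  have e3 : ((κ * x + (z + h) * x + (h * U / z + v * Y + v / z * U + g / z * X)) *
          starRingEnd ℂ x).re = (κ + z.re + h) * ‖x‖ ^ 2 +
      ((h * U / z + v * Y + v / z * U + g / z * X) * starRingEnd ℂ x).re := by
    have : (κ * x + (z + h) * x + (h * U / z + v * Y + v / z * U + g / z * X)) *
        starRingEnd ℂ x = (κ + z + h) * (x * starRingEnd ℂ x) +
        (h * U / z + v * Y + v / z * U + g / z * X) * starRingEnd ℂ x := by ring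
    rw [this, mul_conj_eq, Complex.add_re, Complex.re_mul_ofReal]
    simp
  rw [e1, e2, e3]
  obtain ⟨q, hq⟩ : ∃ q, q = 1 / r := ⟨_, rfl⟩
  have hq0 : 0 ≤ q := by rw [hq]; positivity
  have hq1 : q ≤ 1 := by rw [hq, div_le_one hr0]; exact hr
  have hqr : q * r = 1 := by rw [hq]; field_simp
  have hdiv : ∀ y : ℂ, ‖y / z‖ = q ^ 2 * ‖y‖ := fun y => by
    rw [norm_div, hzr, hq]; field_simp
  have hXn : ‖X‖ ≤ ‖x‖ + q ^ 2 * ‖U‖ := by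
    rw [hX, ← hdiv]; exact norm_add_le _ _
  obtain ⟨ξ, hξ⟩ : ∃ ξ, ξ = ‖x‖ + q ^ 2 * ‖U‖ := ⟨_, rfl⟩
  rw [← hξ] at hXn
  have hξ0 : 0 ≤ ξ := (norm_nonneg _).trans hXn
  have hY : ‖Y‖ = q * (r * ‖Y‖) := by rw [← mul_assoc, hqr, one_mul]
  have b1 : (η * (((ε : ℝ) - v) * U * starRingEnd ℂ Y)).re ≤ 4 * ‖U‖ * ‖Y‖ := by
    refine (hη.re_le _).trans ?_
    rw [norm_mul, norm_mul, RCLike.norm_conj, ← Complex.ofReal_sub, Complex.norm_real,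
      Real.norm_eq_abs]
    have h1 : |ε - v| ≤ 2 := by rw [abs_le]; constructor <;> linarith
    have h2 : 0 ≤ ‖U‖ * ‖Y‖ := by positivity
    nlinarith
  have b2 : ν * (r * ‖Y‖) ^ 2 ≤ v * ‖Y‖ ^ 2 * (η * z).re := by
    have h1 := hη.le_re
    rw [hzr] at h1
    have h2 : ν * ‖Y‖ ^ 2 ≤ v * ‖Y‖ ^ 2 := mul_le_mul_of_nonneg_right hv (by positivity)
    have := mul_le_mul h2 h1 (by positivity) (by positivity)
    linarith
  have b3 : -(2 * B * ξ * ‖Y‖) ≤ (η * (g * X * starRingEnd ℂ Y)).re := by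
    refine le_trans ?_ (hη.neg_le_re _)
    rw [norm_mul, norm_mul, RCLike.norm_conj, Complex.norm_real, Real.norm_eq_abs, neg_le_neg_iff]
    have : |g| * ‖X‖ * ‖Y‖ ≤ B * ξ * ‖Y‖ := by gcongr
    linarith
  have b4 : (η * (h * U * starRingEnd ℂ X)).re ≤ 2 * B * ‖U‖ * ξ := by
    refine (hη.re_le _).trans ?_
    rw [norm_mul, norm_mul, RCLike.norm_conj, Complex.norm_real, Real.norm_of_nonneg hh]
    have : h * ‖U‖ * ‖X‖ ≤ B * ‖U‖ * ξ := by gcongr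
    linarith
  have b5 : ((U - h * X) * starRingEnd ℂ Y).re ≤ (‖U‖ + B * ξ) * ‖Y‖ := by
    refine (Complex.re_le_norm _).trans ?_
    rw [norm_mul, RCLike.norm_conj]
    refine mul_le_mul_of_nonneg_right ((norm_sub_le _ _).trans ?_) (norm_nonneg _)
    rw [norm_mul, Complex.norm_real, Real.norm_of_nonneg hh]
    gcongr
  have b6 : -(((B + 1) * (q ^ 2 * ‖U‖) + ‖Y‖ + B * q ^ 2 * ξ) * ‖x‖) ≤
      ((h * U / z + v * Y + v / z * U + g / z * X) * starRingEnd ℂ x).re := by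
    refine le_trans ?_ (neg_norm_le_re _)
    rw [norm_mul, RCLike.norm_conj, neg_le_neg_iff]
    refine mul_le_mul_of_nonneg_right ?_ (norm_nonneg _)
    have n1 : ‖h * U / z‖ ≤ B * (q ^ 2 * ‖U‖) := by
      rw [hdiv, norm_mul, Complex.norm_real, Real.norm_of_nonneg hh]
      have : q ^ 2 * (h * ‖U‖) ≤ q ^ 2 * (B * ‖U‖) := by gcongr
      linarith
    have n2 : ‖v * Y‖ ≤ ‖Y‖ := by
      rw [norm_mul, Complex.norm_real, Real.norm_of_nonneg hv0.le]
      exact mul_le_of_le_one_left (norm_nonneg _) hv1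
    have n3 : ‖v / z * U‖ ≤ q ^ 2 * ‖U‖ := by
      rw [norm_mul, hdiv, Complex.norm_real, Real.norm_of_nonneg hv0.le]
      have : q ^ 2 * v ≤ q ^ 2 := mul_le_of_le_one_right (by positivity) hv1
      exact mul_le_mul_of_nonneg_right this (norm_nonneg _)
    have n4 : ‖g / z * X‖ ≤ B * q ^ 2 * ξ := by
      rw [norm_mul, hdiv, Complex.norm_real, Real.norm_eq_abs]
      have : q ^ 2 * |g| * ‖X‖ ≤ q ^ 2 * B * ξ := by gcongr
      linarith
    have := norm_add_le (h * U / z + v * Y + v / z * U) (g / z * X)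
    have := norm_add_le (h * U / z + v * Y) (v / z * U)
    have := norm_add_le (h * U / z) (v * Y)
    linarith
  have hcr : 0 ≤ 2 * (c * r) := by rw [hc]; positivity
  have d1 := mul_le_mul_of_nonneg_left b5 hcr
  have d2 := mul_le_mul_of_nonneg_left b6 (by positivity : 0 ≤ 2 * K)
  have d3 : 0 ≤ K * ‖x‖ ^ 2 * (z.re + h) := mul_nonneg (by positivity) (by linarith)
  have d4 : 0 ≤ c * r * ‖Y‖ ^ 2 * ε := by rw [hc]; positivity
  have hSr : S / r = S * q := by rw [hq]; ring
  rw [hSr] at h₁ h₂ h₃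
  have main := outflow_rate_bound_aux (a := ‖U‖) (β := r * ‖Y‖) (w := ‖x‖) hν hν1 hB hε hK hq0 hq1
    hS h₁ h₂ h₃ (norm_nonneg _) (by positivity) (norm_nonneg _)
  rw [← hξ, ← hY] at main
  have e4 : ν / 2 * (‖U‖ + B * ξ) * (r * ‖Y‖) = 2 * (c * r) * ((‖U‖ + B * ξ) * ‖Y‖) := by
    rw [hc]; ring
  have e5 : q * (r * ‖Y‖) = ‖Y‖ := hY.symm
  refine main.trans (le_of_sub_nonneg ?_)
  have e6 : K * (κ + z.re + h) * ‖x‖ ^ 2 * 2 = ε * K * ‖x‖ ^ 2 + 2 * (K * ‖x‖ ^ 2 * (z.re + h)) := by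
    rw [← hκ]; ring
  have e7 : c * r * (2 * (κ * ‖Y‖ ^ 2)) = c * r * ‖Y‖ ^ 2 * ε := by rw [← hκ]; ring
  rw [e4]
  linarith

/-- The coefficients of an outflow problem on the half-line `t = -x ≥ 0`. -/
structure OutflowCoeff (v h dh : ℝ → ℝ) (ν B : ℝ) : Prop where
  pos : 0 < ν
  one_le : 1 ≤ B
  le_v : ∀ t, 0 ≤ t → ν ≤ v t
  v_le : ∀ t, 0 ≤ t → v t ≤ 1
  h_nonneg : ∀ t, 0 ≤ t → 0 ≤ h t
  h_le : ∀ t, 0 ≤ t → h t ≤ B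
  deriv_le : ∀ t, 0 ≤ t → |-dh t - v t * h t| ≤ B
  deriv : ∀ t ∈ Ici (0 : ℝ), HasDerivWithinAt h (dh t) (Ici 0) t

/-- The eigenvalue system in the variables `Z = w₁ + w₂`, `X = w₂ / z`, `w = w₃` and `t = -x`,
multiplied by `e^{κ t}`. -/
structure OutflowSystem (v h : ℝ → ℝ) (z : ℂ) (κ : ℝ) (Z X w : ℝ → ℂ) : Prop where
  dZ : ∀ t ∈ Ici (0 : ℝ), HasDerivWithinAt Z (κ * Z t - (z ^ 2 * X t + 2 * z * w t)) (Ici 0) t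
  dX : ∀ t ∈ Ici (0 : ℝ), HasDerivWithinAt X (κ * X t - w t) (Ici 0) t
  dw : ∀ t ∈ Ici (0 : ℝ),
    HasDerivWithinAt w (κ * w t - (v t * Z t + (v t - h t - z) * w t)) (Ici 0) t

theorem exists_outflow_radius {ν B ε : ℝ} (hν : 0 < ν) (hB : 1 ≤ B) (hε : 0 < ε) :
    ∃ Λ : ℝ, 0 < Λ ∧ ∀ L, Λ ≤ L → ∃ r S K, 1 ≤ r ∧ L = r ^ 2 ∧ K * ε = 16 * B ^ 2 ∧
      S = 2 + 5 * B + 2 * K * (3 * B + 2) ∧ S / r ≤ 1 / 4 ∧ S / r ≤ ν / 4 ∧ S / r ≤ ε * K / 4 ∧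
      32 ≤ ν * r ∧ 8 * B ≤ r ^ 2 := by
  obtain ⟨K, hK⟩ : ∃ K, K = 16 * B ^ 2 / ε := ⟨_, rfl⟩
  obtain ⟨S, hS⟩ : ∃ S, S = 2 + 5 * B + 2 * K * (3 * B + 2) := ⟨_, rfl⟩
  have hB0 : 0 < B := by linarith
  have hK0 : 0 < K := by rw [hK]; positivity
  have hS0 : 0 < S := by rw [hS]; positivity
  obtain ⟨R, hR⟩ : ∃ R, R = 1 + 4 * S + 4 * S / ν + 4 * S / (ε * K) + 32 / ν + 8 * B := ⟨_, rfl⟩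
  have p1 : 0 < 4 * S / ν := by positivity
  have p2 : 0 < 4 * S / (ε * K) := by positivity
  have p3 : 0 < 32 / ν := by positivity
  have hR0 : 0 < R := by rw [hR]; positivity
  refine ⟨R ^ 2, by positivity, fun L hL => ?_⟩
  have hRr : R ≤ √L := Real.le_sqrt_of_sq_le hL
  have hr0 : 0 < √L := hR0.trans_le hRr
  refine ⟨√L, S, K, by linarith, (Real.sq_sqrt ((by positivity : 0 ≤ R ^ 2).trans hL)).symm,
    by rw [hK]; field_simp, hS, ?_, ?_, ?_, ?_, ?_⟩
  · rw [div_le_iff₀ hr0]; linarith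
  · rw [div_le_iff₀ hr0]
    have h : 4 * S / ν ≤ √L := by linarith
    rw [div_le_iff₀ hν] at h
    linarith
  · rw [div_le_iff₀ hr0]
    have h : 4 * S / (ε * K) ≤ √L := by linarith
    rw [div_le_iff₀ (by positivity)] at h
    linarith
  · have h : 32 / ν ≤ √L := by linarith
    rw [div_le_iff₀ hν] at h
    linarith
  · have h : 8 * B ≤ √L := by linarith
    nlinarith

/-- Monotonicity of the quadratic form shows that `U = z X + w + h X` dominates: both `Y` and `X`
are small compared with it when `|z|` is large. The boundary combination is later written as `U - (s
+ h) X` up to sign, so this domination excludes zeros. -/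
theorem OutflowSystem.key {ν B κ : ℝ} (hν : 0 < ν) (hν1 : ν ≤ 1) (hB : 1 ≤ B) (hκ : 0 < κ)
    (hκ1 : 2 * κ ≤ 1) : ∃ Λ : ℝ, 0 < Λ ∧ ∀ (v h dh : ℝ → ℝ) (z : ℂ) (Z X w : ℝ → ℂ),
      OutflowCoeff v h dh ν B → 0 ≤ z.re → Λ ≤ ‖z‖ → OutflowSystem v h z κ Z X w →
      Tendsto Z atTop (𝓝 0) → Tendsto X atTop (𝓝 0) → Tendsto w atTop (𝓝 0) →
      (∀ T : ℝ, ∃ t, T < t ∧ ¬ (Z t = 0 ∧ X t = 0 ∧ w t = 0)) →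
      ∀ t, 0 ≤ t → ∀ s : ℝ, |s| ≤ B →
        ‖(s + h t) * X t‖ < ‖z * X t + w t + h t * X t‖ := by
  obtain ⟨Λ, hΛ0, hΛ⟩ := exists_outflow_radius hν hB (by linarith : 0 < 2 * κ)
  refine ⟨Λ, hΛ0, fun v h dh z Z X w hc hz hzΛ hs hZ hX hw hne t ht s hsB => ?_⟩
  obtain ⟨r, S, K, hr1, hzr, hK, hS, h₁, h₂, h₃, hνr, hBr⟩ := hΛ _ hzΛ
  obtain ⟨η, hη⟩ := exists_isRotation hz
  have hz0 : z ≠ 0 := by rw [← norm_pos_iff]; linarith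
  have hr0 : 0 < r := by linarith
  have hB0 : 0 < B := by linarith
  have hK0 : 0 < K := by
    by_contra h
    push Not at h
    nlinarith [mul_nonneg_of_nonpos_of_nonpos h (by linarith : -κ ≤ 0)]
  obtain ⟨c, hcdef⟩ : ∃ c, c = ν / 4 := ⟨_, rfl⟩
  have hc0 : 0 < c := by rw [hcdef]; positivity
  -- In these variables `U` and `Y` drive one another through `U' ≈ -v z Y` and `Y' ≈ -U`, while `x
  -- = X - U / z` obeys `x' ≈ (z + h) x`.
  set U : ℝ → ℂ := fun t => z * X t + w t + h t * X t with hU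
  set Y : ℝ → ℂ := fun t => Z t / z - X t with hY
  set x : ℝ → ℂ := fun t => X t - U t / z with hx
  have dY : ∀ t ∈ Ici (0 : ℝ), HasDerivWithinAt Y (κ * Y t - (U t - h t * X t)) (Ici 0) t :=
    fun t ht => by
      refine (((hs.dZ t ht).div_const z).sub (hs.dX t ht)).congr_deriv ?_
      simp only [hY, hU]; field_simp; ring
  have dU : ∀ t ∈ Ici (0 : ℝ), HasDerivWithinAt U
      (κ * U t - (v t * z * Y t + v t * U t + ((-dh t - v t * h t : ℝ) : ℂ) * X t)) (Ici 0) t :=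
    fun t ht => by
      refine ((((hs.dX t ht).const_mul z).add (hs.dw t ht)).add
        ((hc.deriv t ht).ofReal_comp.mul (hs.dX t ht))).congr_deriv ?_
      simp only [hY, hU]; push_cast; field_simp; ring
  have dx : ∀ t ∈ Ici (0 : ℝ), HasDerivWithinAt x
      (κ * x t + (z + h t) * x t + (h t * U t / z + v t * Y t + v t / z * U t +
        ((-dh t - v t * h t : ℝ) : ℂ) / z * X t)) (Ici 0) t := fun t ht => by
    refine ((hs.dX t ht).sub ((dU t ht).div_const z)).congr_deriv ?_
    have : w t = U t - z * X t - h t * X t := by simp only [hU]; ring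
    rw [this]; simp only [hx]; field_simp; ring
  have hXx : ∀ t, X t = x t + U t / z := fun t => by simp only [hx]; ring
  have hN := fun t (ht : t ∈ Ici (0 : ℝ)) =>
    (((hasDerivWithinAt_re_mul_conj (η := η) (dU t ht) (dY t ht)).sub
      ((hasDerivWithinAt_re_mul_conj (η := 1) (dY t ht) (dY t ht)).const_mul (c * r))).sub
      ((hasDerivWithinAt_re_mul_conj (η := 1) (dx t ht) (dx t ht)).const_mul K)).neg
  have hbound := fun t (ht : (0 : ℝ) ≤ t) =>
    outflow_rate_bound hν hν1 hB (by linarith : 0 < 2 * κ) hκ1 hK hS rfl hcdef hη hz hr1 hzr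
      h₁ h₂ h₃ (hc.le_v t ht) (hc.v_le t ht) (hc.h_nonneg t ht) (hc.h_le t ht) (hc.deriv_le t ht)
      (hXx t) (Y := Y t)
  have hhX : Tendsto (fun t => (h t : ℂ) * X t) atTop (𝓝 0) := by
    refine squeeze_zero_norm' (a := fun t => B * ‖X t‖) ?_ (by simpa using hX.norm.const_mul B)
    filter_upwards [eventually_ge_atTop 0] with t ht
    rw [norm_mul, Complex.norm_real, Real.norm_of_nonneg (hc.h_nonneg t ht)]
    exact mul_le_mul_of_nonneg_right (hc.h_le t ht) (norm_nonneg _)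
  have lU : Tendsto U atTop (𝓝 0) := by
    have := ((hX.const_mul z).add hw).add hhX
    rwa [mul_zero, add_zero, add_zero] at this
  have lY : Tendsto Y atTop (𝓝 0) := by
    have := (hZ.div_const z).sub hX
    rwa [zero_div, sub_zero] at this
  have lx : Tendsto x atTop (𝓝 0) := by
    have := hX.sub (lU.div_const z)
    rwa [zero_div, sub_zero] at this
  have lq : ∀ (ζ : ℂ) {f g : ℝ → ℂ}, Tendsto f atTop (𝓝 0) → Tendsto g atTop (𝓝 0) →
      Tendsto (fun t => (ζ * (f t * starRingEnd ℂ (g t))).re) atTop (𝓝 0) := fun ζ f g hf hg => by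
    have hcg := (Complex.continuous_conj.tendsto _).comp hg
    have := (Complex.continuous_re.tendsto _).comp ((hf.mul hcg).const_mul ζ)
    rw [zero_mul, mul_zero, Complex.zero_re] at this
    exact this
  have key := neg_of_deriv_nonneg hN (fun t ht => by
      refine le_trans ?_ (hbound t ht)
      positivity) (by
      have := (((lq η lU lY).sub ((lq 1 lY lY).const_mul (c * r))).sub
        ((lq 1 lx lx).const_mul K)).neg
      rw [mul_zero, mul_zero, sub_zero, sub_zero, neg_zero] at this
      exact this) (fun T hT => by
      obtain ⟨t, hTt, hnt⟩ := hne T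
      refine ⟨t, hTt, fun h0 => hnt ?_⟩
      have ht0 : 0 ≤ t := hT.trans hTt.le
      have h1 := hbound t ht0
      have h1' := h1.trans_eq h0
      have a1 : ‖U t‖ = 0 := by
        by_contra hne
        have : 0 < ‖U t‖ ^ 2 / 4 := by positivity
        have : 0 ≤ ν * (r * ‖Y t‖) ^ 2 / 4 + 2 * κ * K * ‖x t‖ ^ 2 / 4 := by positivity
        linarith
      have a2 : ‖Y t‖ = 0 := by
        by_contra hne
        have : 0 < ν * (r * ‖Y t‖) ^ 2 / 4 := by positivity
        have : 0 ≤ ‖U t‖ ^ 2 / 4 + 2 * κ * K * ‖x t‖ ^ 2 / 4 := by positivity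
        linarith
      have a3 : ‖x t‖ = 0 := by
        by_contra hne
        have : 0 < 2 * κ * K * ‖x t‖ ^ 2 / 4 := by positivity
        have : 0 ≤ ‖U t‖ ^ 2 / 4 + ν * (r * ‖Y t‖) ^ 2 / 4 := by positivity
        linarith
      rw [norm_eq_zero] at a1 a2 a3
      have a4 : X t = 0 := by rw [hXx, a1, a3]; simp
      have a5 : Z t = z * (Y t + X t) := by simp only [hY]; field_simp; ring
      have a6 : w t = U t - z * X t - h t * X t := by simp only [hU]; ring
      refine ⟨?_, a4, ?_⟩
      · rw [a5, a2, a4]; simp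
      · rw [a6, a1, a4]; simp) ht
  -- Negativity of the Lyapunov function, read backwards, bounds `Y` and `x` by the single product
  -- of `U` and `Y`.
  have key' : 0 < (η * (U t * starRingEnd ℂ (Y t))).re - c * r * ‖Y t‖ ^ 2 - K * ‖x t‖ ^ 2 := by
    have e : ∀ y : ℂ, (1 * (y * starRingEnd ℂ y)).re = ‖y‖ ^ 2 := fun y => by
      rw [one_mul, mul_conj_eq, Complex.ofReal_re]
    have := neg_pos.2 key
    simp only [Pi.neg_apply, Pi.sub_apply, neg_neg, e] at this
    exact this
  have hUY : (η * (U t * starRingEnd ℂ (Y t))).re ≤ 2 * (‖U t‖ * ‖Y t‖) := by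
    have := hη.re_le (U t * starRingEnd ℂ (Y t))
    rwa [norm_mul, RCLike.norm_conj] at this
  have hYp : 0 < ‖Y t‖ := by
    refine (norm_nonneg _).lt_of_ne' fun h0 => ?_
    rw [h0] at hUY key'
    have : 0 ≤ K * ‖x t‖ ^ 2 := by positivity
    linarith
  have hUp : 0 < ‖U t‖ := by
    refine (norm_nonneg _).lt_of_ne' fun h0 => ?_
    rw [h0] at hUY
    have : 0 ≤ K * ‖x t‖ ^ 2 := by positivity
    have : 0 ≤ c * r * ‖Y t‖ ^ 2 := by positivity
    linarith
  -- First `Y` is bounded by `U`, then `x`, and finally `X = x + U / z`, using `8 B ≤ |z|` for the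
  -- last term.
  have k1 : c * r * ‖Y t‖ < 2 * ‖U t‖ := by
    have : 0 ≤ K * ‖x t‖ ^ 2 := by positivity
    have : c * r * ‖Y t‖ * ‖Y t‖ < 2 * ‖U t‖ * ‖Y t‖ := by linarith
    exact lt_of_mul_lt_mul_right this hYp.le
  have k2 : 4 * ‖Y t‖ ≤ ‖U t‖ := by
    have : 8 ≤ c * r := by rw [hcdef]; linarith
    have := mul_le_mul_of_nonneg_right this hYp.le
    linarith
  have k3 : K * ‖x t‖ ^ 2 ≤ ‖U t‖ ^ 2 / 2 := by
    have : 0 ≤ c * r * ‖Y t‖ ^ 2 := by positivity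
    have h4 := mul_le_mul_of_nonneg_left k2 hUp.le
    linarith
  have k4 : 16 * B ^ 2 * ‖x t‖ ^ 2 ≤ ‖U t‖ ^ 2 / 2 := by
    refine le_trans ?_ k3
    rw [← hK]
    have := mul_le_mul_of_nonneg_left hκ1 (by positivity : 0 ≤ K * ‖x t‖ ^ 2)
    linarith
  have k5 : 4 * B * ‖x t‖ < ‖U t‖ := by
    refine lt_of_pow_lt_pow_left₀ 2 hUp.le ?_
    have : 0 < ‖U t‖ ^ 2 := by positivity
    have e : (4 * B * ‖x t‖) ^ 2 = 16 * B ^ 2 * ‖x t‖ ^ 2 := by ring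
    linarith
  have k6 : 4 * B * ‖U t / z‖ ≤ ‖U t‖ / 2 * 1 := by
    rw [norm_div, hzr, mul_div_assoc', div_le_iff₀ (by positivity)]
    have := mul_le_mul_of_nonneg_left hBr hUp.le
    linarith
  have k7 : ‖(s + h t : ℂ) * X t‖ ≤ 2 * B * (‖x t‖ + ‖U t / z‖) := by
    rw [norm_mul]
    refine mul_le_mul ?_ ((congrArg norm (hXx t)).trans_le (norm_add_le _ _)) (norm_nonneg _)
      (by positivity)
    rw [← Complex.ofReal_add, Complex.norm_real]
    have h1 := abs_add_le s (h t)
    have h2 := hc.h_le t ht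
    rw [abs_of_nonneg (hc.h_nonneg t ht)] at h1
    rw [Real.norm_eq_abs]
    linarith
  change _ < ‖U t‖
  linarith

end BoundaryLayer

end

noncomputable section

namespace BoundaryLayer

/-! ### Profiles -/

/-- Only the sign of `F` just above `b` is used. After the last time at which `v ≤ b`, the mean
value theorem would produce a positive derivative at a point where `F ≤ 0`. -/
theorem le_of_barrier {v F : ℝ → ℝ} {b ε : ℝ} (hε : 0 < ε)
    (hv : ∀ x ∈ Ici (0 : ℝ), HasDerivWithinAt v (F (v x)) (Ici 0) x) (h0 : v 0 ≤ b)
    (hF : ∀ y, b < y → y < b + ε → F y ≤ 0) {x : ℝ} (hx : 0 ≤ x) : v x ≤ b := by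
  by_contra! hlt
  have hcont : ContinuousOn v (Ici 0) := fun y hy => (hv y hy).continuousWithinAt
  have hcont' : ContinuousOn v (Icc 0 x) := hcont.mono Icc_subset_Ici_self
  obtain ⟨x₀, hx₀, hmax⟩ : ∃ x₀, IsGreatest (Icc 0 x ∩ v ⁻¹' Iic b) x₀ :=
    (isCompact_Icc.of_isClosed_subset (hcont'.preimage_isClosed_of_isClosed isClosed_Icc isClosed_Iic)
      inter_subset_left).exists_isGreatest ⟨0, ⟨le_rfl, hx⟩, h0⟩
  have hx₀0 : 0 ≤ x₀ := hx₀.1.1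
  have hx₀b : v x₀ ≤ b := hx₀.2
  have hx₀x : x₀ < x := hx₀.1.2.lt_of_ne fun h => by rw [h] at hx₀b; exact hlt.not_ge hx₀b
  have hgt : ∀ y, x₀ < y → y ≤ x → b < v y := fun y hy hyx => by
    by_contra! h
    exact hy.not_ge (hmax ⟨⟨hx₀0.trans hy.le, hyx⟩, h⟩)
  have hnear : ∀ᶠ y in 𝓝[Ici 0] x₀, v y < b + ε :=
    (hcont x₀ hx₀0).eventually_lt_const (by linarith)
  rw [eventually_nhdsWithin_iff, Metric.eventually_nhds_iff] at hnear
  obtain ⟨δ, hδ, hnear⟩ := hnear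
  obtain ⟨y, hy⟩ : ∃ y, y = min x (x₀ + δ / 2) := ⟨_, rfl⟩
  have hyx : y ≤ x := hy.trans_le (min_le_left _ _)
  have hyδ : y ≤ x₀ + δ / 2 := hy.trans_le (min_le_right _ _)
  have hx₀y : x₀ < y := hy ▸ lt_min hx₀x (by linarith)
  obtain ⟨ξ, hξ, hslope⟩ := exists_hasDerivAt_eq_slope v (fun t => F (v t)) hx₀y
    (hcont.mono fun t ht => hx₀0.trans ht.1)
    fun t ht => (hv t (hx₀0.trans ht.1.le)).hasDerivAt (Ici_mem_nhds (hx₀0.trans_lt ht.1))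
  have h1 : F (v ξ) ≤ 0 := by
    refine hF _ (hgt ξ hξ.1 (hξ.2.le.trans hyx)) (hnear ?_ (hx₀0.trans hξ.1.le))
    rw [Real.dist_eq, abs_of_pos (by linarith [hξ.1])]
    linarith [hξ.2]
  have h2 : 0 < (v y - v x₀) / (y - x₀) :=
    div_pos (by linarith [hgt y hx₀y hyx]) (by linarith)
  linarith

theorem ge_of_barrier {v F : ℝ → ℝ} {b ε : ℝ} (hε : 0 < ε)
    (hv : ∀ x ∈ Ici (0 : ℝ), HasDerivWithinAt v (F (v x)) (Ici 0) x) (h0 : b ≤ v 0)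
    (hF : ∀ y, b - ε < y → y < b → 0 ≤ F y) {x : ℝ} (hx : 0 ≤ x) : b ≤ v x := by
  have := le_of_barrier (v := fun x => -v x) (F := fun y => -F (-y)) (b := -b) hε
    (fun x hx => by simpa using (hv x hx).fun_neg) (by simpa using h0)
    (fun y h1 h2 => neg_nonpos.2 (hF _ (by linarith) (by linarith))) hx
  linarith

theorem le_exp_of_deriv_le {u du : ℝ → ℝ} {c : ℝ}
    (hu : ∀ x ∈ Ici (0 : ℝ), HasDerivWithinAt u (du x) (Ici 0) x)
    (hle : ∀ x, 0 ≤ x → du x ≤ -c * u x) {x : ℝ} (hx : 0 ≤ x) : u x ≤ u 0 * Real.exp (-c * x) := by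
  have he : ∀ x ∈ Ici (0 : ℝ), HasDerivWithinAt (fun x => Real.exp (c * x) * u x)
      (Real.exp (c * x) * (c * 1) * u x + Real.exp (c * x) * du x) (Ici 0) x := fun x hx =>
    (((hasDerivAt_id x).const_mul c).exp.hasDerivWithinAt).mul (hu x hx)
  have hanti : AntitoneOn (fun x => Real.exp (c * x) * u x) (Ici 0) := by
    refine antitoneOn_of_hasDerivWithinAt_nonpos (convex_Ici 0)
      (fun x hx => (he x hx).continuousWithinAt)
      (fun x hx => (he x (interior_subset hx)).mono interior_subset) fun x hx => ?_
    have h1 := hle x (interior_subset hx)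
    have h2 := mul_le_mul_of_nonneg_left h1 (Real.exp_pos (c * x)).le
    linarith
  have h1 := hanti (mem_Ici.2 le_rfl) (mem_Ici.2 hx) hx
  simp only [mul_zero, Real.exp_zero, one_mul] at h1
  have h2 := mul_le_mul_of_nonneg_right h1 (Real.exp_pos (-c * x)).le
  have h3 : Real.exp (c * x) * u x * Real.exp (-c * x) = u x := by
    rw [mul_right_comm, ← Real.exp_add]; simp
  linarith

section
variable {γ vp : ℝ}

theorem rpow_vp_lt_one (hγ : 1 ≤ γ) (h0 : 0 < vp) (h1 : vp < 1) : vp ^ γ < 1 :=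
  Real.rpow_lt_one h0.le h1 (by linarith)

theorem pressureConst_pos (hγ : 1 ≤ γ) (h0 : 0 < vp) (h1 : vp < 1) : 0 < pressureConst γ vp :=
  div_pos (mul_pos (Real.rpow_pos_of_pos h0 _) (by linarith))
    (by linarith [rpow_vp_lt_one hγ h0 h1])

/-- The rate `H(v) / v`. -/
def profileRate (γ vp v : ℝ) : ℝ := v - 1 + pressureConst γ vp * (v ^ (-γ) - 1)

theorem profileRHS_eq (γ vp v : ℝ) : profileRHS γ vp v = v * profileRate γ vp v := rfl

theorem profileRate_one (γ vp : ℝ) : profileRate γ vp 1 = 0 := by simp [profileRate]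

theorem pressureConst_mul_rpow (hγ : 1 ≤ γ) (h0 : 0 < vp) (h1 : vp < 1) :
    pressureConst γ vp * vp ^ (-γ) = (1 - vp) / (1 - vp ^ γ) := by
  have := rpow_vp_lt_one hγ h0 h1
  have h2 : 1 - vp ^ γ ≠ 0 := by linarith
  have h3 := (Real.rpow_pos_of_pos h0 γ).ne'
  rw [pressureConst, Real.rpow_neg h0.le]
  field_simp

theorem profileRate_vp (hγ : 1 ≤ γ) (h0 : 0 < vp) (h1 : vp < 1) : profileRate γ vp vp = 0 := by
  have := rpow_vp_lt_one hγ h0 h1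
  have h2 : 1 - vp ^ γ ≠ 0 := by linarith
  rw [profileRate, mul_sub, pressureConst_mul_rpow hγ h0 h1, pressureConst]
  field_simp
  ring

theorem hasDerivAt_profileRate (γ vp : ℝ) {v : ℝ} (hv : 0 < v) :
    HasDerivAt (profileRate γ vp) (1 - pressureConst γ vp * γ * v ^ (-γ - 1)) v := by
  have h := ((hasDerivAt_id v).sub_const 1).add
    (((Real.hasDerivAt_rpow_const (p := -γ) (Or.inl hv.ne')).sub_const 1).const_mul
      (pressureConst γ vp))
  exact h.congr_deriv (by ring)

/-- The signs of the profile equation come from this convexity: the rate vanishes at `v₊` and `1`,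
so it is negative between them and nonnegative outside, and its secants give linear bounds near the
end states. -/
theorem strictConvexOn_profileRate (hγ : 1 ≤ γ) (h0 : 0 < vp) (h1 : vp < 1) :
    StrictConvexOn ℝ (Ioi 0) (profileRate γ vp) := by
  refine StrictMonoOn.strictConvexOn_of_deriv (convex_Ioi 0)
    (fun v hv => (hasDerivAt_profileRate γ vp hv).continuousAt.continuousWithinAt) ?_
  rw [interior_Ioi]
  intro x hx y hy hxy
  rw [(hasDerivAt_profileRate γ vp hx).deriv, (hasDerivAt_profileRate γ vp hy).deriv]
  have h2 := Real.rpow_lt_rpow_of_neg hx hxy (by linarith : -γ - 1 < 0)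
  have h3 : 0 < pressureConst γ vp * γ := mul_pos (pressureConst_pos hγ h0 h1) (by linarith)
  linarith [mul_lt_mul_of_pos_left h2 h3]

theorem profileRate_neg (hγ : 1 ≤ γ) (h0 : 0 < vp) {v : ℝ} (hv : vp < v) (hv1 : v < 1) :
    profileRate γ vp v < 0 := by
  have h1 := hv.trans hv1
  have hs := (strictConvexOn_profileRate hγ h0 h1).slope_strict_mono_adjacent (mem_Ioi.2 h0)
    (mem_Ioi.2 one_pos) hv hv1
  rw [profileRate_vp hγ h0 h1, profileRate_one, sub_zero, zero_sub] at hs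
  by_contra! h
  have h2 : 0 ≤ profileRate γ vp v / (v - vp) := div_nonneg h (by linarith)
  have h3 : -profileRate γ vp v / (1 - v) ≤ 0 :=
    div_nonpos_of_nonpos_of_nonneg (by linarith) (by linarith)
  linarith

theorem profileRate_nonneg_left (hγ : 1 ≤ γ) (h1 : vp < 1) {v : ℝ} (hv : 0 < v)
    (hvp : v < vp) : 0 ≤ profileRate γ vp v := by
  have h0 := hv.trans hvp
  have hs := (strictConvexOn_profileRate hγ h0 h1).convexOn.slope_mono_adjacent (mem_Ioi.2 hv)
    (mem_Ioi.2 one_pos) hvp h1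
  rw [profileRate_vp hγ h0 h1, profileRate_one, zero_sub, sub_zero, zero_div,
    div_le_iff₀ (by linarith)] at hs
  linarith

theorem profileRate_nonneg_right (hγ : 1 ≤ γ) (h0 : 0 < vp) (h1 : vp < 1) {v : ℝ} (hv : 1 < v) :
    0 ≤ profileRate γ vp v := by
  have hs := (strictConvexOn_profileRate hγ h0 h1).convexOn.slope_mono_adjacent (mem_Ioi.2 h0)
    (mem_Ioi.2 (one_pos.trans hv)) h1 hv
  rw [profileRate_vp hγ h0 h1, profileRate_one, sub_zero, sub_zero, zero_div,
    le_div_iff₀ (by linarith)] at hs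
  linarith

theorem exists_profileRate_le_left (hγ : 1 ≤ γ) (h0 : 0 < vp) {v0 : ℝ} (hv : vp ≤ v0)
    (hv1 : v0 < 1) : ∃ κ, 0 < κ ∧ ∀ y, vp ≤ y → y ≤ v0 → profileRate γ vp y ≤ -κ * (y - vp) := by
  have h1 := hv.trans_lt hv1
  rcases hv.eq_or_lt with rfl | hv
  · refine ⟨1, one_pos, fun y hy hy' => ?_⟩
    obtain rfl : y = vp := le_antisymm hy' hy
    rw [profileRate_vp hγ h0 h1]; simp
  have hneg := profileRate_neg hγ h0 hv hv1
  refine ⟨-profileRate γ vp v0 / (v0 - vp), div_pos (by linarith) (by linarith),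
    fun y hy hy' => ?_⟩
  rcases hy.eq_or_lt with rfl | hy
  · rw [profileRate_vp hγ h0 h1]; simp
  have := (strictConvexOn_profileRate hγ h0 h1).convexOn.secant_mono (a := vp) (x := y) (y := v0)
    h0 (h0.trans hy) (h0.trans hv) hy.ne' hv.ne' hy'
  rw [profileRate_vp hγ h0 h1, sub_zero, sub_zero, div_le_iff₀ (by linarith)] at this
  rw [neg_div, neg_neg]
  exact this

theorem exists_profileRate_le_right (hγ : 1 ≤ γ) (h0 : 0 < vp) {v0 : ℝ} (hv : vp < v0)
    (hv1 : v0 < 1) : ∃ κ, 0 < κ ∧ ∀ y, v0 ≤ y → y ≤ 1 → profileRate γ vp y ≤ -κ * (1 - y) := by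
  have h1 := hv.trans hv1
  have hneg := profileRate_neg hγ h0 hv hv1
  refine ⟨-profileRate γ vp v0 / (1 - v0), div_pos (by linarith) (by linarith),
    fun y hy hy' => ?_⟩
  rcases hy'.eq_or_lt with rfl | hy'
  · rw [profileRate_one]; simp
  have := (strictConvexOn_profileRate hγ h0 h1).convexOn.secant_mono (a := 1) (x := v0) (y := y)
    (mem_Ioi.2 one_pos) (h0.trans hv) ((h0.trans hv).trans_le hy) hv1.ne hy'.ne hy
  rw [profileRate_one, sub_zero, sub_zero, le_div_iff_of_neg (by linarith)] at this
  have e : profileRate γ vp v0 / (v0 - 1) * (y - 1) =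
      -(-profileRate γ vp v0 / (1 - v0)) * (1 - y) := by
    have : v0 - 1 ≠ 0 := by linarith
    have : 1 - v0 ≠ 0 := by linarith
    field_simp
    ring
  linarith

/-! #### The coefficient `h = v - f` -/

/-- The coefficient `v - f(v)`. -/
def hCoeff (γ vp v : ℝ) : ℝ := v - fCoeff γ vp v

theorem hCoeff_eq (γ vp v : ℝ) : hCoeff γ vp v =
    -v + pressureConst γ vp * (γ - 1) * v ^ (-γ) + (pressureConst γ vp + 1) := by
  rw [hCoeff, fCoeff]; ring

theorem hCoeff_one (γ vp : ℝ) : hCoeff γ vp 1 = pressureConst γ vp * γ := by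
  rw [hCoeff_eq, Real.one_rpow]; ring

/-- Bernoulli's inequality gives `1 - v₊^γ ≤ γ (1 - v₊)`. The strict inequality puts the inflow end
state in the case `h > v`, where the eigenvalue branch passes through `0` at `z = 0` and still
continues analytically. -/
theorem hCoeff_vp (hγ : 1 ≤ γ) (h0 : 0 < vp) (h1 : vp < 1) : vp < hCoeff γ vp vp := by
  have hr := profileRate_vp hγ h0 h1
  rw [profileRate, mul_sub] at hr
  have hp := pressureConst_mul_rpow hγ h0 h1
  have hlt := rpow_vp_lt_one hγ h0 h1
  have hb := one_add_mul_self_le_rpow_one_add (by linarith : -1 ≤ vp - 1) hγ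
  rw [show 1 + (vp - 1) = vp by ring] at hb
  have h2 : 1 ≤ γ * ((1 - vp) / (1 - vp ^ γ)) := by
    rw [mul_div_assoc', le_div_iff₀ (by linarith)]; linarith
  rw [← hp] at h2
  have e : hCoeff γ vp vp = γ * (pressureConst γ vp * vp ^ (-γ)) := by
    rw [hCoeff_eq]; linarith
  rw [e]; linarith

/-- Bernoulli's inequality applied to `1 / v₊`, together with `1 / v₊ - 1 > 1 - v₊`. As `h = a γ` at
`v = 1`, the outflow end state satisfies `h < v`. -/
theorem pressureConst_mul_lt_one (hγ : 1 ≤ γ) (h0 : 0 < vp) (h1 : vp < 1) :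
    pressureConst γ vp * γ < 1 := by
  have hlt := rpow_vp_lt_one hγ h0 h1
  have hp := Real.rpow_pos_of_pos h0 γ
  have hb := one_add_mul_self_le_rpow_one_add (s := 1 / vp - 1)
    (by have : 0 < 1 / vp := by positivity
        linarith) hγ
  rw [show 1 + (1 / vp - 1) = vp⁻¹ by ring, Real.inv_rpow h0.le] at hb
  have h2 : 1 - vp < 1 / vp - 1 := by
    have : (1 / vp - 1) - (1 - vp) = (1 - vp) ^ 2 / vp := by field_simp
    have : 0 < (1 - vp) ^ 2 / vp := div_pos (pow_pos (by linarith) 2) h0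
    linarith
  have h3 : 1 + γ * (1 - vp) < (vp ^ γ)⁻¹ := by
    have := mul_lt_mul_of_pos_left h2 (by linarith : 0 < γ)
    linarith
  have h4 := mul_lt_mul_of_pos_left h3 hp
  rw [mul_inv_cancel₀ hp.ne'] at h4
  rw [pressureConst, div_mul_eq_mul_div, div_lt_one (by linarith)]
  linarith

theorem le_hCoeff (hγ : 1 ≤ γ) (h0 : 0 < vp) (h1 : vp < 1) {v : ℝ} (hv : 0 < v) (hv1 : v ≤ 1) :
    pressureConst γ vp * γ ≤ hCoeff γ vp v := by
  have h2 := Real.one_le_rpow_of_pos_of_le_one_of_nonpos hv hv1 (by linarith : -γ ≤ 0)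
  have h3 := mul_le_mul_of_nonneg_left h2
    (mul_nonneg (pressureConst_pos hγ h0 h1).le (by linarith : 0 ≤ γ - 1))
  rw [hCoeff_eq]
  linarith

/-- The derivative of `h = v - f(v)`. -/
def hCoeffDeriv (γ vp v : ℝ) : ℝ := -1 - pressureConst γ vp * (γ - 1) * γ * v ^ (-γ - 1)

theorem hasDerivAt_hCoeff (γ vp : ℝ) {v : ℝ} (hv : 0 < v) :
    HasDerivAt (hCoeff γ vp) (hCoeffDeriv γ vp v) v := by
  have h := ((hasDerivAt_id v).neg.add
    ((Real.hasDerivAt_rpow_const (p := -γ) (Or.inl hv.ne')).const_mul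
      (pressureConst γ vp * (γ - 1)))).add_const (pressureConst γ vp + 1)
  refine (h.congr_of_eventuallyEq (Eventually.of_forall fun x => ?_)).congr_deriv ?_
  · simp [hCoeff_eq]
  · rw [hCoeffDeriv]; ring

theorem hasDerivAt_fCoeff (γ vp : ℝ) {v : ℝ} (hv : 0 < v) :
    HasDerivAt (fCoeff γ vp) (1 - hCoeffDeriv γ vp v) v := by
  have h := (hasDerivAt_id v).sub (hasDerivAt_hCoeff γ vp hv)
  refine h.congr_of_eventuallyEq (Eventually.of_forall fun x => ?_)
  simp [hCoeff]

/-- The coefficient `f` is the derivative of `H`, so `H` along the profile solves the linearized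
equation. This identifies the outflow mode at `z = 0`. -/
theorem hasDerivAt_profileRHS (γ vp : ℝ) {v : ℝ} (hv : 0 < v) :
    HasDerivAt (profileRHS γ vp) (fCoeff γ vp v) v := by
  have h := (hasDerivAt_id v).mul (hasDerivAt_profileRate γ vp hv)
  refine h.congr_deriv ?_
  have : v * v ^ (-γ - 1) = v ^ (-γ) := by
    rw [Real.rpow_sub hv, Real.rpow_one]; field_simp
  simp only [id, profileRate, fCoeff]
  linear_combination (-pressureConst γ vp * γ) * this

theorem exists_abs_hCoeffDeriv_le (γ vp : ℝ) {ν : ℝ} (hν : 0 < ν) :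
    ∃ C, 1 ≤ C ∧ ∀ v ∈ Icc ν 1, |hCoeffDeriv γ vp v| ≤ C := by
  have hc : ContinuousOn (hCoeffDeriv γ vp) (Icc ν 1) := by
    refine (continuousOn_const.sub (continuousOn_const.mul ?_))
    exact continuousOn_id.rpow_const fun x hx => Or.inl (hν.trans_le hx.1).ne'
  obtain ⟨C, hC⟩ := isCompact_Icc.exists_bound_of_continuousOn hc
  exact ⟨max C 1, le_max_right _ _, fun v hv => (hC v hv).trans (le_max_left _ _)⟩

theorem abs_fCoeff_sub_le {ν C : ℝ} (hν : 0 < ν)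
    (hC : ∀ v ∈ Icc ν 1, |hCoeffDeriv γ vp v| ≤ C) {x y : ℝ} (hx : x ∈ Icc ν 1)
    (hy : y ∈ Icc ν 1) : |fCoeff γ vp y - fCoeff γ vp x| ≤ (1 + C) * |y - x| := by
  refine (convex_Icc ν 1).norm_image_sub_le_of_norm_hasDerivWithin_le
    (fun v hv => (hasDerivAt_fCoeff γ vp (hν.trans_le hv.1)).hasDerivWithinAt) (fun v hv => ?_) hx hy
  refine (norm_sub_le _ _).trans ?_
  rw [norm_one]
  exact add_le_add le_rfl (hC v hv)

theorem exists_hCoeff_le (γ vp : ℝ) {ν : ℝ} (hν : 0 < ν) :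
    ∃ C, 1 ≤ C ∧ ∀ v ∈ Icc ν 1, hCoeff γ vp v ≤ C := by
  obtain ⟨C, hC⟩ := isCompact_Icc.exists_bound_of_continuousOn (s := Icc ν 1)
    (f := hCoeff γ vp)
    fun v hv => (hasDerivAt_hCoeff γ vp (hν.trans_le hv.1)).continuousAt.continuousWithinAt
  exact ⟨max C 1, le_max_right _ _, fun v hv =>
    (le_abs_self _).trans ((hC v hv).trans (le_max_left _ _))⟩

end

/-! #### Profiles of the full model -/

theorem IsInflowProfile.mem {γ vp v0 : ℝ} {v : ℝ → ℝ} (hγ : 1 ≤ γ) (h0 : 0 < vp) (hv : vp ≤ v0)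
    (hv1 : v0 < 1) (hp : IsInflowProfile γ vp v0 v) {x : ℝ} (hx : 0 ≤ x) : v x ∈ Icc vp v0 := by
  have h1 := hv.trans_lt hv1
  constructor
  · refine ge_of_barrier h0 hp.ode (hp.init.symm ▸ hv) (fun y hy hy' => ?_) hx
    have : 0 < y := by linarith
    exact mul_nonneg this.le (profileRate_nonneg_left hγ h1 this hy')
  · refine le_of_barrier (sub_pos.2 hv1) hp.ode hp.init.le (fun y hy hy' => ?_) hx
    exact mul_nonpos_of_nonneg_of_nonpos (by linarith)
      (profileRate_neg hγ h0 (hv.trans_lt hy) (by linarith)).le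

theorem IsInflowProfile.exists_decay {γ vp v0 : ℝ} {v : ℝ → ℝ} (hγ : 1 ≤ γ) (h0 : 0 < vp)
    (hv : vp ≤ v0) (hv1 : v0 < 1) (hp : IsInflowProfile γ vp v0 v) :
    ∃ c, 0 < c ∧ ∀ x, 0 ≤ x → |v x - vp| ≤ 1 * Real.exp (-c * x) := by
  obtain ⟨κ, hκ, hle⟩ := exists_profileRate_le_left hγ h0 hv hv1
  refine ⟨vp * κ, by positivity, fun x hx => ?_⟩
  have hm := fun x hx => hp.mem hγ h0 hv hv1 (x := x) hx
  rw [abs_of_nonneg (by linarith [(hm x hx).1])]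
  refine (le_exp_of_deriv_le (c := vp * κ) (fun x hx => (hp.ode x hx).sub_const vp)
    (fun x hx => ?_) hx).trans ?_
  · obtain ⟨h1, h2⟩ := hm x hx
    have h3 := mul_le_mul_of_nonneg_left (hle _ h1 h2) (h0.le.trans h1)
    have h4 := mul_le_mul_of_nonneg_right h1 (mul_nonneg hκ.le (sub_nonneg.2 h1))
    rw [profileRHS_eq]
    linarith
  · have : v 0 - vp ≤ 1 := by rw [hp.init]; linarith
    exact mul_le_mul_of_nonneg_right this (Real.exp_pos _).le

theorem IsOutflowProfile.hasDerivWithinAt_comp_neg {γ vp v0 : ℝ} {v : ℝ → ℝ}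
    (hp : IsOutflowProfile γ vp v0 v) {t : ℝ} (ht : t ∈ Ici (0 : ℝ)) :
    HasDerivWithinAt (fun t => v (-t)) (-profileRHS γ vp (v (-t))) (Ici 0) t := by
  have h1 := hp.ode (-t) (by simpa using ht)
  have h2 := h1.scomp t ((hasDerivAt_neg t).hasDerivWithinAt (s := Ici 0))
    (fun y hy => by simpa using hy)
  simpa [Function.comp_def] using h2

theorem IsOutflowProfile.mem {γ vp v0 : ℝ} {v : ℝ → ℝ} (hγ : 1 ≤ γ) (h0 : 0 < vp) (hv : vp < v0)
    (hv1 : v0 < 1) (hp : IsOutflowProfile γ vp v0 v) {t : ℝ} (ht : 0 ≤ t) :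
    v (-t) ∈ Icc v0 1 := by
  have h1 := hv.trans hv1
  have hi : v (-0) = v0 := by rw [neg_zero]; exact hp.init
  constructor
  · refine ge_of_barrier (v := fun t => v (-t)) (F := fun y => -profileRHS γ vp y) (sub_pos.2 hv)
      (fun t ht => hp.hasDerivWithinAt_comp_neg ht) hi.ge (fun y hy hy' => ?_) ht
    have : vp < y := by linarith
    exact neg_nonneg.2 (mul_nonpos_of_nonneg_of_nonpos (by linarith)
      (profileRate_neg hγ h0 this (by linarith)).le)
  · refine le_of_barrier (v := fun t => v (-t)) (F := fun y => -profileRHS γ vp y) one_pos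
      (fun t ht => hp.hasDerivWithinAt_comp_neg ht) (hi.trans_le hv1.le) (fun y hy _ => ?_) ht
    exact neg_nonpos.2 (mul_nonneg (by linarith) (profileRate_nonneg_right hγ h0 h1 hy))

theorem IsOutflowProfile.exists_decay {γ vp v0 : ℝ} {v : ℝ → ℝ} (hγ : 1 ≤ γ) (h0 : 0 < vp)
    (hv : vp < v0) (hv1 : v0 < 1) (hp : IsOutflowProfile γ vp v0 v) :
    ∃ c, 0 < c ∧ ∀ t, 0 ≤ t → |v (-t) - 1| ≤ 1 * Real.exp (-c * t) := by
  obtain ⟨κ, hκ, hle⟩ := exists_profileRate_le_right hγ h0 hv hv1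
  have hv0 := h0.trans hv
  refine ⟨v0 * κ, by positivity, fun t ht => ?_⟩
  have hm := fun t ht => hp.mem hγ h0 hv hv1 (t := t) ht
  rw [abs_sub_comm, abs_of_nonneg (by linarith [(hm t ht).2])]
  refine (le_exp_of_deriv_le (u := fun t => 1 - v (-t)) (c := v0 * κ)
    (fun t ht => (hp.hasDerivWithinAt_comp_neg ht).const_sub 1) (fun t ht => ?_) ht).trans ?_
  · obtain ⟨h1, h2⟩ := hm t ht
    have h3 := mul_le_mul_of_nonneg_left (hle _ h1 h2) (hv0.le.trans h1)
    have h4 := mul_le_mul_of_nonneg_right h1 (mul_nonneg hκ.le (sub_nonneg.2 h2))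
    rw [profileRHS_eq]
    linarith
  · have : 1 - v (-0) ≤ 1 := by rw [neg_zero, hp.init]; linarith
    exact mul_le_mul_of_nonneg_right this (Real.exp_pos _).le

/-! #### The limiting profile -/

theorem limitProfile_eq {v0 : ℝ} (h0 : 0 < v0) (h1 : v0 < 1) (x : ℝ) :
    limitProfile v0 x = v0 / (v0 + (1 - v0) * Real.exp x) := by
  have h2 : 0 < 1 - v0 := by linarith
  have e : Real.exp (x - Real.log (v0 / (1 - v0))) = Real.exp x * (1 - v0) / v0 := by
    rw [Real.exp_sub, Real.exp_log (by positivity)]; field_simp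
  have hy : ∀ y : ℝ, (1 - Real.tanh (y / 2)) / 2 = 1 / (1 + Real.exp y) := fun y => by
    have h3 : Real.exp y = Real.exp (y / 2) * Real.exp (y / 2) := by
      rw [← Real.exp_add]; congr 1; ring
    rw [Real.tanh_eq_sinh_div_cosh, Real.sinh_eq, Real.cosh_eq, Real.exp_neg, h3]
    have := Real.exp_pos (y / 2)
    field_simp
    ring
  rw [limitProfile, hy, e]
  have := Real.exp_pos x
  field_simp

section
variable {v0 : ℝ}

theorem limitProfile_zero (h0 : 0 < v0) (h1 : v0 < 1) : limitProfile v0 0 = v0 := by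
  rw [limitProfile_eq h0 h1]; simp

theorem limitProfile_pos (h0 : 0 < v0) (h1 : v0 < 1) (x : ℝ) : 0 < limitProfile v0 x := by
  rw [limitProfile_eq h0 h1]
  have := Real.exp_pos x
  have : 0 < 1 - v0 := by linarith
  positivity

theorem limitProfile_lt_one (h0 : 0 < v0) (h1 : v0 < 1) (x : ℝ) : limitProfile v0 x < 1 := by
  rw [limitProfile_eq h0 h1]
  have := Real.exp_pos x
  have h2 : 0 < 1 - v0 := by linarith
  rw [div_lt_one (by positivity)]
  have := mul_pos h2 this
  linarith

theorem hasDerivAt_limitProfile (h0 : 0 < v0) (h1 : v0 < 1) (x : ℝ) :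
    HasDerivAt (limitProfile v0) (limitProfile v0 x * (limitProfile v0 x - 1)) x := by
  have := Real.exp_pos x
  have h2 : 0 < 1 - v0 := by linarith
  have h3 : v0 + (1 - v0) * Real.exp x ≠ 0 := by positivity
  have h := (hasDerivAt_const x v0).div (((Real.hasDerivAt_exp x).const_mul (1 - v0)).const_add v0) h3
  refine (h.congr_of_eventuallyEq (Eventually.of_forall fun y => limitProfile_eq h0 h1 y)).congr_deriv
    ?_
  rw [limitProfile_eq h0 h1]
  field_simp
  ring

theorem limitProfile_le (h0 : 0 < v0) (h1 : v0 < 1) (x : ℝ) :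
    limitProfile v0 x ≤ v0 / (1 - v0) * Real.exp (-1 * x) := by
  have h2 : 0 < 1 - v0 := by linarith
  rw [limitProfile_eq h0 h1, neg_one_mul, Real.exp_neg]
  have := Real.exp_pos x
  rw [← div_eq_mul_inv, div_div]
  exact div_le_div_of_nonneg_left h0.le (by positivity) (by linarith)

theorem one_sub_limitProfile_le (h0 : 0 < v0) (h1 : v0 < 1) (x : ℝ) :
    1 - limitProfile v0 x ≤ (1 - v0) / v0 * Real.exp x := by
  have h2 : 0 < 1 - v0 := by linarith
  have := Real.exp_pos x
  have e : 1 - limitProfile v0 x = (1 - v0) * Real.exp x / (v0 + (1 - v0) * Real.exp x) := by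
    rw [limitProfile_eq h0 h1]
    field_simp
    ring
  rw [e, div_mul_eq_mul_div]
  exact div_le_div_of_nonneg_left (by positivity) h0 (by linarith [mul_pos h2 this])

theorem limitProfile_translate (v0 x : ℝ) :
    limitProfile v0 x = limitProfile (1 / 2) (x - Real.log (v0 / (1 - v0))) := by
  simp only [limitProfile]
  norm_num

end

end BoundaryLayer

end

noncomputable section

namespace BoundaryLayer

/-! ### Matrix systems -/

/-- A matrix as a continuous linear map. -/
def matCLM : Matrix (Fin 3) (Fin 3) ℂ →ₗ[ℂ] (Fin 3 → ℂ) →L[ℂ] (Fin 3 → ℂ) where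
  toFun A := LinearMap.toContinuousLinearMap A.mulVecLin
  map_add' A B := by ext x i; simp
  map_smul' a A := by ext x i; simp

theorem matCLM_apply (A : Matrix (Fin 3) (Fin 3) ℂ) (y : Fin 3 → ℂ) :
    matCLM A y = A.mulVec y := rfl

theorem analyticAt_matCLM {A : ℂ → Matrix (Fin 3) (Fin 3) ℂ} {z : ℂ}
    (hA : ∀ i j, AnalyticAt ℂ (fun z => A z i j) z) : AnalyticAt ℂ (fun z => matCLM (A z)) z := by
  have h : (fun z => matCLM (A z)) =
      fun z => ∑ i, ∑ j, A z i j • matCLM (Matrix.single i j 1) := by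
    funext z
    conv_lhs => rw [Matrix.matrix_eq_sum_single (A z)]
    simp only [map_sum]
    refine Finset.sum_congr rfl fun i _ => Finset.sum_congr rfl fun j _ => ?_
    rw [← map_smul, Matrix.smul_single, smul_eq_mul, mul_one]
  rw [h]
  exact Finset.analyticAt_fun_sum _ fun i _ => Finset.analyticAt_fun_sum _ fun j _ =>
    (hA i j).smul analyticAt_const

theorem isDecaying_matCLM {α β : ℝ → ℝ} {c C₁ C₂ : ℝ} (E₁ E₂ : Matrix (Fin 3) (Fin 3) ℂ)
    (hα : ContinuousOn α (Ici 0)) (hβ : ContinuousOn β (Ici 0))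
    (hα' : ∀ x, 0 ≤ x → |α x| ≤ C₁ * Real.exp (-c * x))
    (hβ' : ∀ x, 0 ≤ x → |β x| ≤ C₂ * Real.exp (-c * x)) :
    IsDecaying (fun x => matCLM ((α x : ℂ) • E₁ + (β x : ℂ) • E₂)) c
      (C₁ * ‖matCLM E₁‖ + C₂ * ‖matCLM E₂‖) where
  cont := by
    simp only [map_add, map_smul]
    exact ((Complex.continuous_ofReal.comp_continuousOn hα).smul continuousOn_const).add
      ((Complex.continuous_ofReal.comp_continuousOn hβ).smul continuousOn_const)
  bound x hx := by
    rw [map_add, map_smul, map_smul]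
    refine (norm_add_le _ _).trans ?_
    rw [norm_smul, norm_smul, Complex.norm_real, Complex.norm_real]
    have h1 := mul_le_mul_of_nonneg_right (hα' x hx) (norm_nonneg (matCLM E₁))
    have h2 := mul_le_mul_of_nonneg_right (hβ' x hx) (norm_nonneg (matCLM E₂))
    rw [Real.norm_eq_abs, Real.norm_eq_abs]
    linarith

theorem isSol_matCLM {A : Matrix (Fin 3) (Fin 3) ℂ} {E : ℝ → Matrix (Fin 3) (Fin 3) ℂ}
    {y : ℝ → Fin 3 → ℂ} : IsSol (matCLM A) (fun x => matCLM (E x)) y ↔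
      ∀ x ∈ Ici (0 : ℝ), ∀ i, HasDerivWithinAt (fun x => y x i) (((A + E x).mulVec (y x)) i)
        (Ici 0) x := by
  refine forall₂_congr fun x _ => ?_
  rw [hasDerivWithinAt_pi]
  simp only [matCLM_apply, Matrix.add_mulVec]

theorem nonnegSpectrum_matCLM {A : Matrix (Fin 3) (Fin 3) ℂ}
    (h : ∀ (r a b c : ℂ), A.mulVec ![a, b, c] = r • ![a, b, c] → r.re < 0 →
      a = 0 ∧ b = 0 ∧ c = 0) : NonnegSpectrum (matCLM A) := fun r w hw hr => by
  by_contra! hneg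
  have e : w = ![w 0, w 1, w 2] := by ext i; fin_cases i <;> rfl
  obtain ⟨h0, h1, h2⟩ := h r (w 0) (w 1) (w 2) (by rw [← e]; exact hr) hneg
  exact hw (by rw [e, h0, h1, h2]; ext i; fin_cases i <;> rfl)

theorem tendsto_vec3 {ι : Type*} {l : Filter ι} {y : ι → Fin 3 → ℂ} {a b c : ℂ} :
    Tendsto y l (𝓝 ![a, b, c]) ↔ Tendsto (fun x => y x 0) l (𝓝 a) ∧
      Tendsto (fun x => y x 1) l (𝓝 b) ∧ Tendsto (fun x => y x 2) l (𝓝 c) := by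
  rw [tendsto_pi_nhds, Fin.forall_fin_succ, Fin.forall_fin_two]
  rfl

/-! ### The eigenvalue branch -/

/-- The eigenvalue with positive real part, in terms of the branch parameter. -/
def branchEig (v h : ℝ) (T : ℂ → ℂ) (z : ℂ) : ℂ := √v * (T z - h / T z)

namespace IsBranch

variable {v h δ : ℝ} {T : ℂ → ℂ} {z : ℂ}

theorem lt_re (hb : IsBranch v h δ T) (hz : z ∈ nonstable) : -δ < z.re :=
  (neg_neg_of_pos hb.pos).trans_le hz

theorem eventually_lt_re (hb : IsBranch v h δ T) (hz : z ∈ nonstable) :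
    ∀ᶠ w in 𝓝 z, -δ < w.re :=
  Complex.continuous_re.continuousAt.eventually_const_lt (hb.lt_re hz)

theorem ne_zero (hb : IsBranch v h δ T) (hz : -δ < z.re) : T z ≠ 0 :=
  ne_zero_of_re_pos (hb.re_pos z hz) le_rfl

theorem eig_mul (hb : IsBranch v h δ T) (hz : -δ < z.re) :
    branchEig v h T z * T z = √v * (z + branchEig v h T z) := by
  have h0 := hb.ne_zero hz
  have h1 := hb.eq z hz
  have e : z + branchEig v h T z = specParam (√v) h (T z) + branchEig v h T z := by rw [h1]
  rw [e, specParam, branchEig]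
  field_simp
  ring

theorem add_eig (hb : IsBranch v h δ T) (hz : -δ < z.re) :
    z + branchEig v h T z = T z ^ 2 - h := by
  have h0 := hb.ne_zero hz
  have e : z + branchEig v h T z = specParam (√v) h (T z) + branchEig v h T z := by
    rw [hb.eq z hz]
  rw [e, specParam, branchEig]
  field_simp
  ring

theorem cubic (hb : IsBranch v h δ T) (hv : 0 ≤ v) (hz : -δ < z.re) :
    branchEig v h T z ^ 3 + (z - (v - h : ℝ)) * branchEig v h T z ^ 2 -
      2 * z * v * branchEig v h T z - v * z ^ 2 = 0 := by
  have h1 := hb.eig_mul hz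
  have h2 := hb.add_eig hz
  have h3 : ((√v : ℝ) : ℂ) ^ 2 = v := by rw [← Complex.ofReal_pow, Real.sq_sqrt hv]
  push_cast
  linear_combination (branchEig v h T z ^ 2) * h2 +
    (branchEig v h T z * T z + √v * (z + branchEig v h T z)) * h1 +
    (z + branchEig v h T z) ^ 2 * h3

theorem analyticAt_eig (hb : IsBranch v h δ T) (hz : -δ < z.re) :
    AnalyticAt ℂ (branchEig v h T) z :=
  analyticAt_const.mul ((hb.analytic z hz).sub
    (analyticAt_const.div (hb.analytic z hz) (hb.ne_zero hz)))

theorem eig_conj (hb : IsBranch v h δ T) (hz : -δ < z.re) :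
    branchEig v h T (starRingEnd ℂ z) = starRingEnd ℂ (branchEig v h T z) := by
  rw [branchEig, branchEig, hb.conj z hz]; simp

theorem eig_re_ge (hb : IsBranch v h δ T) (hh : 0 ≤ h) (hz : z ∈ nonstable) :
    √v * ((T z).re - h / (T z).re) ≤ (branchEig v h T z).re := by
  have h1 := re_div_le (T := T z) hh (hb.re_pos z (hb.lt_re hz))
  rw [branchEig, Complex.re_ofReal_mul, Complex.sub_re]
  exact mul_le_mul_of_nonneg_left (by linarith) (Real.sqrt_nonneg v)

theorem eig_re_nonneg (hb : IsBranch v h δ T) (hh : 0 ≤ h) (hz : z ∈ nonstable) :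
    0 ≤ (branchEig v h T z).re := by
  refine le_trans (mul_nonneg (Real.sqrt_nonneg v) (sub_nonneg.2 ?_)) (hb.eig_re_ge hh hz)
  rw [div_le_iff₀ (hb.re_pos z (hb.lt_re hz)), ← sq]
  exact hb.le_sq z hz

/-- One has `Re r = √v * Re T * (1 - h / |T|²)`, and `|T|² ≥ (Re T)² ≥ h`. Equality would make `T`
real with `T² = h`, and then `specParam` gives `z = 0`. -/
theorem eig_re_pos (hb : IsBranch v h δ T) (hv : 0 < v) (hz : z ∈ nonstable)
    (hz0 : z ≠ 0) : 0 < (branchEig v h T z).re := by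
  have hT := hb.re_pos z (hb.lt_re hz)
  have hs := hb.le_sq z hz
  have hk : 0 < √v := Real.sqrt_pos.2 hv
  have e : (branchEig v h T z).re =
      √v * ((T z).re * (1 - h / Complex.normSq (T z))) := by
    rw [branchEig, Complex.re_ofReal_mul, Complex.sub_re, Complex.div_re]
    simp only [Complex.ofReal_re, Complex.ofReal_im, zero_mul, zero_div, add_zero]
    ring
  have hN : Complex.normSq (T z) = (T z).re ^ 2 + (T z).im ^ 2 := by
    rw [Complex.normSq_apply]; ring
  have hNp : 0 < Complex.normSq (T z) := Complex.normSq_pos.2 (hb.ne_zero (hb.lt_re hz))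
  rw [e]
  refine mul_pos hk (mul_pos hT (sub_pos.2 ?_))
  rw [div_lt_one hNp, hN]
  refine lt_of_le_of_ne (by nlinarith [sq_nonneg (T z).im]) fun heq => hz0 ?_
  have him : (T z).im = 0 := by
    have : (T z).im ^ 2 ≤ 0 := by linarith
    exact pow_eq_zero_iff (two_ne_zero) |>.1 (le_antisymm this (sq_nonneg _))
  have hTr : T z = ((T z).re : ℂ) := by
    apply Complex.ext <;> simp [him]
  rw [him] at heq
  have hsq : T z ^ 2 = h := by
    rw [hTr, ← Complex.ofReal_pow, heq]; simp
  have h0 := hb.ne_zero (hb.lt_re hz)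
  have := hb.eq z (hb.lt_re hz)
  rw [← this, specParam, ← hsq]
  field_simp
  ring

theorem eig_re_ge_one_sub (hb : IsBranch 1 h δ T) (hh : 0 ≤ h) (hz : z ∈ nonstable) :
    1 - h ≤ (branchEig 1 h T z).re := by
  refine le_trans ?_ (hb.eig_re_ge hh hz)
  have h1 := hb.sqrt_le z hz
  rw [Real.sqrt_one] at h1 ⊢
  rw [one_mul]
  have h2 : h / (T z).re ≤ h := div_le_self hh h1
  linarith

/-- At `z = 0` the defining equation factors as `(T² - h) (T - √v) = 0`; for `h > v` the second root
violates `h ≤ (Re T)²`. -/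
theorem sq_zero (hb : IsBranch v h δ T) (hv : 0 < v) (hvh : v < h) : T 0 ^ 2 = h := by
  have hz := zero_mem_nonstable
  have h0 := hb.ne_zero (hb.lt_re hz)
  have h1 := hb.eq 0 (hb.lt_re hz)
  rw [specParam] at h1
  have h2 : (T 0 ^ 2 - h) * (T 0 - √v) = 0 := by
    field_simp at h1
    linear_combination h1
  rcases mul_eq_zero.1 h2 with h3 | h3
  · exact sub_eq_zero.1 h3
  · exfalso
    have h4 := hb.le_sq 0 le_rfl
    rw [sub_eq_zero.1 h3, Complex.ofReal_re, Real.sq_sqrt hv.le] at h4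
    linarith

theorem eig_zero_of_lt (hb : IsBranch v h δ T) (hv : 0 < v) (hvh : v < h) :
    branchEig v h T 0 = 0 := by
  have h1 := hb.add_eig (hb.lt_re zero_mem_nonstable)
  rw [hb.sq_zero hv hvh, zero_add, sub_self] at h1
  exact h1

theorem eq_of_root (hb : IsBranch v h δ T) {r : ℂ} (hz : z ∈ nonstable) (hr : 0 < r.re)
    (hc : r ^ 3 + (z - (v - h : ℝ)) * r ^ 2 - 2 * z * v * r - v * z ^ 2 = 0) :
    r = branchEig v h T z := hb.root z r hz hr hc

end IsBranch

end BoundaryLayer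

end

noncomputable section

namespace BoundaryLayer

theorem hasDerivAt_cexp_mul (r : ℂ) (x : ℝ) :
    HasDerivAt (fun x : ℝ => Complex.exp (r * x)) (r * Complex.exp (r * x)) x := by
  have h1 : HasDerivAt (fun x : ℝ => r * (x : ℂ)) r x := by
    simpa using (Complex.ofRealCLM.hasDerivAt (x := x)).const_mul r
  exact h1.cexp.congr_deriv (mul_comm _ _)

theorem tendsto_cexp_mul {r : ℂ} (hr : r.re < 0) :
    Tendsto (fun x : ℝ => Complex.exp (r * x)) atTop (𝓝 0) := by
  rw [tendsto_zero_iff_norm_tendsto_zero]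
  simp only [Complex.norm_exp, Complex.re_mul_ofReal]
  exact Real.tendsto_exp_atBot.comp ((tendsto_const_mul_atBot_of_neg hr).2 tendsto_id)

theorem pos_of_tendsto_pos {f : ℝ → ℝ} {L : ℝ} (hf : ContinuousOn f (Ici 0))
    (h0 : ∀ x, 0 ≤ x → f x ≠ 0) (hL : 0 < L) (hlim : Tendsto f atTop (𝓝 L)) {x : ℝ} (hx : 0 ≤ x) :
    0 < f x := by
  by_contra! hneg
  obtain ⟨y, hxy, hy⟩ := ((eventually_ge_atTop x).and (hlim.eventually_const_lt hL)).exists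
  obtain ⟨t, ht, ht0⟩ := intermediate_value_Icc hxy
    (hf.mono fun t ht => hx.trans ht.1) ⟨hneg, hy.le⟩
  exact h0 t (hx.trans ht.1) ht0

/-! ### The adjoint system at `+∞` -/

/-- The conjugated adjoint system, shifted by the exponent `r`. -/
structure ShiftedInflow (v f : ℝ → ℝ) (z r : ℂ) (p q s : ℝ → ℂ) : Prop where
  dp : ∀ x ∈ Ici (0 : ℝ), HasDerivWithinAt p (r * p x - v x * s x) (Ici 0) x
  dq : ∀ x ∈ Ici (0 : ℝ), HasDerivWithinAt q (r * q x - z * p x - v x * s x) (Ici 0) x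
  ds : ∀ x ∈ Ici (0 : ℝ),
    HasDerivWithinAt s (r * s x - z * (p x + q x) + (z - f x) * s x) (Ici 0) x

theorem ShiftedInflow.mul_exp {v f : ℝ → ℝ} {z r : ℂ} {p q s : ℝ → ℂ}
    (h : ShiftedInflow v f z r p q s) (ρ : ℂ) :
    ShiftedInflow v f z (r + ρ) (fun x => Complex.exp (ρ * x) * p x)
      (fun x => Complex.exp (ρ * x) * q x) (fun x => Complex.exp (ρ * x) * s x) where
  dp x hx := ((hasDerivAt_cexp_mul ρ x).hasDerivWithinAt.mul (h.dp x hx)).congr_deriv (by ring)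
  dq x hx := ((hasDerivAt_cexp_mul ρ x).hasDerivWithinAt.mul (h.dq x hx)).congr_deriv (by ring)
  ds x hx := ((hasDerivAt_cexp_mul ρ x).hasDerivWithinAt.mul (h.ds x hx)).congr_deriv (by ring)

theorem ShiftedInflow.const_mul {v f : ℝ → ℝ} {z r : ℂ} {p q s : ℝ → ℂ}
    (h : ShiftedInflow v f z r p q s) (c : ℂ) :
    ShiftedInflow v f z r (fun x => c * p x) (fun x => c * q x) (fun x => c * s x) where
  dp x hx := ((h.dp x hx).const_mul c).congr_deriv (by ring)
  dq x hx := ((h.dq x hx).const_mul c).congr_deriv (by ring)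
  ds x hx := ((h.ds x hx).const_mul c).congr_deriv (by ring)

theorem ShiftedInflow.conj {v f : ℝ → ℝ} {z r : ℂ} {p q s : ℝ → ℂ}
    (h : ShiftedInflow v f z r p q s) :
    ShiftedInflow v f (starRingEnd ℂ z) (starRingEnd ℂ r) (fun x => starRingEnd ℂ (p x))
      (fun x => starRingEnd ℂ (q x)) (fun x => starRingEnd ℂ (s x)) where
  dp x hx := (h.dp x hx).star.congr_deriv (by simp)
  dq x hx := (h.dq x hx).star.congr_deriv (by simp)
  ds x hx := (h.ds x hx).star.congr_deriv (by simp)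

theorem ShiftedInflow.system {v f : ℝ → ℝ} {z : ℂ} {p q s : ℝ → ℂ}
    (h : ShiftedInflow v f z 0 p q s) : InflowSystem v (fun x => v x - f x) z p q s where
  dp x hx := (h.dp x hx).congr_deriv (by ring)
  dq x hx := (h.dq x hx).congr_deriv (by ring)
  ds x hx := (h.ds x hx).congr_deriv (by push_cast; ring)

/-- Conjugation replaces `-A^*` by `-Aᵀ`, whose entries are polynomials in `z`; this is why
analyticity is asked of the conjugate eigenvector. -/
theorem solvesAdjoint_iff {v f : ℝ → ℝ} {z : ℂ} {W : ℝ → Fin 3 → ℂ} :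
    SolvesAdjoint v f z W ↔ ShiftedInflow v (fun x => f (v x)) z 0 (fun x => star (W x 0))
      (fun x => star (W x 1)) (fun x => star (W x 2)) := by
  have key : ∀ x, star (-((coeffMatrix (v x) (f (v x)) z).conjTranspose.mulVec (W x))) =
      ![-(v x * star (W x 2)), -(z * star (W x 0)) - v x * star (W x 2),
        -(z * (star (W x 0) + star (W x 1))) + (z - f (v x)) * star (W x 2)] := fun x => by
    funext i
    fin_cases i <;>
      simp [coeffMatrix, Matrix.mulVec, dotProduct, Fin.sum_univ_three] <;> ring
  constructor
  · intro h
    have h' := fun x (hx : x ∈ Ici (0 : ℝ)) (i : Fin 3) =>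
      (hasDerivWithinAt_pi.1 (h x hx) i).star
    refine ⟨fun x hx => (h' x hx 0).congr_deriv ?_, fun x hx => (h' x hx 1).congr_deriv ?_,
      fun x hx => (h' x hx 2).congr_deriv ?_⟩
    · rw [← Pi.star_apply, key]; simp
    · rw [← Pi.star_apply, key]; simp
    · rw [← Pi.star_apply, key]; simp
  · intro h x hx
    refine hasDerivWithinAt_pi.2 fun i => ?_
    rw [← star_star (-((coeffMatrix (v x) (f (v x)) z).conjTranspose.mulVec (W x))), key]
    fin_cases i
    · exact ((h.dp x hx).star.congr (fun y _ => (star_star _).symm)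
        (star_star _).symm).congr_deriv (by simp)
    · exact ((h.dq x hx).star.congr (fun y _ => (star_star _).symm)
        (star_star _).symm).congr_deriv (by simp)
    · exact ((h.ds x hx).star.congr (fun y _ => (star_star _).symm)
        (star_star _).symm).congr_deriv (by simp)

/-- The matrix `r - Aᵀ`. -/
def inflowMat (v f : ℝ) (z r : ℂ) : Matrix (Fin 3) (Fin 3) ℂ :=
  !![r, 0, -v; -z, r, -v; -z, -z, r - (f - z)]

/-- The difference of the variable and the limiting coefficients. -/
def inflowPert (v f : ℝ → ℝ) (v' f' : ℝ) (x : ℝ) : (Fin 3 → ℂ) →L[ℂ] (Fin 3 → ℂ) :=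
  matCLM (((v x - v' : ℝ) : ℂ) • !![0, 0, -1; 0, 0, -1; 0, 0, 0] +
    ((f x - f' : ℝ) : ℂ) • !![0, 0, 0; 0, 0, 0; 0, 0, -1])

theorem isSol_inflow_iff {v f : ℝ → ℝ} {v' f' : ℝ} {z r : ℂ} {y : ℝ → Fin 3 → ℂ} :
    IsSol (matCLM (inflowMat v' f' z r)) (inflowPert v f v' f') y ↔
      ShiftedInflow v f z r (fun x => y x 0) (fun x => y x 1) (fun x => y x 2) := by
  have key : ∀ x, (inflowMat v' f' z r + (((v x - v' : ℝ) : ℂ) • !![0, 0, -1; 0, 0, -1; 0, 0, 0] +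
      ((f x - f' : ℝ) : ℂ) • !![0, 0, 0; 0, 0, 0; 0, 0, -1])).mulVec (y x) =
      ![r * y x 0 - v x * y x 2, r * y x 1 - z * y x 0 - v x * y x 2,
        r * y x 2 - z * (y x 0 + y x 1) + (z - f x) * y x 2] := fun x => by
    funext i
    fin_cases i <;>
      simp [inflowMat, Matrix.mulVec, dotProduct, Fin.sum_univ_three] <;> ring
  unfold inflowPert
  rw [isSol_matCLM]
  constructor
  · intro h
    refine ⟨fun x hx => (h x hx 0).congr_deriv ?_, fun x hx => (h x hx 1).congr_deriv ?_,
      fun x hx => (h x hx 2).congr_deriv ?_⟩ <;> rw [key] <;> simp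
  · intro h x hx i
    rw [key]
    fin_cases i
    · exact h.dp x hx
    · exact h.dq x hx
    · exact h.ds x hx

theorem inflowMat_mulVec (v f : ℝ) (z r a b c : ℂ) : (inflowMat v f z r).mulVec ![a, b, c] =
    ![r * a - v * c, r * b - z * a - v * c, r * c - z * (a + b) + (z - f) * c] := by
  funext i
  fin_cases i <;> simp [inflowMat, Matrix.mulVec, dotProduct, Fin.sum_univ_three] <;> ring

theorem cubic_of_adjoint_eigenvector {v h : ℝ} (hv : v ≠ 0) {z ρ a b c : ℂ} (hρ : ρ ≠ 0)
    (h1 : v * c = ρ * a) (h2 : z * a + v * c = ρ * b)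
    (h3 : z * (a + b) + ((v - h : ℝ) - z) * c = ρ * c) (hne : ¬ (a = 0 ∧ b = 0 ∧ c = 0)) :
    a ≠ 0 ∧ ρ ^ 3 + (z - (v - h : ℝ)) * ρ ^ 2 - 2 * z * v * ρ - v * z ^ 2 = 0 := by
  have hv' : (v : ℂ) ≠ 0 := Complex.ofReal_ne_zero.2 hv
  have ha : a ≠ 0 := by
    rintro rfl
    have hc : c = 0 := by simpa [hv'] using h1
    subst hc
    have hb : b = 0 := by simpa [hρ] using h2.symm
    exact hne ⟨rfl, hb, rfl⟩
  refine ⟨ha, ?_⟩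
  have hv3 : ρ ^ 3 + (z - (v - h : ℝ)) * ρ ^ 2 - 2 * z * v * ρ - v * z ^ 2 =
      (ρ ^ 3 + (z - (v - h : ℝ)) * ρ ^ 2 - 2 * z * v * ρ - v * z ^ 2) * a / a := by
    field_simp
  rw [hv3, div_eq_zero_iff]
  left
  linear_combination (-(ρ ^ 2) - (z - (v - h : ℝ)) * ρ + z * v) * h1 - (v * ρ) * h3 + (z * v) * (-h2)

/-- The eigenvector of the transposed limiting matrix. -/
def inflowVec (v h : ℝ) (T : ℂ → ℂ) (z : ℂ) : Fin 3 → ℂ :=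
  ![1, T z / √v, branchEig v h T z / v]

namespace IsBranch

variable {v h δ : ℝ} {T : ℂ → ℂ} {z : ℂ}

theorem inflowMat_mulVec_inflowVec (hb : IsBranch v h δ T) (hv : 0 < v) (hz : -δ < z.re) :
    (inflowMat v (v - h) z (branchEig v h T z)).mulVec (inflowVec v h T z) = 0 := by
  have hv' : (v : ℂ) ≠ 0 := Complex.ofReal_ne_zero.2 hv.ne'
  have hk : ((√v : ℝ) : ℂ) ≠ 0 := Complex.ofReal_ne_zero.2 (Real.sqrt_pos.2 hv).ne'
  have h1 := hb.eig_mul hz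
  have h2 := hb.add_eig hz
  have h3 : ((√v : ℝ) : ℂ) ^ 2 = v := by rw [← Complex.ofReal_pow, Real.sq_sqrt hv.le]
  rw [inflowVec, inflowMat_mulVec]
  set r := branchEig v h T z
  have e1 : r * 1 - v * (r / v) = 0 := by field_simp; ring
  have e2 : r * (T z / √v) - z * 1 - v * (r / v) = 0 := by
    field_simp
    linear_combination h1
  have e3 : r * (r / v) - z * (1 + T z / √v) + (z - ((v - h : ℝ) : ℂ)) * (r / v) = 0 := by
    have : z = T z ^ 2 - h - r := by linear_combination h2
    rw [← h3]
    push_cast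
    field_simp
    rw [← h3]
    linear_combination ((√v : ℂ) + T z) * h1 + r * h2
  rw [e1, e2, e3]
  funext i
  fin_cases i <;> rfl

/-- An eigenvalue `ρ` of `r - Aᵀ` with `Re ρ < 0` would give the eigenvalue `r - ρ` of `Aᵀ`, with
positive real part. The branch value `r` is the only one of that kind, so `ρ = 0`, a contradiction.
-/
theorem nonnegSpectrum_inflowMat (hb : IsBranch v h δ T) (hv : 0 < v) (hh : 0 ≤ h)
    (hz : z ∈ nonstable) :
    NonnegSpectrum (matCLM (inflowMat v (v - h) z (branchEig v h T z))) := by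
  refine nonnegSpectrum_matCLM fun ρ a b c hE hneg => ?_
  by_contra hne
  rw [inflowMat_mulVec] at hE
  have g1 := congrFun hE 0
  have g2 := congrFun hE 1
  have g3 := congrFun hE 2
  simp at g1 g2 g3
  have hr := hb.eig_re_nonneg hh hz
  set r := branchEig v h T z with hrdef
  have hre : 0 < (r - ρ).re := by rw [Complex.sub_re]; linarith
  have hne0 : r - ρ ≠ 0 := fun h0 => by rw [h0] at hre; simp at hre
  obtain ⟨-, hc⟩ := cubic_of_adjoint_eigenvector (v := v) (h := h) (z := z) (a := a) (b := b) (c := c)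
    hv.ne' hne0
    (by linear_combination -g1) (by linear_combination -g2)
    (by push_cast; linear_combination -g3) hne
  have := hb.eq_of_root hz hre hc
  rw [← hrdef] at this
  have h0 : ρ = 0 := by linear_combination -this
  rw [h0] at hneg
  simp at hneg

theorem analyticAt_inflowVec (hb : IsBranch v h δ T) (hz : -δ < z.re) :
    AnalyticAt ℂ (inflowVec v h T) z := by
  refine analyticAt_pi_iff.2 fun i => ?_
  fin_cases i
  · exact analyticAt_const
  · exact (hb.analytic z hz).div_const
  · exact (hb.analyticAt_eig hz).div_const

theorem analyticAt_inflowMat (hb : IsBranch v h δ T) (hz : -δ < z.re) (f : ℝ) :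
    AnalyticAt ℂ (fun z => matCLM (inflowMat v f z (branchEig v h T z))) z := by
  have hr := hb.analyticAt_eig hz
  have hid : AnalyticAt ℂ (fun z : ℂ => z) z := analyticAt_id
  refine analyticAt_matCLM fun i j => ?_
  fin_cases i <;> fin_cases j <;> simp only [inflowMat, Matrix.of_apply, Fin.isValue, Fin.mk_zero,
    Fin.mk_one, Fin.reduceFinMk, Matrix.cons_val, Matrix.cons_val_zero,
    Matrix.cons_val_one]
  exacts [hr, analyticAt_const, analyticAt_const, hid.neg, hr, analyticAt_const, hid.neg, hid.neg,
    hr.sub (analyticAt_const.sub hid)]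

end IsBranch

end BoundaryLayer

end

/-! ### The inflow mode and its behavior for small and large spectral parameter -/

noncomputable section

namespace BoundaryLayer

/-- The mode at `+∞` of the conjugated adjoint system, with its uniqueness. -/
structure IsInflowMode (v f : ℝ → ℝ) (vp h δ : ℝ) (T : ℂ → ℂ) (Y : ℂ → ℝ → Fin 3 → ℂ) : Prop where
  branch : IsBranch vp h δ T
  analytic : ∀ z ∈ nonstable, AnalyticAt ℂ (fun z => Y z 0) z
  sol : ∀ z ∈ nonstable, ShiftedInflow v f z (branchEig vp h T z) (fun x => Y z x 0)
    (fun x => Y z x 1) (fun x => Y z x 2)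
  tendsto : ∀ z ∈ nonstable, Tendsto (Y z) atTop (𝓝 (inflowVec vp h T z))
  unique : ∀ z ∈ nonstable, ∀ (c : ℂ) (y : ℝ → Fin 3 → ℂ),
    ShiftedInflow v f z (branchEig vp h T z) (fun x => y x 0) (fun x => y x 1) (fun x => y x 2) →
    Tendsto y atTop (𝓝 (c • inflowVec vp h T z)) → ∀ x, 0 ≤ x → y x = c • Y z x

theorem exists_isInflowMode {v f : ℝ → ℝ} {vp h c C₁ C₂ : ℝ} (hvp : 0 < vp) (hh : 0 ≤ h)
    (hne : h ≠ vp) (hc : 0 < c) (hv : ContinuousOn v (Ici 0)) (hf : ContinuousOn f (Ici 0))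
    (hv' : ∀ x, 0 ≤ x → |v x - vp| ≤ C₁ * Real.exp (-c * x))
    (hf' : ∀ x, 0 ≤ x → |f x - (vp - h)| ≤ C₂ * Real.exp (-c * x)) :
    ∃ δ T Y, IsInflowMode v f vp h δ T Y := by
  obtain ⟨δ, T, hb⟩ := exists_isBranch hvp hh hne
  have hR : IsDecaying (inflowPert v f vp (vp - h)) c _ :=
    isDecaying_matCLM _ _ (hv.sub continuousOn_const) (hf.sub continuousOn_const) hv' hf'
  obtain ⟨Y, hY⟩ := exists_analytic_solution (S := nonstable) hc hR
    (fun z hz => hb.analyticAt_inflowMat (hb.lt_re hz) (vp - h))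
    (fun z hz => hb.analyticAt_inflowVec (hb.lt_re hz))
    (fun z hz => (hb.eventually_lt_re hz).mono fun w hw => hb.inflowMat_mulVec_inflowVec hvp hw)
    (fun z hz => hb.nonnegSpectrum_inflowMat hvp hh hz)
  refine ⟨δ, T, Y, hb, fun z hz => (hY z hz).1, fun z hz => isSol_inflow_iff.1 (hY z hz).2.1,
    fun z hz => (hY z hz).2.2, fun z hz c y hy hlim x hx => ?_⟩
  have h1 : IsSol (matCLM (inflowMat vp (vp - h) z (branchEig vp h T z)))
      (inflowPert v f vp (vp - h)) (fun x => c • Y z x) :=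
    isSol_inflow_iff.2 ((isSol_inflow_iff.1 (hY z hz).2.1).const_mul c)
  exact IsSol.eqOn_of_tendsto hc hR (hb.nonnegSpectrum_inflowMat hvp hh hz)
    (isSol_inflow_iff.2 hy) h1 hlim ((hY z hz).2.2.const_smul c) hx

namespace IsInflowMode

variable {v f : ℝ → ℝ} {vp h δ : ℝ} {T : ℂ → ℂ} {Y : ℂ → ℝ → Fin 3 → ℂ} {z : ℂ}

theorem analyticAt_zero (hY : IsInflowMode v f vp h δ T Y) (hz : z ∈ nonstable) :
    AnalyticAt ℂ (fun z => Y z 0 0) z := analyticAt_pi_iff.1 (hY.analytic z hz) 0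

theorem conj (hY : IsInflowMode v f vp h δ T Y) (hz : z ∈ nonstable) {x : ℝ} (hx : 0 ≤ x) :
    Y (starRingEnd ℂ z) x = star (Y z x) := by
  have h1 := (hY.sol z hz).conj
  rw [← hY.branch.eig_conj (hY.branch.lt_re hz)] at h1
  have hz' := conj_mem_nonstable hz
  have h2 : Tendsto (fun x => star (Y z x)) atTop
      (𝓝 ((1 : ℂ) • inflowVec vp h T (starRingEnd ℂ z))) := by
    rw [one_smul]
    have e : inflowVec vp h T (starRingEnd ℂ z) = star (inflowVec vp h T z) := by
      funext i
      rw [inflowVec, inflowVec, hY.branch.eig_conj (hY.branch.lt_re hz),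
        hY.branch.conj z (hY.branch.lt_re hz)]
      fin_cases i <;> simp
    rw [e]
    exact (hY.tendsto z hz).star
  have h3 := hY.unique _ hz' 1 (fun x => star (Y z x)) h1 h2 x hx
  rw [one_smul] at h3
  exact h3.symm

/-- At `z = 0` the eigenvalue is `0` and the third component of the eigenvector vanishes, so the
constant vector solves the system; uniqueness identifies it with the mode. -/
theorem apply_zero (hY : IsInflowMode v f vp h δ T Y) (hv : 0 < vp) (hvh : vp < h) :
    Y 0 0 0 = 1 := by
  have hr := hY.branch.eig_zero_of_lt hv hvh
  have h1 := hY.unique 0 zero_mem_nonstable 1 (fun _ => inflowVec vp h T 0)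
    (by
      rw [hr]
      have h2 : inflowVec vp h T 0 2 = 0 := by simp [inflowVec, hr]
      refine ⟨fun x _ => ?_, fun x _ => ?_, fun x _ => ?_⟩ <;>
      · refine (hasDerivWithinAt_const x _ _).congr_deriv ?_
        rw [h2]; simp) (by rw [one_smul]; exact tendsto_const_nhds) 0 le_rfl
  rw [one_smul] at h1
  rw [← h1]
  simp [inflowVec]

/-- The choice `θ = 0` is admissible because `h² - h'` is assumed to be `O(v)`. The exponential
shift is undone first: for `z ≠ 0` the unshifted solution decays, so the Lyapunov function tends to
`0`. -/
theorem re_neg {dh : ℝ → ℝ} {h₀ h₁ C : ℝ} (hY : IsInflowMode v f vp h δ T Y) (hv : 0 < vp)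
    (hc : InflowCoeff v (fun x => v x - f x) dh h₀ h₁) (hz : z ∈ nonstable)
    (hL : 4 + 2 * (h₁ + 1) + 2 * (2 + h₀ * C / 2) ^ 2 / h₀ ^ 2 + 1 ≤ ‖z‖)
    (hE : ∀ x, 0 ≤ x → |(v x - f x) ^ 2 - dh x| ≤ C * v x) {x : ℝ} (hx : 0 ≤ x) :
    Y z x 0 ≠ 0 := by
  have hz0 : z ≠ 0 := by
    rintro rfl
    have h1 := (hc.h₀_pos.le.trans (hc.le_h 0 le_rfl)).trans (hc.h_le 0 le_rfl)
    have h2 : 0 ≤ 2 * (2 + h₀ * C / 2) ^ 2 / h₀ ^ 2 := by positivity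
    rw [norm_zero] at hL
    linarith
  obtain ⟨η, hη⟩ := exists_isRotation hz
  have hr := hY.branch.eig_re_pos hv hz hz0
  set r := branchEig vp h T z with hrdef
  have hs := (hY.sol z hz).mul_exp (-r)
  rw [add_neg_cancel] at hs
  have he : Tendsto (fun x : ℝ => Complex.exp (-r * x)) atTop (𝓝 0) :=
    tendsto_cexp_mul (by rw [Complex.neg_re]; linarith)
  have hlim := tendsto_pi_nhds.1 (hY.tendsto z hz)
  have l0 := he.mul (hlim 0)
  have l1 := he.mul (hlim 1)
  have l2 := he.mul (hlim 2)
  rw [zero_mul] at l0 l1 l2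
  have lP := (l0.sub l1).div_const z
  rw [sub_zero, zero_div] at lP
  have hlim₂ : Tendsto (fun x : ℝ => Complex.exp (-r * x) * Y z x 2 -
      Complex.exp (-r * x) * Y z x 1 - (((v x - f x : ℝ) : ℂ) - 0) *
      ((Complex.exp (-r * x) * Y z x 0 - Complex.exp (-r * x) * Y z x 1) / z)) atTop (𝓝 0) := by
    have h3 : Tendsto (fun x : ℝ => (((v x - f x : ℝ) : ℂ) - 0) *
      ((Complex.exp (-r * x) * Y z x 0 - Complex.exp (-r * x) * Y z x 1) / z)) atTop (𝓝 0) := by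
      refine squeeze_zero_norm' (a := fun x : ℝ => h₁ * ‖(Complex.exp (-r * x) * Y z x 0 -
        Complex.exp (-r * x) * Y z x 1) / z‖) ?_ (by simpa using lP.norm.const_mul h₁)
      filter_upwards [eventually_ge_atTop 0] with t ht
      rw [sub_zero, norm_mul, Complex.norm_real,
        Real.norm_of_nonneg (hc.h₀_pos.le.trans (hc.le_h t ht))]
      exact mul_le_mul_of_nonneg_right (hc.h_le t ht) (norm_nonneg _)
    simpa using (l2.sub l1).sub h3
  have key := hs.system.re_neg (θ := 0) hc hη hz hL (by simp) (fun x hx => by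
      have := hE x hx
      rw [mul_zero, sub_zero, Complex.norm_real]
      exact this)
    (by
      have := l0.mul ((Complex.continuous_conj.tendsto _).comp lP)
      rw [zero_mul] at this
      exact this) hlim₂ (fun X => by
      have h1 : ∀ᶠ x in atTop, Y z x 0 ≠ 0 :=
        (hlim 0).eventually_ne (by simp [inflowVec])
      obtain ⟨t, ht, hXt⟩ := (h1.and (eventually_gt_atTop X)).exists
      refine ⟨t, hXt, fun h => ht ?_⟩
      have := h.1
      rwa [mul_eq_zero, or_iff_right (Complex.exp_ne_zero _)] at this) hx
  intro h0
  simp [h0] at key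

/-- At the left endpoint `g 0 = 1`. For large real `b` the first component is real, has no zero
anywhere on the half-line and tends to `1`, so it is positive at `x = 0`. -/
theorem evenRootCount {dh : ℝ → ℝ} {h₀ h₁ C : ℝ} (hY : IsInflowMode v f vp h δ T Y) (hv : 0 < vp)
    (hvh : vp < h) (hc : InflowCoeff v (fun x => v x - f x) dh h₀ h₁)
    (hE : ∀ x, 0 ≤ x → |(v x - f x) ^ 2 - dh x| ≤ C * v x) :
    EvenRootCount (fun z => Y z 0 0) nonstable := by
  obtain ⟨b, hb⟩ : ∃ b, b = 4 + 2 * (h₁ + 1) + 2 * (2 + h₀ * C / 2) ^ 2 / h₀ ^ 2 + 1 := ⟨_, rfl⟩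
  have hb0 : 0 ≤ b := by
    have h1 := (hc.h₀_pos.le.trans (hc.le_h 0 le_rfl)).trans (hc.h_le 0 le_rfl)
    have h2 : 0 ≤ 2 * (2 + h₀ * C / 2) ^ 2 / h₀ ^ 2 := by positivity
    rw [hb]; linarith
  refine evenRootCount_of_sign (fun z hz => hY.analyticAt_zero hz) (fun z hz => ?_) hb0
    (fun z hz hL => hY.re_neg hv hc hz (hb ▸ hL) hE le_rfl) ?_
  · rw [hY.conj hz le_rfl]; rfl
  · have hbz : (b : ℂ) ∈ nonstable := by simpa [nonstable] using hb0
    have hreal : ∀ x, 0 ≤ x → Y b x 0 = ((Y b x 0).re : ℂ) := fun x hx => by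
      have h1 := hY.conj hbz hx
      rw [Complex.conj_ofReal] at h1
      exact (Complex.conj_eq_iff_re.1 (congrFun h1 0).symm).symm
    rw [hY.apply_zero hv hvh, Complex.one_re, one_mul]
    refine pos_of_tendsto_pos (f := fun x => (Y b x 0).re) (L := 1) ?_ (fun x hx h0 => ?_) one_pos ?_
      le_rfl
    · exact Complex.continuous_re.comp_continuousOn
        fun x hx => ((hY.sol _ hbz).dp x hx).continuousWithinAt
    · refine hY.re_neg (z := b) hv hc hbz ?_ hE hx ?_
      · rw [Complex.norm_real, Real.norm_of_nonneg hb0, hb]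
      · rw [hreal x hx, h0, Complex.ofReal_zero]
    · have := (Complex.continuous_re.tendsto _).comp (tendsto_pi_nhds.1 (hY.tendsto _ hbz) 0)
      simpa [inflowVec, Function.comp_def] using this

end IsInflowMode

/-! ### The inflow Evans function -/

section
variable {γ vp v0 : ℝ} {v : ℝ → ℝ}

theorem IsInflowProfile.exists_isInflowMode (hγ : 1 ≤ γ) (h0 : 0 < vp) (hv : vp ≤ v0)
    (hv1 : v0 < 1) (hp : IsInflowProfile γ vp v0 v) :
    ∃ δ T Y, IsInflowMode v (fun x => fCoeff γ vp (v x)) vp (hCoeff γ vp vp) δ T Y := by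
  have h1 := hv.trans_lt hv1
  have hm := fun x (hx : 0 ≤ x) => hp.mem hγ h0 hv hv1 (x := x) hx
  have hcv : ContinuousOn v (Ici 0) := fun x hx => (hp.ode x hx).continuousWithinAt
  obtain ⟨c, hc, hdec⟩ := hp.exists_decay hγ h0 hv hv1
  obtain ⟨C, hC1, hC⟩ := exists_abs_hCoeffDeriv_le γ vp h0
  have hh := hCoeff_vp hγ h0 h1
  have hIcc : ∀ x, 0 ≤ x → v x ∈ Icc vp 1 := fun x hx => ⟨(hm x hx).1, (hm x hx).2.trans hv1.le⟩
  refine BoundaryLayer.exists_isInflowMode (C₂ := 1 + C) h0 (h0.trans hh).le hh.ne' hc hcv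
    (fun x hx => ?_) hdec
    (fun x hx => ?_)
  · exact (hasDerivAt_fCoeff γ vp (h0.trans_le (hm x hx).1)).continuousAt.comp_continuousWithinAt
      (hcv x hx)
  · have e : vp - hCoeff γ vp vp = fCoeff γ vp vp := sub_sub_cancel _ _
    rw [e]
    refine (abs_fCoeff_sub_le h0 hC ⟨le_rfl, h1.le⟩ (hIcc x hx)).trans ?_
    refine mul_le_mul_of_nonneg_left ?_ (by linarith)
    simpa using hdec x hx

theorem IsInflowProfile.evenRootCount {δ : ℝ} {T : ℂ → ℂ} {Y : ℂ → ℝ → Fin 3 → ℂ} (hγ : 1 ≤ γ)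
    (h0 : 0 < vp) (hv : vp ≤ v0) (hv1 : v0 < 1) (hp : IsInflowProfile γ vp v0 v)
    (hY : IsInflowMode v (fun x => fCoeff γ vp (v x)) vp (hCoeff γ vp vp) δ T Y) :
    EvenRootCount (fun z => Y z 0 0) nonstable := by
  have h1 := hv.trans_lt hv1
  have hm := fun x (hx : 0 ≤ x) => hp.mem hγ h0 hv hv1 (x := x) hx
  have hIcc : ∀ x, 0 ≤ x → v x ∈ Icc vp 1 := fun x hx => ⟨(hm x hx).1, (hm x hx).2.trans hv1.le⟩
  have ha := pressureConst_pos hγ h0 h1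
  obtain ⟨C, hC1, hC⟩ := exists_abs_hCoeffDeriv_le γ vp h0
  obtain ⟨B, hB1, hB⟩ := exists_hCoeff_le γ vp h0
  have hcoef : InflowCoeff v (fun x => v x - fCoeff γ vp (v x))
      (fun x => hCoeffDeriv γ vp (v x) * profileRHS γ vp (v x)) (pressureConst γ vp * γ) B :=
    { h₀_pos := mul_pos ha (by linarith)
      v_pos := fun x hx => h0.trans_le (hm x hx).1
      v_le := fun x hx => (hIcc x hx).2
      le_h := fun x hx => le_hCoeff hγ h0 h1 (h0.trans_le (hm x hx).1) (hIcc x hx).2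
      h_le := fun x hx => hB _ (hIcc x hx)
      deriv := fun x hx => (hasDerivAt_hCoeff γ vp (h0.trans_le (hm x hx).1)).comp_hasDerivWithinAt x
        (hp.ode x hx) }
  obtain ⟨K, hK⟩ := (isCompact_Icc (a := vp) (b := 1)).exists_bound_of_continuousOn
    (f := profileRHS γ vp)
    fun y hy => (hasDerivAt_profileRHS γ vp (h0.trans_le hy.1)).continuousAt.continuousWithinAt
  -- The profile stays above `v₊ > 0`, so a bounded quantity is automatically at most a constant
  -- times `v`.
  refine hY.evenRootCount (C := (B ^ 2 + C * K) / vp) h0 (hCoeff_vp hγ h0 h1) hcoef fun x hx => ?_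
  have b1 : |(v x - fCoeff γ vp (v x)) ^ 2| ≤ B ^ 2 := by
    rw [abs_of_nonneg (sq_nonneg _)]
    exact pow_le_pow_left₀ (hcoef.h₀_pos.le.trans (hcoef.le_h x hx)) (hcoef.h_le x hx) 2
  have b2 : |hCoeffDeriv γ vp (v x) * profileRHS γ vp (v x)| ≤ C * K := by
    rw [abs_mul]
    exact mul_le_mul (hC _ (hIcc x hx)) (hK _ (hIcc x hx)) (abs_nonneg _) (by linarith)
  have hCK : 0 ≤ C * K := (abs_nonneg _).trans b2
  refine (abs_sub _ _).trans ((add_le_add b1 b2).trans ?_)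
  rw [div_mul_eq_mul_div, le_div_iff₀ h0]
  exact mul_le_mul_of_nonneg_left (hm x hx).1 (by positivity)

end

end BoundaryLayer

end

/-! ### Arbitrary inflow Evans functions compared with the standard mode -/

noncomputable section

namespace BoundaryLayer

section
variable {γ vp v0 δ : ℝ} {v : ℝ → ℝ} {T : ℂ → ℂ} {Y : ℂ → ℝ → Fin 3 → ℂ}

theorem star_adjoint_mulVec (v f : ℝ) (z : ℂ) (V : Fin 3 → ℂ) :
    star (-((coeffMatrix v f z).conjTranspose.mulVec V)) =
      ![-(v * star (V 2)), -(z * star (V 0)) - v * star (V 2),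
        -(z * (star (V 0) + star (V 1))) + (z - f) * star (V 2)] := by
  funext i
  fin_cases i <;>
    simp [coeffMatrix, Matrix.mulVec, dotProduct, Fin.sum_univ_three] <;> ring

theorem pairing_single (W : Fin 3 → ℂ) : pairing ![1, 0, 0] W = star (W 0) := by
  simp [pairing, dotProduct, Fin.sum_univ_three]

theorem exists_isInflowEvans (hγ : 1 ≤ γ) (h0 : 0 < vp) (h1 : vp < 1)
    (hY : IsInflowMode v (fun x => fCoeff γ vp (v x)) vp (hCoeff γ vp vp) δ T Y) :
    ∃ D, IsInflowEvans γ vp v D := by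
  have hb := hY.branch
  have hh := hCoeff_vp hγ h0 h1
  set h := hCoeff γ vp vp with hdef
  have hf : fCoeff γ vp vp = vp - h := by rw [hdef, hCoeff]; ring
  refine ⟨fun z => Y z 0 0, fun z hz => hY.analyticAt_zero hz,
    fun z => -star (branchEig vp h T z), fun z => star (inflowVec vp h T z),
    fun z x => star (Complex.exp (-branchEig vp h T z * x) • Y z x), fun z hz => ?_,
    fun z hz h0 => ?_, fun z hz hz0 => ⟨?_, ?_, ?_, ?_, ?_⟩⟩
  · simp only [star_star]
    exact hb.analyticAt_inflowVec (hb.lt_re hz)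
  · have := congrFun h0 0
    simp [inflowVec] at this
  · have := hb.eig_re_pos h0 hz hz0
    simpa using this
  · have hev := hb.inflowMat_mulVec_inflowVec h0 (hb.lt_re hz)
    have e : inflowVec vp h T z =
        ![inflowVec vp h T z 0, inflowVec vp h T z 1, inflowVec vp h T z 2] := by
      ext i; fin_cases i <;> rfl
    rw [e, inflowMat_mulVec] at hev
    have g1 := congrFun hev 0
    have g2 := congrFun hev 1
    have g3 := congrFun hev 2
    simp at g1 g2 g3
    apply star_injective
    rw [star_adjoint_mulVec, hf]
    simp only [Pi.star_apply, star_star, star_smul, star_neg]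
    funext i
    fin_cases i
    · simp; linear_combination -g1
    · simp; linear_combination g2
    · simp; linear_combination g3
  · rw [solvesAdjoint_iff]
    have := (hY.sol z hz).mul_exp (-branchEig vp h T z)
    rw [add_neg_cancel] at this
    simpa using this
  · have h2 := (hY.tendsto z hz).star
    refine h2.congr fun x => ?_
    change star (Y z x) = Complex.exp (-(-star (branchEig vp h T z) * x)) •
      star (Complex.exp (-branchEig vp h T z * x) • Y z x)
    rw [star_smul, smul_smul]
    have : Complex.exp (-(-star (branchEig vp h T z) * x)) *
        star (Complex.exp (-branchEig vp h T z * x)) = 1 := by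
      rw [Complex.star_def, ← Complex.exp_conj, ← Complex.exp_add]
      simp
    rw [this, one_smul]
  · rw [pairing_single]
    simp

/-- The eigenvectors of an inflow mode are multiples of the standard one. -/
theorem IsInflowEvans.eq_mul (hγ : 1 ≤ γ) (h0 : 0 < vp) (h1 : vp < 1)
    (hY : IsInflowMode v (fun x => fCoeff γ vp (v x)) vp (hCoeff γ vp vp) δ T Y) {D : ℂ → ℂ}
    (hD : IsInflowEvans γ vp v D) : ∃ c : ℂ → ℂ, AnalyticOnNhd ℂ c nonstable ∧
      (∀ z ∈ nonstable, c z ≠ 0) ∧ EqOn D (fun z => c z * Y z 0 0) (nonstable \ {0}) := by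
  obtain ⟨-, μ, V, W, hV, hV0, hall⟩ := hD
  have hb := hY.branch
  have hh := hCoeff_vp hγ h0 h1
  set h := hCoeff γ vp vp with hdef
  have hf : fCoeff γ vp vp = vp - h := by rw [hdef, hCoeff]; ring
  have hvp : (vp : ℂ) ≠ 0 := Complex.ofReal_ne_zero.2 h0.ne'
  have hk : ((√vp : ℝ) : ℂ) ≠ 0 := Complex.ofReal_ne_zero.2 (Real.sqrt_pos.2 h0).ne'
  have hcomp : ∀ i, AnalyticOnNhd ℂ (fun z => star (V z) i) nonstable := fun i z hz =>
    analyticAt_pi_iff.1 (hV z hz) i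
  -- The eigenvalue is forced by uniqueness of the root with positive real part; the conjugated
  -- eigenvector is the standard one multiplied by its first component.
  have key : ∀ z ∈ nonstable, z ≠ 0 → star (μ z) = -branchEig vp h T z ∧
      star (V z) = star (V z) 0 • inflowVec vp h T z := fun z hz hz0 => by
    obtain ⟨hμ, hev, -⟩ := hall z hz hz0
    have hev' := congrArg star hev
    rw [star_adjoint_mulVec, hf] at hev'
    have g1 := congrFun hev' 0
    have g2 := congrFun hev' 1
    have g3 := congrFun hev' 2
    simp at g1 g2 g3
    set ρ : ℂ := -star (μ z) with hρ
    have hρμ : starRingEnd ℂ (μ z) = -ρ := by rw [hρ, neg_neg]; rfl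
    rw [hρμ] at g1 g2 g3
    have hρre : 0 < ρ.re := by
      rw [hρ, Complex.neg_re, Complex.star_def, Complex.conj_re]; linarith
    have hρ0 : ρ ≠ 0 := fun hz => by rw [hz] at hρre; simp at hρre
    obtain ⟨ha, hc⟩ := cubic_of_adjoint_eigenvector (v := vp) (h := h) (z := z)
      (a := starRingEnd ℂ (V z 0)) (b := starRingEnd ℂ (V z 1)) (c := starRingEnd ℂ (V z 2))
      h0.ne' hρ0 (by linear_combination -g1) (by linear_combination -g2)
      (by push_cast; linear_combination -g3) (fun ⟨e0, e1, e2⟩ => hV0 z hz (by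
        funext i
        fin_cases i
        · simpa using e0
        · simpa using e1
        · simpa using e2))
    have hr := hb.eq_of_root hz hρre hc
    refine ⟨by rw [← hr, hρ, neg_neg], ?_⟩
    have hT := hb.eig_mul (hb.lt_re hz)
    rw [← hr] at hT
    funext i
    fin_cases i
    · simp [inflowVec]
    · simp only [inflowVec, ← hr]
      simp
      field_simp
      have : ρ * starRingEnd ℂ (V z 1) = (z + ρ) * starRingEnd ℂ (V z 0) := by
        linear_combination g2 - g1
      refine mul_left_cancel₀ hρ0 ?_
      linear_combination (√vp : ℂ) * this - starRingEnd ℂ (V z 0) * hT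
    · simp only [inflowVec, ← hr]
      simp
      field_simp
      linear_combination -g1
  refine ⟨fun z => star (V z) 0, hcomp 0, fun z hz hc => ?_, ?_⟩
  · refine hV0 z hz (star_eq_zero.1 ?_)
    funext i
    have hvec : AnalyticAt ℂ (fun z => inflowVec vp h T z i) z :=
      analyticAt_pi_iff.1 (hb.analyticAt_inflowVec (hb.lt_re hz)) i
    -- At `z = 0` no eigenvector equation is assumed. Proportionality is carried there by the
    -- identity theorem, so the factor cannot vanish without `V` vanishing.
    have := (eventuallyEq_of_eqOn_nonstable hz (hcomp i z hz) ((hcomp 0 z hz).mul hvec)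
      fun w hw => congrFun (key w hw.1 hw.2).2 i).self_of_nhds
    simp only [Pi.mul_apply] at this
    rw [this]
    have hc' : star (V z) 0 = 0 := hc
    rw [hc', zero_mul]; rfl
  · rintro z ⟨hz, hz0⟩
    obtain ⟨hμ, -, hsol, hlim, hDz⟩ := hall z hz hz0
    obtain ⟨hμr, hVc⟩ := key z hz hz0
    rw [solvesAdjoint_iff] at hsol
    have hs := hsol.mul_exp (branchEig vp h T z)
    rw [zero_add] at hs
    have hl : Tendsto (fun x : ℝ => Complex.exp (branchEig vp h T z * x) • star (W z x)) atTop
        (𝓝 (star (V z) 0 • inflowVec vp h T z)) := by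
      rw [← hVc]
      refine hlim.star.congr fun x => ?_
      rw [star_smul]
      congr 1
      rw [Complex.star_def, ← Complex.exp_conj]
      congr 1
      rw [map_neg, map_mul, Complex.conj_ofReal, ← Complex.star_def, hμr]
      ring
    have hu := hY.unique z hz (star (V z) 0) _ hs hl 0 le_rfl
    have hu0 := congrFun hu 0
    simp at hu0
    rw [hDz, pairing_single]
    simpa using hu0

theorem IsInflowProfile.evans (hγ : 1 ≤ γ) (h0 : 0 < vp) (hv : vp ≤ v0) (hv1 : v0 < 1)
    (hp : IsInflowProfile γ vp v0 v) : (∃ D, IsInflowEvans γ vp v D) ∧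
      ∀ D, IsInflowEvans γ vp v D → D 0 ≠ 0 ∧ EvenRootCount D nonstable := by
  have h1 := hv.trans_lt hv1
  obtain ⟨δ, T, Y, hY⟩ := hp.exists_isInflowMode hγ h0 hv hv1
  refine ⟨exists_isInflowEvans hγ h0 h1 hY, fun D hD => ?_⟩
  obtain ⟨c, hc, hc0, hDc⟩ := hD.eq_mul hγ h0 h1 hY
  have hg : AnalyticOnNhd ℂ (fun z => Y z 0 0) nonstable := fun z hz => hY.analyticAt_zero hz
  have hg0 := hY.apply_zero h0 (hCoeff_vp hγ h0 h1)
  have hD0 : D 0 ≠ 0 := by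
    have hz := zero_mem_nonstable
    have := (eventuallyEq_of_eqOn_nonstable hz (hD.1 0 hz) ((hc 0 hz).mul (hg 0 hz))
      hDc).self_of_nhds
    rw [this]
    simpa [hg0] using hc0 0 hz
  exact ⟨hD0, EvenRootCount.of_diff hD0 (EvenRootCount.of_factor hg hD.1 hc
    (fun z hz => hc0 z hz.1) hDc (by rw [hg0]; exact one_ne_zero)
    (hp.evenRootCount hγ h0 hv hv1 hY))⟩

end

end BoundaryLayer

end

noncomputable section

namespace BoundaryLayer

/-! ### The limiting inflow problem -/

/-- The conjugated limiting adjoint system in the variables `p / z`, `q - p`, `s / z`. -/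
structure ScaledInflow (v : ℝ → ℝ) (z : ℂ) (p q s : ℝ → ℂ) : Prop where
  dp : ∀ x ∈ Ici (0 : ℝ), HasDerivWithinAt p (-(v x * s x)) (Ici 0) x
  dq : ∀ x ∈ Ici (0 : ℝ), HasDerivWithinAt q (-(z ^ 2 * p x)) (Ici 0) x
  ds : ∀ x ∈ Ici (0 : ℝ),
    HasDerivWithinAt s (-(2 * z * p x) - q x + (z - (2 * v x - 1)) * s x) (Ici 0) x

theorem ScaledInflow.conj {v : ℝ → ℝ} {z : ℂ} {p q s : ℝ → ℂ} (h : ScaledInflow v z p q s) :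
    ScaledInflow v (starRingEnd ℂ z) (fun x => starRingEnd ℂ (p x))
      (fun x => starRingEnd ℂ (q x)) (fun x => starRingEnd ℂ (s x)) where
  dp x hx := (h.dp x hx).star.congr_deriv (by simp)
  dq x hx := (h.dq x hx).star.congr_deriv (by simp)
  ds x hx := (h.ds x hx).star.congr_deriv (by simp)

theorem ScaledInflow.shifted {v : ℝ → ℝ} {z : ℂ} {p q s : ℝ → ℂ} (h : ScaledInflow v z p q s) :
    ShiftedInflow v (fun x => fCoeffLimit (v x)) z 0 (fun x => z * p x) (fun x => q x + z * p x)
      (fun x => z * s x) where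
  dp x hx := ((h.dp x hx).const_mul z).congr_deriv (by ring)
  dq x hx := ((h.dq x hx).add ((h.dp x hx).const_mul z)).congr_deriv (by ring)
  ds x hx := ((h.ds x hx).const_mul z).congr_deriv (by rw [fCoeffLimit]; push_cast; ring)

theorem ShiftedInflow.scaled {v : ℝ → ℝ} {z : ℂ} {p q s : ℝ → ℂ} (hz : z ≠ 0)
    (h : ShiftedInflow v (fun x => fCoeffLimit (v x)) z 0 p q s) :
    ScaledInflow v z (fun x => p x / z) (fun x => q x - p x) (fun x => s x / z) where
  dp x hx := ((h.dp x hx).div_const z).congr_deriv (by ring)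
  dq x hx := ((h.dq x hx).sub (h.dp x hx)).congr_deriv (by field_simp; ring)
  ds x hx := ((h.ds x hx).div_const z).congr_deriv (by
    simp only [fCoeffLimit]; push_cast; field_simp; ring)

theorem ScaledInflow.translate {v : ℝ → ℝ} {z : ℂ} {p q s : ℝ → ℂ} (h : ScaledInflow v z p q s)
    {τ : ℝ} (hτ : 0 ≤ τ) : ScaledInflow (fun x => v (x + τ)) z (fun x => p (x + τ))
      (fun x => q (x + τ)) (fun x => s (x + τ)) := by
  have key : ∀ {f : ℝ → ℂ} {f' : ℂ} {x : ℝ}, HasDerivWithinAt f f' (Ici 0) (x + τ) →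
      HasDerivWithinAt (fun x => f (x + τ)) f' (Ici 0) x := fun {f f' x} hf => by
    have := hf.scomp x ((hasDerivAt_id x).add_const τ).hasDerivWithinAt (s := Ici 0)
      (fun y hy => add_nonneg hy hτ)
    simpa [Function.comp_def] using this
  exact ⟨fun x hx => key (h.dp _ (add_nonneg hx hτ)), fun x hx => key (h.dq _ (add_nonneg hx hτ)),
    fun x hx => key (h.ds _ (add_nonneg hx hτ))⟩

/-- The limiting matrix of the scaled system. -/
def scaledMat (z : ℂ) : Matrix (Fin 3) (Fin 3) ℂ :=
  !![0, 0, 0; -z ^ 2, 0, 0; -(2 * z), -1, z + 1]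

/-- The deviation of the scaled system from its limit. -/
def scaledPert (v : ℝ → ℝ) (x : ℝ) : (Fin 3 → ℂ) →L[ℂ] (Fin 3 → ℂ) :=
  matCLM ((v x : ℂ) • !![0, 0, -1; 0, 0, 0; 0, 0, -2] +
    ((0 : ℝ) : ℂ) • (0 : Matrix (Fin 3) (Fin 3) ℂ))

/-- The stationary vector of the limiting matrix of the scaled system. -/
def scaledVec (z : ℂ) : Fin 3 → ℂ := ![0, -1, -(1 + z)⁻¹]

theorem isSol_scaled_iff {v : ℝ → ℝ} {z : ℂ} {y : ℝ → Fin 3 → ℂ} :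
    IsSol (matCLM (scaledMat z)) (scaledPert v) y ↔
      ScaledInflow v z (fun x => y x 0) (fun x => y x 1) (fun x => y x 2) := by
  have key : ∀ x, (scaledMat z + ((v x : ℂ) • !![0, 0, -1; 0, 0, 0; 0, 0, -2] +
      ((0 : ℝ) : ℂ) • (0 : Matrix (Fin 3) (Fin 3) ℂ))).mulVec (y x) =
      ![-(v x * y x 2), -(z ^ 2 * y x 0),
        -(2 * z * y x 0) - y x 1 + (z - (2 * v x - 1)) * y x 2] := fun x => by
    funext i
    fin_cases i <;>
      simp [scaledMat, Matrix.mulVec, dotProduct, Fin.sum_univ_three]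
    ring
  unfold scaledPert
  rw [isSol_matCLM]
  constructor
  · intro h
    refine ⟨fun x hx => (h x hx 0).congr_deriv ?_, fun x hx => (h x hx 1).congr_deriv ?_,
      fun x hx => (h x hx 2).congr_deriv ?_⟩ <;> rw [key] <;> simp
  · intro h x hx i
    rw [key]
    fin_cases i
    · exact h.dp x hx
    · exact h.dq x hx
    · exact h.ds x hx

theorem scaledMat_mulVec (z a b c : ℂ) : (scaledMat z).mulVec ![a, b, c] =
    ![0, -(z ^ 2 * a), -(2 * z * a) - b + (z + 1) * c] := by
  funext i
  fin_cases i <;> simp [scaledMat, Matrix.mulVec, dotProduct, Fin.sum_univ_three]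
  ring

theorem one_add_ne_zero {z : ℂ} (hz : -1 < z.re) : 1 + z ≠ 0 := fun h => by
  have := congrArg Complex.re h
  simp at this
  linarith

theorem scaledMat_mulVec_scaledVec {z : ℂ} (hz : -1 < z.re) :
    (scaledMat z).mulVec (scaledVec z) = 0 := by
  have := one_add_ne_zero hz
  rw [scaledVec, scaledMat_mulVec]
  funext i
  fin_cases i
  · simp
  · simp
  · simp only [mul_zero, Fin.reduceFinMk, Matrix.cons_val, Pi.zero_apply]
    field_simp
    ring

theorem nonnegSpectrum_scaledMat {z : ℂ} (hz : z ∈ nonstable) :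
    NonnegSpectrum (matCLM (scaledMat z)) := by
  refine nonnegSpectrum_matCLM fun ρ a b c hE hneg => ?_
  rw [scaledMat_mulVec] at hE
  have g1 := congrFun hE 0
  have g2 := congrFun hE 1
  have g3 := congrFun hE 2
  simp at g1 g2 g3
  have hρ : ρ ≠ 0 := fun h => by simp [h] at hneg
  have ha : a = 0 := by simpa [hρ] using g1
  subst ha
  have hb : b = 0 := by simpa [hρ] using g2
  subst hb
  have h0 : (z + 1 - ρ) * c = 0 := by linear_combination g3
  have hz' : 0 ≤ z.re := hz
  have h1 : z + 1 - ρ ≠ 0 := fun h => by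
    have := congrArg Complex.re h
    simp at this
    linarith
  exact ⟨rfl, rfl, by simpa [h1] using h0⟩

/-- The mode at `+∞` of the scaled system, with its uniqueness. -/
structure IsScaledMode (v : ℝ → ℝ) (Y : ℂ → ℝ → Fin 3 → ℂ) : Prop where
  analytic : ∀ z ∈ nonstable, AnalyticAt ℂ (fun z => Y z 0) z
  sol : ∀ z ∈ nonstable, ScaledInflow v z (fun x => Y z x 0) (fun x => Y z x 1) (fun x => Y z x 2)
  tendsto : ∀ z ∈ nonstable, Tendsto (Y z) atTop (𝓝 (scaledVec z))
  unique : ∀ z ∈ nonstable, ∀ y : ℝ → Fin 3 → ℂ,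
    ScaledInflow v z (fun x => y x 0) (fun x => y x 1) (fun x => y x 2) →
    Tendsto y atTop (𝓝 (scaledVec z)) → ∀ x, 0 ≤ x → y x = Y z x

theorem exists_isScaledMode {v : ℝ → ℝ} {c C : ℝ} (hc : 0 < c) (hv : ContinuousOn v (Ici 0))
    (hv' : ∀ x, 0 ≤ x → |v x| ≤ C * Real.exp (-c * x)) : ∃ Y, IsScaledMode v Y := by
  have hR : IsDecaying (scaledPert v) c _ :=
    isDecaying_matCLM (β := fun _ => 0) (C₂ := 0) _ _ hv continuousOn_const hv' (by simp)
  have hre : ∀ z ∈ nonstable, -1 < z.re := fun z hz => by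
    have hz' : 0 ≤ z.re := hz
    linarith
  obtain ⟨Y, hY⟩ := exists_analytic_solution (S := nonstable) (V := scaledVec)
    (M := fun z => matCLM (scaledMat z)) hc hR
    (fun z hz => by
      have hid : AnalyticAt ℂ (fun z : ℂ => z) z := analyticAt_id
      refine analyticAt_matCLM fun i j => ?_
      fin_cases i <;> fin_cases j <;> simp only [scaledMat, Matrix.of_apply, Fin.isValue,
        Fin.mk_zero, Fin.mk_one, Fin.reduceFinMk, Matrix.cons_val, Matrix.cons_val_zero,
        Matrix.cons_val_one]
      exacts [analyticAt_const, analyticAt_const, analyticAt_const, (hid.pow 2).neg,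
        analyticAt_const, analyticAt_const, (analyticAt_const.mul hid).neg, analyticAt_const,
        hid.add analyticAt_const])
    (fun z hz => by
      refine analyticAt_pi_iff.2 fun i => ?_
      fin_cases i
      · exact analyticAt_const
      · exact analyticAt_const
      · exact ((analyticAt_const.add analyticAt_id).inv (one_add_ne_zero (hre z hz))).neg)
    (fun z hz => (Complex.continuous_re.continuousAt.eventually_const_lt (hre z hz)).mono
      fun w hw => scaledMat_mulVec_scaledVec hw)
    (fun z hz => nonnegSpectrum_scaledMat hz)
  exact ⟨Y, fun z hz => (hY z hz).1, fun z hz => isSol_scaled_iff.1 (hY z hz).2.1,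
    fun z hz => (hY z hz).2.2, fun z hz y hy hlim x hx =>
      IsSol.eqOn_of_tendsto hc hR (nonnegSpectrum_scaledMat hz) (isSol_scaled_iff.2 hy)
        (hY z hz).2.1 hlim (hY z hz).2.2 hx⟩

namespace IsScaledMode

variable {v : ℝ → ℝ} {Y : ℂ → ℝ → Fin 3 → ℂ} {z : ℂ}

theorem analyticAt_zero (hY : IsScaledMode v Y) (hz : z ∈ nonstable) :
    AnalyticAt ℂ (fun z => Y z 0 0) z := analyticAt_pi_iff.1 (hY.analytic z hz) 0

theorem conj (hY : IsScaledMode v Y) (hz : z ∈ nonstable) {x : ℝ} (hx : 0 ≤ x) :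
    Y (starRingEnd ℂ z) x = star (Y z x) := by
  have h2 : Tendsto (fun x => star (Y z x)) atTop (𝓝 (scaledVec (starRingEnd ℂ z))) := by
    have e : scaledVec (starRingEnd ℂ z) = star (scaledVec z) := by
      funext i
      fin_cases i <;> simp [scaledVec]
    rw [e]
    exact (hY.tendsto z hz).star
  exact (hY.unique _ (conj_mem_nonstable hz) (fun x => star (Y z x)) (hY.sol z hz).conj h2 x
    hx).symm

/-- Since `v → 0`, the error `E` must vanish with `v`; `h → 1` and `h' = v (1 - v)` then force `θ =
1 / (1 + z)`. The same choice makes `w` tend to `0`, although `P` tends to the nonzero limit `1 /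
z`. -/
theorem re_mul_neg {h₀ : ℝ} (hY : IsScaledMode v Y)
    (hc : InflowCoeff v (fun x => v x - fCoeffLimit (v x)) (fun x => v x * (1 - v x)) h₀ 1)
    (hv0 : Tendsto v atTop (𝓝 0)) (hz : z ∈ nonstable) {η : ℂ} (hη : IsRotation z η)
    (hL : 4 + 2 * ((1 : ℝ) + 1) + 2 * (2 + h₀ * 6 / 2) ^ 2 / h₀ ^ 2 + 1 ≤ ‖z‖) {x : ℝ}
    (hx : 0 ≤ x) :
    (η * (z * Y z x 0 * starRingEnd ℂ (-Y z x 1 / z))).re < 0 := by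
  have hzre : 0 ≤ z.re := hz
  have hz0 : z ≠ 0 := by
    rintro rfl
    have h2 : 0 ≤ 2 * (2 + h₀ * 6 / 2) ^ 2 / h₀ ^ 2 := by positivity
    rw [norm_zero] at hL
    linarith
  have hz1 : 1 + z ≠ 0 := one_add_ne_zero (by linarith)
  have hθ : ‖(1 + z)⁻¹‖ ≤ 1 := by
    rw [norm_inv]
    refine inv_le_one_of_one_le₀ ?_
    have := Complex.re_le_norm (1 + z)
    simp at this
    linarith
  have hlim := tendsto_pi_nhds.1 (hY.tendsto z hz)
  have l0 : Tendsto (fun x => Y z x 0) atTop (𝓝 0) := hlim 0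
  have l1 : Tendsto (fun x => Y z x 1) atTop (𝓝 (-1)) := hlim 1
  have l2 : Tendsto (fun x => Y z x 2) atTop (𝓝 (-(1 + z)⁻¹)) := hlim 2
  have lp : Tendsto (fun x => z * Y z x 0) atTop (𝓝 0) := by simpa using l0.const_mul z
  have lv : Tendsto (fun x => (v x : ℂ)) atTop (𝓝 0) := by
    have := (Complex.continuous_ofReal.tendsto 0).comp hv0
    rwa [Complex.ofReal_zero] at this
  have lq : Tendsto (fun x => Y z x 1 + z * Y z x 0) atTop (𝓝 (-1)) := by
    simpa using l1.add lp
  have lP := (lp.sub lq).div_const z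
  have hlim₂ : Tendsto (fun x => z * Y z x 2 - (Y z x 1 + z * Y z x 0) -
      (((v x - fCoeffLimit (v x) : ℝ) : ℂ) - (1 + z)⁻¹) *
        ((z * Y z x 0 - (Y z x 1 + z * Y z x 0)) / z)) atTop (𝓝 0) := by
    have l3 : Tendsto (fun x => ((v x - fCoeffLimit (v x) : ℝ) : ℂ)) atTop (𝓝 1) := by
      have : Tendsto (fun x => 1 - (v x : ℂ)) atTop (𝓝 (1 - 0)) := lv.const_sub 1
      rw [sub_zero] at this
      refine this.congr fun x => ?_
      rw [fCoeffLimit]; push_cast; ring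
    have := ((l2.const_mul z).sub lq).sub ((l3.sub_const (1 + z)⁻¹).mul lP)
    convert this using 2
    field_simp
    ring
  have key := (hY.sol z hz).shifted.system.re_neg (θ := (1 + z)⁻¹) (C := 6) hc hη hz hL hθ
    (fun x hx => by
      have e : (((v x - fCoeffLimit (v x)) ^ 2 - v x * (1 - v x) : ℝ) : ℂ) -
          (z + (v x - fCoeffLimit (v x) : ℝ)) * (1 + z)⁻¹ =
          v x * (-3 + 2 * v x + (1 + z)⁻¹) := by
        rw [fCoeffLimit]
        push_cast
        field_simp
        ring
      have hvp := hc.v_pos x hx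
      have hv1 := hc.v_le x hx
      rw [e, norm_mul, Complex.norm_real, Real.norm_of_nonneg hvp.le, mul_comm]
      refine mul_le_mul_of_nonneg_right ?_ hvp.le
      have n1 := norm_add_le (-3 + 2 * v x : ℂ) (1 + z)⁻¹
      have n2 := norm_add_le (-3 : ℂ) (2 * v x)
      have n3 : ‖(2 * v x : ℂ)‖ ≤ 2 := by
        rw [norm_mul, Complex.norm_real, Real.norm_of_nonneg hvp.le]
        norm_num
        linarith
      have n4 : ‖(-3 : ℂ)‖ = 3 := by norm_num
      linarith)
    (by
      have := lp.mul ((Complex.continuous_conj.tendsto _).comp lP)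
      rw [zero_mul] at this
      exact this) hlim₂ (fun X => by
      have h1 : ∀ᶠ x in atTop, Y z x 1 + z * Y z x 0 ≠ 0 := lq.eventually_ne (by norm_num)
      obtain ⟨t, ht, hXt⟩ := (h1.and (eventually_gt_atTop X)).exists
      exact ⟨t, hXt, fun h => ht h.2.1⟩) hx
  have e : z * Y z x 0 - (Y z x 1 + z * Y z x 0) = -Y z x 1 := by ring
  rwa [e] at key

/-- The first component tends to `0` and carries no sign at infinity. For real `z` the strict
inequality makes the product of the first two components positive and excludes zeros of the second;
as that one tends to `-1`, both are negative at the boundary. -/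
theorem evenRootCount {h₀ : ℝ} (hY : IsScaledMode v Y)
    (hc : InflowCoeff v (fun x => v x - fCoeffLimit (v x)) (fun x => v x * (1 - v x)) h₀ 1)
    (hv0 : Tendsto v atTop (𝓝 0)) (h0 : (Y 0 0 0).re < 0) :
    EvenRootCount (fun z => Y z 0 0) nonstable := by
  obtain ⟨b, hb⟩ : ∃ b, b = 4 + 2 * ((1 : ℝ) + 1) + 2 * (2 + h₀ * 6 / 2) ^ 2 / h₀ ^ 2 + 1 :=
    ⟨_, rfl⟩
  have hb0 : 0 < b := by
    have h2 : 0 ≤ 2 * (2 + h₀ * 6 / 2) ^ 2 / h₀ ^ 2 := by positivity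
    rw [hb]; linarith
  refine evenRootCount_of_sign (fun z hz => hY.analyticAt_zero hz) (fun z hz => ?_) hb0.le
    (fun z hz hL h => ?_) ?_
  · rw [hY.conj hz le_rfl]; rfl
  · obtain ⟨η, hη⟩ := exists_isRotation hz
    have := hY.re_mul_neg hc hv0 hz hη (hb ▸ hL) le_rfl
    simp [h] at this
  · have hbz : (b : ℂ) ∈ nonstable := by simpa [nonstable] using hb0.le
    have hreal : ∀ i x, 0 ≤ x → Y b x i = ((Y b x i).re : ℂ) := fun i x hx => by
      have h1 := hY.conj hbz hx
      rw [Complex.conj_ofReal] at h1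
      exact (Complex.conj_eq_iff_re.1 (congrFun h1 i).symm).symm
    obtain ⟨η, hη⟩ := exists_isRotation hbz
    have hneg : ∀ x, 0 ≤ x → (Y b x 0).re * -(Y b x 1).re < 0 := fun x hx => by
      have := hY.re_mul_neg hc hv0 hbz hη
        (by rw [Complex.norm_real, Real.norm_of_nonneg hb0.le, hb]) hx
      rw [hreal 0 x hx, hreal 1 x hx] at this
      have e : (η * ((b : ℂ) * ((Y b x 0).re : ℂ) *
          starRingEnd ℂ (-((Y b x 1).re : ℂ) / b))).re = (Y b x 0).re * -(Y b x 1).re := by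
        have : (η * ((b : ℂ) * ((Y b x 0).re : ℂ) *
          starRingEnd ℂ (-((Y b x 1).re : ℂ) / b))) =
            η * (((Y b x 0).re * -(Y b x 1).re : ℝ) : ℂ) := by
          have hb' : (b : ℂ) ≠ 0 := Complex.ofReal_ne_zero.2 hb0.ne'
          simp only [map_div₀, map_neg, Complex.conj_ofReal]
          push_cast
          field_simp
        rw [this, Complex.re_mul_ofReal, hη.re_eq, one_mul]
      rwa [e] at this
    have hP : 0 < -(Y b 0 1).re := by
      refine pos_of_tendsto_pos (f := fun x => -(Y b x 1).re) (L := 1) ?_ (fun x hx h0 => ?_)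
        one_pos ?_ le_rfl
      · exact (Complex.continuous_re.comp_continuousOn
          fun x hx => ((hY.sol _ hbz).dq x hx).continuousWithinAt).neg
      · have := hneg x hx
        rw [h0, mul_zero] at this
        exact this.false
      · have := ((Complex.continuous_re.tendsto _).comp
          (tendsto_pi_nhds.1 (hY.tendsto _ hbz) 1)).neg
        simpa [scaledVec, Function.comp_def] using this
    have h1 := neg_of_mul_neg_left (hneg 0 le_rfl) hP.le
    exact mul_pos_of_neg_of_neg h0 h1

end IsScaledMode

section
variable {v0 : ℝ}

theorem tendsto_limitProfile (h0 : 0 < v0) (h1 : v0 < 1) :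
    Tendsto (limitProfile v0) atTop (𝓝 0) := by
  refine squeeze_zero (fun x => (limitProfile_pos h0 h1 x).le) (limitProfile_le h0 h1) ?_
  have : Tendsto (fun x : ℝ => Real.exp (-1 * x)) atTop (𝓝 0) :=
    Real.tendsto_exp_atBot.comp ((tendsto_const_mul_atBot_of_neg (by norm_num)).2 tendsto_id)
  simpa using this.const_mul (v0 / (1 - v0))

theorem exists_limitMode (h0 : 0 < v0) (h1 : v0 < 1) : ∃ Y, IsScaledMode (limitProfile v0) Y := by
  refine exists_isScaledMode (c := 1) (C := v0 / (1 - v0)) one_pos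
    (fun x _ => (hasDerivAt_limitProfile h0 h1 x).continuousAt.continuousWithinAt) fun x _ => ?_
  rw [abs_of_pos (limitProfile_pos h0 h1 x)]
  exact limitProfile_le h0 h1 x

theorem limitProfile_le_init (h0 : 0 < v0) (h1 : v0 < 1) {x : ℝ} (hx : 0 ≤ x) :
    limitProfile v0 x ≤ v0 := by
  have h2 : 0 < 1 - v0 := by linarith
  have h3 := Real.one_le_exp hx
  rw [limitProfile_eq h0 h1]
  refine div_le_self h0.le ?_
  have := mul_le_mul_of_nonneg_left h3 h2.le
  linarith

theorem inflowCoeff_limitProfile (h0 : 0 < v0) (h1 : v0 < 1) :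
    InflowCoeff (limitProfile v0) (fun x => limitProfile v0 x - fCoeffLimit (limitProfile v0 x))
      (fun x => limitProfile v0 x * (1 - limitProfile v0 x)) (1 - v0) 1 where
  h₀_pos := by linarith
  v_pos x _ := limitProfile_pos h0 h1 x
  v_le x _ := (limitProfile_lt_one h0 h1 x).le
  le_h x hx := by
    have := limitProfile_le_init h0 h1 hx
    simp only [fCoeffLimit]; linarith
  h_le x _ := by
    have := limitProfile_pos h0 h1 x
    simp only [fCoeffLimit]; linarith
  deriv x _ := by
    have h := (hasDerivAt_limitProfile h0 h1 x).const_sub 1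
    refine ((h.congr_of_eventuallyEq (Eventually.of_forall fun y => ?_)).congr_deriv
      (by ring)).hasDerivWithinAt
    simp only [fCoeffLimit]; ring

/-- At `z = 0` the system is solved by `p = 1 - 1/(1 - v)`, `q = -1`, `s = -1/(1 - v)`, as follows
from `v' = v (v - 1)`. -/
theorem limitMode_zero (h0 : 0 < v0) (h1 : v0 < 1) {Y : ℂ → ℝ → Fin 3 → ℂ}
    (hY : IsScaledMode (limitProfile v0) Y) : Y 0 0 0 = ((-(v0 / (1 - v0)) : ℝ) : ℂ) := by
  have hlt := limitProfile_lt_one h0 h1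
  have hne : ∀ x, 1 - limitProfile v0 x ≠ 0 := fun x => by linarith [hlt x]
  have hd := fun x => hasDerivAt_limitProfile h0 h1 x
  have hds : ∀ x, HasDerivAt (fun x => -(1 - limitProfile v0 x)⁻¹)
      (limitProfile v0 x / (1 - limitProfile v0 x)) x := fun x => by
    refine (((hd x).const_sub 1).inv (hne x)).neg.congr_deriv ?_
    have := hne x
    field_simp
    ring
  have hdp : ∀ x, HasDerivAt (fun x => 1 - (1 - limitProfile v0 x)⁻¹)
      (limitProfile v0 x / (1 - limitProfile v0 x)) x := fun x => by
    have := (hds x).const_add 1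
    simpa [sub_eq_add_neg] using this
  have h := hY.unique 0 zero_mem_nonstable
    (fun x => ![((1 - (1 - limitProfile v0 x)⁻¹ : ℝ) : ℂ), -1,
      ((-(1 - limitProfile v0 x)⁻¹ : ℝ) : ℂ)])
    ⟨fun x _ => ((hdp x).ofReal_comp.hasDerivWithinAt.congr_deriv (by
        simp; ring)),
      fun x _ => (hasDerivWithinAt_const x _ (-1 : ℂ)).congr_deriv (by simp),
      fun x _ => ((hds x).ofReal_comp.hasDerivWithinAt.congr_deriv (by
        have h2 : (1 - limitProfile v0 x : ℂ) ≠ 0 := by exact_mod_cast hne x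
        simp
        field_simp
        ring))⟩ (by
      have l1 : Tendsto (fun x => (1 - limitProfile v0 x)⁻¹) atTop (𝓝 1) := by
        have := ((tendsto_limitProfile h0 h1).const_sub 1).inv₀ (by norm_num)
        simpa using this
      have lc := fun (g : ℝ → ℝ) (L : ℝ) (hg : Tendsto g atTop (𝓝 L)) =>
        (Complex.continuous_ofReal.tendsto L).comp hg
      refine tendsto_vec3.2 ⟨?_, tendsto_const_nhds, ?_⟩
      · have := lc _ _ (l1.const_sub 1)
        rw [sub_self, Complex.ofReal_zero] at this
        exact this
      · have := lc _ _ l1.neg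
        rw [add_zero, inv_one]
        rw [Complex.ofReal_neg, Complex.ofReal_one] at this
        exact this) 0 le_rfl
  rw [← h, limitProfile_zero h0 h1]
  have : 1 - v0 ≠ 0 := by linarith
  simp only [Matrix.cons_val_zero]
  congr 1
  field_simp
  ring

/-- Passing to `p / z` and `s / z` isolates the factor `z` responsible for the zero at the origin;
what remains is regular there. The identity at `0` itself follows by analytic continuation. -/
theorem IsLimitInflowEvans.eq_mul (h0 : 0 < v0) (h1 : v0 < 1) {Y : ℂ → ℝ → Fin 3 → ℂ}
    (hY : IsScaledMode (limitProfile v0) Y) {D : ℂ → ℂ} (hD : IsLimitInflowEvans v0 D) :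
    EqOn D (fun z => z * Y z 0 0) nonstable := by
  obtain ⟨hDa, W, hW⟩ := hD
  have key : EqOn D (fun z => z * Y z 0 0) (nonstable \ {0}) := by
    rintro z ⟨hz, hz0⟩
    have hz0' : z ≠ 0 := hz0
    have hzre : 0 ≤ z.re := hz
    have hz1 : 1 + z ≠ 0 := one_add_ne_zero (by linarith)
    have hz2 : -1 - z ≠ 0 := fun h => hz1 (by linear_combination -h)
    obtain ⟨hsol, hlim, hDz⟩ := hW z hz
    obtain ⟨l0, l1, l2⟩ := tendsto_vec3.1 hlim
    have h := hY.unique z hz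
      (fun x => ![star (W z x 0) / z, star (W z x 1) - star (W z x 0), star (W z x 2) / z])
      ((solvesAdjoint_iff.1 hsol).scaled hz0') (by
        refine tendsto_vec3.2 ⟨?_, ?_, ?_⟩
        · simpa using l0.star.div_const z
        · simpa using l1.star.sub l0.star
        · have := l2.star.div_const z
          rw [star_star] at this
          have e : z / (-1 - z) / z = -(1 + z)⁻¹ := by field_simp; ring
          rw [e] at this
          exact this) 0 le_rfl
    have hp := congrFun h 0
    simp only [Matrix.cons_val_zero] at hp
    rw [hDz, pairing_single]
    change star (W z 0 0) = z * Y z 0 0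
    rw [← hp]
    field_simp
  intro z hz
  exact (eventuallyEq_of_eqOn_nonstable hz (hDa z hz) (analyticAt_id.mul (hY.analyticAt_zero hz))
    key).self_of_nhds

theorem exists_isLimitInflowEvans (h0 : 0 < v0) (h1 : v0 < 1) : ∃ D, IsLimitInflowEvans v0 D := by
  obtain ⟨Y, hY⟩ := exists_limitMode h0 h1
  refine ⟨fun z => z * Y z 0 0, fun z hz => analyticAt_id.mul (hY.analyticAt_zero hz),
    fun z x => star ![z * Y z x 0, Y z x 1 + z * Y z x 0, z * Y z x 2],
    fun z hz => ⟨?_, ?_, ?_⟩⟩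
  · rw [solvesAdjoint_iff]
    simpa using (hY.sol z hz).shifted
  · have hlim := tendsto_pi_nhds.1 (hY.tendsto z hz)
    have l0 := (hlim 0).const_mul z
    have l1 := (hlim 1).add l0
    have l2 := (hlim 2).const_mul z
    have hzre : 0 ≤ z.re := hz
    have hz1 : 1 + z ≠ 0 := one_add_ne_zero (by linarith)
    have hz2 : -1 - z ≠ 0 := fun h => hz1 (by linear_combination -h)
    have : Tendsto (fun x => ![z * Y z x 0, Y z x 1 + z * Y z x 0, z * Y z x 2]) atTop
        (𝓝 ![0, -1, z / (-1 - z)]) := by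
      refine tendsto_vec3.2 ⟨?_, ?_, ?_⟩
      · simpa [scaledVec] using l0
      · simpa [scaledVec] using l1
      · have e : z * scaledVec z 2 = z / (-1 - z) := by
          simp only [scaledVec, Matrix.cons_val]
          field_simp
          ring
        rw [e] at l2
        exact l2
    have := this.star
    convert this using 2
    funext i
    fin_cases i <;> simp
  · rw [pairing_single]; simp

theorem limitInflow_evans (h0 : 0 < v0) (h1 : v0 < 1) : (∃ D, IsLimitInflowEvans v0 D) ∧
    ∀ D, IsLimitInflowEvans v0 D →
      D 0 = 0 ∧ deriv D 0 ≠ 0 ∧ EvenRootCount D (nonstable \ {0}) := by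
  refine ⟨exists_isLimitInflowEvans h0 h1, fun D hD => ?_⟩
  obtain ⟨Y, hY⟩ := exists_limitMode h0 h1
  have hE := hD.eq_mul h0 h1 hY
  have hg : AnalyticOnNhd ℂ (fun z => Y z 0 0) nonstable := fun z hz => hY.analyticAt_zero hz
  have hg0 := limitMode_zero h0 h1 hY
  have hpos : 0 < v0 / (1 - v0) := div_pos h0 (by linarith)
  have hg1 : Y 0 0 0 ≠ 0 := by
    rw [hg0, Complex.ofReal_ne_zero]; linarith
  refine ⟨by rw [hE zero_mem_nonstable]; simp, ?_, ?_⟩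
  · rw [deriv_eq_of_factor (a := fun _ => 1) hg hD.1 (fun z _ => analyticAt_const)
      (fun z hz => by rw [hE hz.1]; simp)]
    simpa using hg1
  · refine EvenRootCount.of_factor hg hD.1 (a := fun z => z) (fun z _ => analyticAt_id)
      (fun z hz => hz.2) (fun z hz => hE hz.1) hg1
      (hY.evenRootCount (inflowCoeff_limitProfile h0 h1) (tendsto_limitProfile h0 h1) ?_)
    rw [hg0, Complex.ofReal_re]
    linarith

/-- All limiting profiles are translates of the one with `v₀ = 1/2`, and for `v₀ ≤ 1/2` the
translation is to the right. By uniqueness the modes are translates too, so `D v₀ z / z` for `z ≠ 0`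
is a fixed function evaluated at `-log (v₀ / (1 - v₀)) → +∞`, where it tends to `0`. -/
theorem tendsto_limitInflowEvans {D : ℝ → ℂ → ℂ}
    (hD : ∀ v0 : ℝ, 0 < v0 → v0 < 1 → IsLimitInflowEvans v0 (D v0)) {z : ℂ} (hz : z ∈ nonstable) :
    Tendsto (fun v0 => D v0 z) (𝓝[>] 0) (𝓝 0) := by
  obtain ⟨Y, hY⟩ := exists_limitMode (v0 := 1 / 2) (by norm_num) (by norm_num)
  have hev : ∀ᶠ v0 : ℝ in 𝓝[>] 0, z * Y z (-Real.log (v0 / (1 - v0))) 0 = D v0 z := by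
    filter_upwards [Ioc_mem_nhdsGT (show (0 : ℝ) < 1 / 2 by norm_num)] with v0 hv0
    have h1 : v0 < 1 := by linarith [hv0.2]
    obtain ⟨Y', hY'⟩ := exists_limitMode hv0.1 h1
    have hτ : 0 ≤ -Real.log (v0 / (1 - v0)) := by
      rw [neg_nonneg]
      refine Real.log_nonpos (div_nonneg hv0.1.le (by linarith)) ?_
      rw [div_le_one (by linarith)]
      linarith [hv0.2]
    have h := hY'.unique z hz (fun x => Y z (x + -Real.log (v0 / (1 - v0)))) (by
      have := (hY.sol z hz).translate hτ
      have e : (fun x => limitProfile (1 / 2) (x + -Real.log (v0 / (1 - v0)))) =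
          limitProfile v0 := by
        funext x
        exact (congrArg _ (sub_eq_add_neg _ _).symm).trans (limitProfile_translate v0 x).symm
      rw [e] at this
      exact this) ((hY.tendsto z hz).comp (tendsto_atTop_add_const_right _ _ tendsto_id)) 0 le_rfl
    rw [zero_add] at h
    rw [h]
    exact ((hD v0 hv0.1 h1).eq_mul hv0.1 h1 hY' hz).symm
  refine Tendsto.congr' hev ?_
  have hlog : Tendsto (fun v0 : ℝ => -Real.log (v0 / (1 - v0))) (𝓝[>] 0) atTop := by
    refine tendsto_neg_atBot_atTop.comp (Real.tendsto_log_nhdsGT_zero.comp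
      (tendsto_nhdsWithin_iff.2 ⟨?_, ?_⟩))
    · have : ContinuousAt (fun v0 : ℝ => v0 / (1 - v0)) 0 :=
        continuousAt_id.div (continuousAt_const.sub continuousAt_id) (by norm_num)
      have h2 := this.tendsto
      simp only [zero_div] at h2
      exact h2.mono_left nhdsWithin_le_nhds
    · filter_upwards [Ioc_mem_nhdsGT (show (0 : ℝ) < 1 / 2 by norm_num)] with v0 hv0
      exact div_pos hv0.1 (by linarith [hv0.2])
  have := ((tendsto_pi_nhds.1 (hY.tendsto z hz) 0).comp hlog).const_mul z
  simpa [scaledVec, Function.comp_def] using this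

end

end BoundaryLayer

end

noncomputable section

namespace BoundaryLayer

/-! ### The outflow problem -/

/-- The eigenvalue system in the variables `Z = w₁ + w₂`, `X = w₂ / z`, `w = w₃` and `t = -x`,
shifted by the exponent `r`. -/
structure ShiftedOutflow (v f : ℝ → ℝ) (z r : ℂ) (Z X w : ℝ → ℂ) : Prop where
  dZ : ∀ t ∈ Ici (0 : ℝ), HasDerivWithinAt Z (r * Z t - (z ^ 2 * X t + 2 * z * w t)) (Ici 0) t
  dX : ∀ t ∈ Ici (0 : ℝ), HasDerivWithinAt X (r * X t - w t) (Ici 0) t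
  dw : ∀ t ∈ Ici (0 : ℝ),
    HasDerivWithinAt w (r * w t - (v t * Z t + (f t - z) * w t)) (Ici 0) t

theorem ShiftedOutflow.mul_exp {v f : ℝ → ℝ} {z r : ℂ} {Z X w : ℝ → ℂ}
    (h : ShiftedOutflow v f z r Z X w) (ρ : ℂ) :
    ShiftedOutflow v f z (r + ρ) (fun t => Complex.exp (ρ * t) * Z t)
      (fun t => Complex.exp (ρ * t) * X t) (fun t => Complex.exp (ρ * t) * w t) where
  dZ t ht := ((hasDerivAt_cexp_mul ρ t).hasDerivWithinAt.mul (h.dZ t ht)).congr_deriv (by ring)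
  dX t ht := ((hasDerivAt_cexp_mul ρ t).hasDerivWithinAt.mul (h.dX t ht)).congr_deriv (by ring)
  dw t ht := ((hasDerivAt_cexp_mul ρ t).hasDerivWithinAt.mul (h.dw t ht)).congr_deriv (by ring)

theorem ShiftedOutflow.const_mul {v f : ℝ → ℝ} {z r : ℂ} {Z X w : ℝ → ℂ}
    (h : ShiftedOutflow v f z r Z X w) (c : ℂ) :
    ShiftedOutflow v f z r (fun t => c * Z t) (fun t => c * X t) (fun t => c * w t) where
  dZ t ht := ((h.dZ t ht).const_mul c).congr_deriv (by ring)
  dX t ht := ((h.dX t ht).const_mul c).congr_deriv (by ring)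
  dw t ht := ((h.dw t ht).const_mul c).congr_deriv (by ring)

theorem ShiftedOutflow.conj {v f : ℝ → ℝ} {z r : ℂ} {Z X w : ℝ → ℂ}
    (h : ShiftedOutflow v f z r Z X w) :
    ShiftedOutflow v f (starRingEnd ℂ z) (starRingEnd ℂ r) (fun t => starRingEnd ℂ (Z t))
      (fun t => starRingEnd ℂ (X t)) (fun t => starRingEnd ℂ (w t)) where
  dZ t ht := (h.dZ t ht).star.congr_deriv (by simp)
  dX t ht := (h.dX t ht).star.congr_deriv (by simp)
  dw t ht := (h.dw t ht).star.congr_deriv (by simp)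

theorem ShiftedOutflow.system {v f : ℝ → ℝ} {z : ℂ} {κ : ℝ} {Z X w : ℝ → ℂ}
    (h : ShiftedOutflow v f z κ Z X w) : OutflowSystem v (fun t => v t - f t) z κ Z X w where
  dZ := h.dZ
  dX := h.dX
  dw t ht := (h.dw t ht).congr_deriv (by push_cast; ring)

theorem hasDerivWithinAt_comp_neg_Ici {E : Type*} [NormedAddCommGroup E] [NormedSpace ℝ E]
    {g : ℝ → E} {g' : E} {t : ℝ} (h : HasDerivWithinAt g g' (Iic 0) (-t)) :
    HasDerivWithinAt (fun t => g (-t)) (-g') (Ici 0) t := by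
  have h2 := h.scomp t ((hasDerivAt_neg t).hasDerivWithinAt (s := Ici 0))
    (fun y hy => by simpa using hy)
  simpa [Function.comp_def] using h2

theorem hasDerivWithinAt_comp_neg_Iic {E : Type*} [NormedAddCommGroup E] [NormedSpace ℝ E]
    {g : ℝ → E} {g' : E} {x : ℝ} (h : HasDerivWithinAt g g' (Ici 0) (-x)) :
    HasDerivWithinAt (fun x => g (-x)) (-g') (Iic 0) x := by
  have h2 := h.scomp x ((hasDerivAt_neg x).hasDerivWithinAt (s := Iic 0))
    (fun y hy => by simpa using hy)
  simpa [Function.comp_def] using h2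

theorem coeffMatrix_mulVec (v f : ℝ) (z : ℂ) (W : Fin 3 → ℂ) : (coeffMatrix v f z).mulVec W =
    ![z * (W 1 + W 2), z * W 2, v * (W 0 + W 1) + (f - z) * W 2] := by
  funext i
  fin_cases i <;> simp [coeffMatrix, Matrix.mulVec, dotProduct, Fin.sum_univ_three] <;> ring

theorem SolvesEigen.shifted {v f : ℝ → ℝ} {z : ℂ} {W : ℝ → Fin 3 → ℂ} (hz : z ≠ 0)
    (h : SolvesEigen v f z W) :
    ShiftedOutflow (fun t => v (-t)) (fun t => f (v (-t))) z 0 (fun t => W (-t) 0 + W (-t) 1)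
      (fun t => W (-t) 1 / z) (fun t => W (-t) 2) := by
  have h' := fun t (ht : t ∈ Ici (0 : ℝ)) (i : Fin 3) =>
    hasDerivWithinAt_comp_neg_Ici (hasDerivWithinAt_pi.1 (h (-t) (by simpa using ht)) i)
  simp only [coeffMatrix_mulVec] at h'
  refine ⟨fun t ht => ((h' t ht 0).add (h' t ht 1)).congr_deriv ?_,
    fun t ht => ((h' t ht 1).div_const z).congr_deriv ?_,
    fun t ht => (h' t ht 2).congr_deriv ?_⟩
  · simp; field_simp; ring
  · simp; field_simp
  · simp

theorem ShiftedOutflow.solvesEigen {v f : ℝ → ℝ} {z : ℂ} {Z X w : ℝ → ℂ}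
    (h : ShiftedOutflow (fun t => v (-t)) (fun t => f (v (-t))) z 0 Z X w) :
    SolvesEigen v f z (fun x => ![Z (-x) - z * X (-x), z * X (-x), w (-x)]) := by
  intro x hx
  have hx' : -x ∈ Ici (0 : ℝ) := by simpa using hx
  rw [coeffMatrix_mulVec]
  refine hasDerivWithinAt_pi.2 fun i => ?_
  have h0 := hasDerivWithinAt_comp_neg_Iic (h.dZ _ hx')
  have h1 := hasDerivWithinAt_comp_neg_Iic (h.dX _ hx')
  have h2 := hasDerivWithinAt_comp_neg_Iic (h.dw _ hx')
  simp only [neg_neg] at h2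
  fin_cases i
  · refine (h0.sub (h1.const_mul z)).congr_deriv ?_
    simp; ring
  · refine (h1.const_mul z).congr_deriv ?_
    simp
  · refine h2.congr_deriv ?_
    simp

/-- The matrix `r - B` of the limiting shifted system. -/
def outflowMat (f : ℝ) (z r : ℂ) : Matrix (Fin 3) (Fin 3) ℂ :=
  !![r, -z ^ 2, -(2 * z); 0, r, -1; -1, 0, r - (f - z)]

/-- The deviation of the coefficients from their limits. -/
def outflowPert (v f : ℝ → ℝ) (f' : ℝ) (t : ℝ) : (Fin 3 → ℂ) →L[ℂ] (Fin 3 → ℂ) :=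
  matCLM (((v t - 1 : ℝ) : ℂ) • !![0, 0, 0; 0, 0, 0; -1, 0, 0] +
    ((f t - f' : ℝ) : ℂ) • !![0, 0, 0; 0, 0, 0; 0, 0, -1])

theorem isSol_outflow_iff {v f : ℝ → ℝ} {f' : ℝ} {z r : ℂ} {y : ℝ → Fin 3 → ℂ} :
    IsSol (matCLM (outflowMat f' z r)) (outflowPert v f f') y ↔
      ShiftedOutflow v f z r (fun t => y t 0) (fun t => y t 1) (fun t => y t 2) := by
  have key : ∀ t, (outflowMat f' z r + (((v t - 1 : ℝ) : ℂ) • !![0, 0, 0; 0, 0, 0; -1, 0, 0] +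
      ((f t - f' : ℝ) : ℂ) • !![0, 0, 0; 0, 0, 0; 0, 0, -1])).mulVec (y t) =
      ![r * y t 0 - (z ^ 2 * y t 1 + 2 * z * y t 2), r * y t 1 - y t 2,
        r * y t 2 - (v t * y t 0 + (f t - z) * y t 2)] := fun t => by
    funext i
    fin_cases i <;>
      simp [outflowMat, Matrix.mulVec, dotProduct, Fin.sum_univ_three] <;> ring
  unfold outflowPert
  rw [isSol_matCLM]
  constructor
  · intro h
    refine ⟨fun t ht => (h t ht 0).congr_deriv ?_, fun t ht => (h t ht 1).congr_deriv ?_,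
      fun t ht => (h t ht 2).congr_deriv ?_⟩ <;> rw [key] <;> simp
  · intro h t ht i
    rw [key]
    fin_cases i
    · exact h.dZ t ht
    · exact h.dX t ht
    · exact h.dw t ht

theorem outflowMat_mulVec (f : ℝ) (z r a b c : ℂ) : (outflowMat f z r).mulVec ![a, b, c] =
    ![r * a - (z ^ 2 * b + 2 * z * c), r * b - c, r * c - (a + (f - z) * c)] := by
  funext i
  fin_cases i <;> simp [outflowMat, Matrix.mulVec, dotProduct, Fin.sum_univ_three] <;> ring

/-- The eigenvector of the limiting matrix in the variables `Z`, `X`, `w`. -/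
def outflowVec (h : ℝ) (T : ℂ → ℂ) (z : ℂ) : Fin 3 → ℂ :=
  ![(z ^ 2 / branchEig 1 h T z + 2 * z) / branchEig 1 h T z, 1 / branchEig 1 h T z, 1]

namespace IsBranch

variable {h δ : ℝ} {T : ℂ → ℂ} {z : ℂ}

theorem eig_re_pos_of_lt_one (hb : IsBranch 1 h δ T) (hh : 0 ≤ h) (h1 : h < 1)
    (hz : z ∈ nonstable) : 0 < (branchEig 1 h T z).re :=
  (sub_pos.2 h1).trans_le (hb.eig_re_ge_one_sub hh hz)

theorem eig_ne_zero (hb : IsBranch 1 h δ T) (hh : 0 ≤ h) (h1 : h < 1) (hz : z ∈ nonstable) :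
    branchEig 1 h T z ≠ 0 := fun h0 => by
  have := hb.eig_re_pos_of_lt_one hh h1 hz
  rw [h0] at this
  simp at this

theorem outflowMat_mulVec_outflowVec (hb : IsBranch 1 h δ T) (hz : -δ < z.re)
    (h0 : branchEig 1 h T z ≠ 0) :
    (outflowMat (1 - h) z (branchEig 1 h T z)).mulVec (outflowVec h T z) = 0 := by
  have hc := hb.cubic zero_le_one hz
  rw [outflowVec, outflowMat_mulVec]
  set r := branchEig 1 h T z
  have e1 : r * ((z ^ 2 / r + 2 * z) / r) - (z ^ 2 * (1 / r) + 2 * z * 1) = 0 := by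
    field_simp; ring
  have e2 : r * (1 / r) - 1 = 0 := by field_simp; ring
  have e3 : r * 1 - ((z ^ 2 / r + 2 * z) / r + (((1 - h : ℝ) : ℂ) - z) * 1) = 0 := by
    field_simp
    push_cast at hc ⊢
    linear_combination hc
  rw [e1, e2, e3]
  funext i
  fin_cases i <;> rfl

theorem nonnegSpectrum_outflowMat (hb : IsBranch 1 h δ T) (hh : 0 ≤ h) (h1 : h < 1)
    (hz : z ∈ nonstable) : NonnegSpectrum (matCLM (outflowMat (1 - h) z (branchEig 1 h T z))) := by
  refine nonnegSpectrum_matCLM fun ρ a b c hE hneg => ?_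
  rw [outflowMat_mulVec] at hE
  have g1 := congrFun hE 0
  have g2 := congrFun hE 1
  have g3 := congrFun hE 2
  simp at g1 g2 g3
  have hr := (hb.eig_re_pos_of_lt_one hh h1 hz).le
  set r := branchEig 1 h T z with hrdef
  have hre : 0 < (r - ρ).re := by rw [Complex.sub_re]; linarith
  have hne0 : r - ρ ≠ 0 := fun h0 => by rw [h0] at hre; simp at hre
  have hc : c = (r - ρ) * b := by linear_combination -g2
  by_cases hb0 : b = 0
  · have hc0 : c = 0 := by rw [hc, hb0, mul_zero]
    refine ⟨?_, hb0, hc0⟩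
    have : (r - ρ) * a = 0 := by
      rw [hb0, hc0] at g1
      linear_combination g1
    exact (mul_eq_zero.1 this).resolve_left hne0
  · exfalso
    have hcub : ((r - ρ) ^ 3 + (z - ((1 : ℝ) - h : ℝ)) * (r - ρ) ^ 2 - 2 * z * (1 : ℝ) * (r - ρ) -
        (1 : ℝ) * z ^ 2) * b = 0 := by
      rw [hc] at g1 g3
      push_cast
      linear_combination g1 + (r - ρ) * g3
    have := hb.eq_of_root hz hre ((mul_eq_zero.1 hcub).resolve_right hb0)
    rw [← hrdef] at this
    have h0 : ρ = 0 := by linear_combination -this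
    rw [h0] at hneg
    simp at hneg

theorem analyticAt_outflowVec (hb : IsBranch 1 h δ T) (hz : -δ < z.re)
    (h0 : branchEig 1 h T z ≠ 0) : AnalyticAt ℂ (outflowVec h T) z := by
  have hr := hb.analyticAt_eig hz
  have hid : AnalyticAt ℂ (fun z : ℂ => z) z := analyticAt_id
  refine analyticAt_pi_iff.2 fun i => ?_
  fin_cases i
  · exact (((hid.pow 2).div hr h0).add (analyticAt_const.mul hid)).div hr h0
  · exact analyticAt_const.div hr h0
  · exact analyticAt_const

theorem analyticAt_outflowMat (hb : IsBranch 1 h δ T) (hz : -δ < z.re) (f : ℝ) :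
    AnalyticAt ℂ (fun z => matCLM (outflowMat f z (branchEig 1 h T z))) z := by
  have hr := hb.analyticAt_eig hz
  have hid : AnalyticAt ℂ (fun z : ℂ => z) z := analyticAt_id
  refine analyticAt_matCLM fun i j => ?_
  fin_cases i <;> fin_cases j <;> simp only [outflowMat, Matrix.of_apply, Fin.isValue, Fin.mk_zero,
    Fin.mk_one, Fin.reduceFinMk, Matrix.cons_val, Matrix.cons_val_zero, Matrix.cons_val_one]
  exacts [hr, (hid.pow 2).neg, (analyticAt_const.mul hid).neg, analyticAt_const, hr,
    analyticAt_const, analyticAt_const, analyticAt_const, hr.sub (analyticAt_const.sub hid)]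

end IsBranch

theorem cubic_of_eigenvector {h : ℝ} {z ρ : ℂ} (hρ : ρ ≠ 0) {V : Fin 3 → ℂ}
    (hV : (coeffMatrix 1 (1 - h) z).mulVec V = ρ • V) (hne : V ≠ 0) :
    V 2 ≠ 0 ∧ ρ ^ 3 + (z - ((1 : ℝ) - h : ℝ)) * ρ ^ 2 - 2 * z * (1 : ℝ) * ρ - (1 : ℝ) * z ^ 2 = 0 ∧
      ρ * V 1 = z * V 2 ∧ ρ * V 0 = z * (V 1 + V 2) := by
  rw [coeffMatrix_mulVec] at hV
  have g1 := congrFun hV 0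
  have g2 := congrFun hV 1
  have g3 := congrFun hV 2
  simp at g1 g2 g3
  have h2 : V 2 ≠ 0 := fun h0 => hne (by
    have hV1 : V 1 = 0 := by simpa [h0, hρ] using g2.symm
    have hV0 : V 0 = 0 := by simpa [h0, hV1, hρ] using g1.symm
    funext i
    fin_cases i
    exacts [hV0, hV1, h0])
  refine ⟨h2, ?_, g2.symm, g1.symm⟩
  refine (mul_eq_zero.1 (?_ : _ * V 2 = 0)).resolve_right h2
  push_cast
  linear_combination (-(ρ ^ 2)) * g3 - ρ * g1 - (z + ρ) * g2

end BoundaryLayer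

end

/-! ### Outflow layers, their modes and the reduced Evans function -/

noncomputable section

namespace BoundaryLayer

/-- An outflow boundary layer on the half-line `t = -x ≥ 0`: the profile `v`, its slope `H`, the
coefficient `f`, with limits `1`, `0` and `1 - h'`. -/
structure OutflowLayer (v f H dh : ℝ → ℝ) (h' s v0 ν B c C₁ C₂ : ℝ) : Prop where
  coeff : OutflowCoeff v (fun t => v t - f t) dh ν B
  c_pos : 0 < c
  h'_nonneg : 0 ≤ h'
  h'_lt_one : h' < 1
  init : v 0 = v0
  init_lt : v0 < 1
  s_neg : s < 0
  s_le : |s| ≤ B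
  H_zero : H 0 = s
  H_nonpos : ∀ t, 0 ≤ t → H t ≤ 0
  deriv_v : ∀ t ∈ Ici (0 : ℝ), HasDerivWithinAt v (-H t) (Ici 0) t
  deriv_H : ∀ t ∈ Ici (0 : ℝ), HasDerivWithinAt H (-(f t * H t)) (Ici 0) t
  cont_f : ContinuousOn f (Ici 0)
  decay_v : ∀ t, 0 ≤ t → |v t - 1| ≤ C₁ * Real.exp (-c * t)
  decay_f : ∀ t, 0 ≤ t → |f t - (1 - h')| ≤ C₂ * Real.exp (-c * t)

theorem tendsto_of_decay {g : ℝ → ℝ} {L c C : ℝ} (hc : 0 < c)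
    (h : ∀ t, 0 ≤ t → |g t - L| ≤ C * Real.exp (-c * t)) : Tendsto g atTop (𝓝 L) := by
  rw [tendsto_iff_norm_sub_tendsto_zero]
  have h0 : Tendsto (fun t : ℝ => Real.exp (-c * t)) atTop (𝓝 0) :=
    Real.tendsto_exp_atBot.comp ((tendsto_const_mul_atBot_of_neg (by linarith)).2 tendsto_id)
  refine squeeze_zero' (Eventually.of_forall fun _ => norm_nonneg _)
    ((eventually_ge_atTop 0).mono h) ?_
  simpa using h0.const_mul C

/-- The mode at `t = +∞`, with its uniqueness. -/
structure IsOutflowLayerMode (v f : ℝ → ℝ) (h' δ : ℝ) (T : ℂ → ℂ) (Y : ℂ → ℝ → Fin 3 → ℂ) :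
    Prop where
  branch : IsBranch 1 h' δ T
  analytic : ∀ z ∈ nonstable, AnalyticAt ℂ (fun z => Y z 0) z
  sol : ∀ z ∈ nonstable, ShiftedOutflow v f z (branchEig 1 h' T z) (fun t => Y z t 0)
    (fun t => Y z t 1) (fun t => Y z t 2)
  tendsto : ∀ z ∈ nonstable, Tendsto (Y z) atTop (𝓝 (outflowVec h' T z))
  unique : ∀ z ∈ nonstable, ∀ (c : ℂ) (y : ℝ → Fin 3 → ℂ),
    ShiftedOutflow v f z (branchEig 1 h' T z) (fun t => y t 0) (fun t => y t 1) (fun t => y t 2) →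
    Tendsto y atTop (𝓝 (c • outflowVec h' T z)) → ∀ t, 0 ≤ t → y t = c • Y z t

variable {v f H dh : ℝ → ℝ} {h' s v0 ν B c C₁ C₂ δ : ℝ} {T : ℂ → ℂ} {Y : ℂ → ℝ → Fin 3 → ℂ}
  {z : ℂ}

theorem OutflowLayer.exists_mode (hl : OutflowLayer v f H dh h' s v0 ν B c C₁ C₂) :
    ∃ δ T Y, IsOutflowLayerMode v f h' δ T Y := by
  have hh := hl.h'_nonneg
  have h1 := hl.h'_lt_one
  obtain ⟨δ, T, hb⟩ := exists_isBranch one_pos hh h1.ne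
  have hR : IsDecaying (outflowPert v f (1 - h')) c _ :=
    isDecaying_matCLM _ _ (ContinuousOn.sub (fun t ht => (hl.deriv_v t ht).continuousWithinAt)
      continuousOn_const) (hl.cont_f.sub continuousOn_const) hl.decay_v hl.decay_f
  have hne : ∀ z ∈ nonstable, branchEig 1 h' T z ≠ 0 := fun z hz => hb.eig_ne_zero hh h1 hz
  obtain ⟨Y, hY⟩ := exists_analytic_solution (S := nonstable) hl.c_pos hR
    (fun z hz => hb.analyticAt_outflowMat (hb.lt_re hz) (1 - h'))
    (fun z hz => hb.analyticAt_outflowVec (hb.lt_re hz) (hne z hz))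
    (fun z hz => ((hb.eventually_lt_re hz).and
      ((hb.analyticAt_eig (hb.lt_re hz)).continuousAt.eventually_ne (hne z hz))).mono
        fun w hw => hb.outflowMat_mulVec_outflowVec hw.1 hw.2)
    (fun z hz => hb.nonnegSpectrum_outflowMat hh h1 hz)
  refine ⟨δ, T, Y, hb, fun z hz => (hY z hz).1, fun z hz => isSol_outflow_iff.1 (hY z hz).2.1,
    fun z hz => (hY z hz).2.2, fun z hz k y hy hlim t ht => ?_⟩
  have h2 : IsSol (matCLM (outflowMat (1 - h') z (branchEig 1 h' T z)))
      (outflowPert v f (1 - h')) (fun t => k • Y z t) :=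
    isSol_outflow_iff.2 ((isSol_outflow_iff.1 (hY z hz).2.1).const_mul k)
  exact IsSol.eqOn_of_tendsto hl.c_pos hR (hb.nonnegSpectrum_outflowMat hh h1 hz)
    (isSol_outflow_iff.2 hy) h2 hlim ((hY z hz).2.2.const_smul k) ht

/-- The reduced outflow Evans function `D / z`, for the standard normalization of the mode. -/
def reducedOutflow (s : ℝ) (Y : ℂ → ℝ → Fin 3 → ℂ) (z : ℂ) : ℂ :=
  -(Y z 0 1 + Y z 0 2 / (z - s))

theorem sub_ne_zero_of_neg (hs : s < 0) (hz : z ∈ nonstable) : z - s ≠ 0 := fun h => by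
  have hz' : 0 ≤ z.re := hz
  have := congrArg Complex.re h
  simp at this
  linarith

namespace IsOutflowLayerMode

theorem analyticOnNhd_reduced (hY : IsOutflowLayerMode v f h' δ T Y) (hs : s < 0) :
    AnalyticOnNhd ℂ (reducedOutflow s Y) nonstable := fun z hz => by
  have h := analyticAt_pi_iff.1 (hY.analytic z hz)
  exact ((h 1).add ((h 2).div (analyticAt_id.sub analyticAt_const)
    (sub_ne_zero_of_neg hs hz))).neg

theorem conj (hY : IsOutflowLayerMode v f h' δ T Y) (hz : z ∈ nonstable) {t : ℝ} (ht : 0 ≤ t) :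
    Y (starRingEnd ℂ z) t = star (Y z t) := by
  have h1 := (hY.sol z hz).conj
  rw [← hY.branch.eig_conj (hY.branch.lt_re hz)] at h1
  have h2 : Tendsto (fun t => star (Y z t)) atTop
      (𝓝 ((1 : ℂ) • outflowVec h' T (starRingEnd ℂ z))) := by
    rw [one_smul]
    have e : outflowVec h' T (starRingEnd ℂ z) = star (outflowVec h' T z) := by
      funext i
      rw [outflowVec, outflowVec, hY.branch.eig_conj (hY.branch.lt_re hz)]
      fin_cases i <;> simp
    rw [e]
    exact (hY.tendsto z hz).star
  have h3 := hY.unique _ (conj_mem_nonstable hz) 1 (fun t => star (Y z t)) h1 h2 t ht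
  rw [one_smul] at h3
  exact h3.symm

theorem real (hY : IsOutflowLayerMode v f h' δ T Y) {b : ℝ} (hb : 0 ≤ b) (i : Fin 3) {t : ℝ}
    (ht : 0 ≤ t) : Y b t i = ((Y b t i).re : ℂ) := by
  have hbz : (b : ℂ) ∈ nonstable := by simpa [nonstable] using hb
  have h1 := hY.conj hbz ht
  rw [Complex.conj_ofReal] at h1
  exact (Complex.conj_eq_iff_re.1 (congrFun h1 i).symm).symm

theorem eig_real (hY : IsOutflowLayerMode v f h' δ T Y) {b : ℝ} (hb : 0 ≤ b) :
    branchEig 1 h' T b = ((branchEig 1 h' T b).re : ℂ) := by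
  have hbz : (b : ℂ) ∈ nonstable := by simpa [nonstable] using hb
  have h1 := hY.branch.eig_conj (hY.branch.lt_re hbz)
  rw [Complex.conj_ofReal] at h1
  exact (Complex.conj_eq_iff_re.1 h1.symm).symm

theorem conj_reduced (hY : IsOutflowLayerMode v f h' δ T Y) (s : ℝ) (hz : z ∈ nonstable) :
    reducedOutflow s Y (starRingEnd ℂ z) = starRingEnd ℂ (reducedOutflow s Y z) := by
  rw [reducedOutflow, reducedOutflow, hY.conj hz le_rfl]
  simp

/-- At `z = 0` the mode is a multiple of the derivative of the profile. -/
theorem exists_eq_at_zero (hl : OutflowLayer v f H dh h' s v0 ν B c C₁ C₂)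
    (hY : IsOutflowLayerMode v f h' δ T Y) : ∃ C : ℝ, C < 0 ∧ (∀ t : ℝ, 0 ≤ t →
      Complex.exp (-branchEig 1 h' T 0 * t) * Y 0 t 0 = 0 ∧
      Complex.exp (-branchEig 1 h' T 0 * t) * Y 0 t 1 = C * (v t - 1) ∧
      Complex.exp (-branchEig 1 h' T 0 * t) * Y 0 t 2 = C * H t) := by
  have hz := zero_mem_nonstable
  set r := branchEig 1 h' T 0 with hr
  have hrre : 0 < r.re := hY.branch.eig_re_pos_of_lt_one hl.h'_nonneg hl.h'_lt_one hz
  have he : Tendsto (fun t : ℝ => Complex.exp (-r * t)) atTop (𝓝 0) :=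
    tendsto_cexp_mul (by rw [Complex.neg_re]; linarith)
  have hlim := tendsto_pi_nhds.1 (hY.tendsto 0 hz)
  have l0 := he.mul (hlim 0)
  have l1 := he.mul (hlim 1)
  rw [zero_mul] at l0 l1
  have hs := (hY.sol 0 hz).mul_exp (-r)
  rw [add_neg_cancel] at hs
  obtain ⟨dZ, dX, dw⟩ := hs
  have hconst : ∀ {g : ℝ → ℂ} {L : ℂ}, (∀ t ∈ Ici (0 : ℝ), HasDerivWithinAt g 0 (Ici 0) t) →
      Tendsto g atTop (𝓝 L) → ∀ t, 0 ≤ t → g t = L := fun {g L} hg hL => by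
    have h0 : ∀ t, 0 ≤ t → g t = g 0 := fun t ht => by
      refine (convex_Ici (0 : ℝ)).is_const_of_fderivWithin_eq_zero (𝕜 := ℝ)
        (fun x hx => (hg x hx).differentiableWithinAt) (fun x hx => ?_) ht self_mem_Ici
      exact ((hg x hx).hasFDerivWithinAt.fderivWithin (uniqueDiffOn_Ici 0 x hx)).trans (by simp)
    have h1 : L = g 0 := tendsto_nhds_unique hL (tendsto_const_nhds.congr'
      ((eventually_ge_atTop 0).mono fun t ht => (h0 t ht).symm))
    intro t ht
    rw [h0 t ht, h1]
  -- At `z = 0` the equation for `Z` is `Z' = 0` once the shift is removed, and `Z` tends to `0`.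
  have hZ : ∀ t : ℝ, 0 ≤ t → Complex.exp (-r * t) * Y 0 t 0 = 0 :=
    hconst (fun t ht => (dZ t ht).congr_deriv (by simp)) l0
  have hsne : (s : ℂ) ≠ 0 := Complex.ofReal_ne_zero.2 hl.s_neg.ne
  obtain ⟨C, hC⟩ : ∃ C : ℝ, C = (Y 0 0 2).re / s := ⟨_, rfl⟩
  have hC0 : Y 0 0 2 = C * s := by
    have := hY.real (b := 0) le_rfl 2 le_rfl
    rw [Complex.ofReal_zero] at this
    rw [this, hC]
    push_cast
    field_simp
  have hW : ∀ t : ℝ, 0 ≤ t → Complex.exp (-r * t) * Y 0 t 2 = C * H t := fun t ht => by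
    have dy : ∀ t ∈ Ici (0 : ℝ), HasDerivWithinAt
        (fun t : ℝ => Complex.exp (-r * t) * Y 0 t 2 - C * H t)
        (-(f t * (Complex.exp (-r * t) * Y 0 t 2 - C * H t))) (Ici 0) t := fun t ht => by
      refine ((dw t ht).sub ((hl.deriv_H t ht).ofReal_comp.const_mul (C : ℂ))).congr_deriv ?_
      rw [hZ t ht]
      push_cast
      ring
    -- Gronwall for the squared modulus of the difference: its logarithmic derivative is `-2 f ≤ 2
    -- (1 + B)`, and it starts from zero.
    have hu := le_exp_of_deriv_le (c := -(2 * (1 + B)))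
      (fun t ht => hasDerivWithinAt_re_mul_conj (η := 1) (dy t ht) (dy t ht)) (fun t ht => by
        rw [re_one_mul_add_conj]
        have hf : -f t ≤ 1 + B := by
          have h1 := hl.coeff.h_le t ht
          have h2 := hl.coeff.le_v t ht
          have h3 := hl.coeff.pos
          linarith
        have e : ∀ y : ℂ, (-(f t * y) * starRingEnd ℂ y).re = -f t * ‖y‖ ^ 2 := fun y => by
          have : -(f t * y) * starRingEnd ℂ y = ((-f t : ℝ) : ℂ) * (y * starRingEnd ℂ y) := by
            push_cast; ring
          rw [this, mul_conj_eq, ← Complex.ofReal_mul, Complex.ofReal_re]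
        rw [e, one_mul, mul_conj_eq, Complex.ofReal_re]
        have := mul_le_mul_of_nonneg_right hf
          (sq_nonneg ‖Complex.exp (-r * t) * Y 0 t 2 - C * H t‖)
        linarith) ht
    rw [one_mul, mul_conj_eq, Complex.ofReal_re, hl.H_zero, one_mul, mul_conj_eq,
      Complex.ofReal_re] at hu
    have e0 : Complex.exp (-r * ((0 : ℝ) : ℂ)) * Y 0 0 2 - C * s = 0 := by
      rw [hC0]; simp
    rw [e0, norm_zero] at hu
    have h2 : ‖Complex.exp (-r * t) * Y 0 t 2 - C * H t‖ = 0 := by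
      refine pow_eq_zero_iff two_ne_zero |>.1 (le_antisymm ?_ (sq_nonneg _))
      simpa using hu
    exact sub_eq_zero.1 (norm_eq_zero.1 h2)
  refine ⟨C, ?_, fun t ht => ⟨hZ t ht, ?_, hW t ht⟩⟩
  -- The normalized third component is real and tends to `1`, while `H ≤ 0`; a nonnegative `C` would
  -- give the wrong sign for large `t`.
  · by_contra! hCn
    have l2 : Tendsto (fun t => (Y 0 t 2).re) atTop (𝓝 1) := by
      have := (Complex.continuous_re.tendsto _).comp (hlim 2)
      simpa [outflowVec, Function.comp_def] using this
    obtain ⟨t, ht, ht0⟩ := ((l2.eventually_const_lt one_pos).and (eventually_ge_atTop 0)).exists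
    have h1 := hW t ht0
    have hrr := hY.eig_real (b := 0) le_rfl
    rw [Complex.ofReal_zero, ← hr] at hrr
    have hyr := hY.real (b := 0) le_rfl 2 ht0
    rw [Complex.ofReal_zero] at hyr
    rw [hrr, hyr, ← Complex.ofReal_neg, ← Complex.ofReal_mul, ← Complex.ofReal_exp,
      ← Complex.ofReal_mul, ← Complex.ofReal_mul, Complex.ofReal_inj] at h1
    have h2 := mul_pos (Real.exp_pos (-r.re * t)) ht
    have h3 := mul_nonneg_of_nonpos_of_nonpos (neg_nonpos.2 hCn) (hl.H_nonpos t ht0)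
    linarith
  · have lv : Tendsto (fun t => (v t : ℂ)) atTop (𝓝 1) := by
      have := (Complex.continuous_ofReal.tendsto 1).comp (tendsto_of_decay hl.c_pos hl.decay_v)
      rwa [Complex.ofReal_one] at this
    have h1 := hconst (g := fun t : ℝ => Complex.exp (-r * t) * Y 0 t 1 - C * (v t - 1)) (L := 0)
      (fun t ht => by
        refine ((dX t ht).sub (((hl.deriv_v t ht).ofReal_comp.sub_const 1).const_mul
          (C : ℂ))).congr_deriv ?_
        rw [hW t ht]
        push_cast
        ring) (by simpa using l1.sub ((lv.sub_const 1).const_mul (C : ℂ))) t ht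
    exact sub_eq_zero.1 h1

/-- Both boundary terms are explicit, namely `C (v0 - 1)` and `C s / (0 - s) = -C`. -/
theorem reduced_zero (hl : OutflowLayer v f H dh h' s v0 ν B c C₁ C₂) {C : ℝ}
    (h : ∀ t : ℝ, 0 ≤ t → Complex.exp (-branchEig 1 h' T 0 * t) * Y 0 t 0 = 0 ∧
      Complex.exp (-branchEig 1 h' T 0 * t) * Y 0 t 1 = C * (v t - 1) ∧
      Complex.exp (-branchEig 1 h' T 0 * t) * Y 0 t 2 = C * H t) :
    reducedOutflow s Y 0 = ((C * (2 - v0) : ℝ) : ℂ) := by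
  obtain ⟨-, h1, h2⟩ := h 0 le_rfl
  have hsne : (s : ℂ) ≠ 0 := Complex.ofReal_ne_zero.2 hl.s_neg.ne
  simp [hl.init, hl.H_zero] at h1 h2
  rw [reducedOutflow, h1, h2]
  push_cast
  field_simp
  ring

/-- Only part of the exponential shift is undone: keeping a factor `e^{κ t}` with `κ = (1 - h') / 2
< Re r` still leaves a decaying solution and supplies the damping required by `OutflowSystem.key`.
The common exponential factor cancels in the resulting inequality. -/
theorem exists_radius (hl : OutflowLayer v f H dh h' s v0 ν B c C₁ C₂)
    (hY : IsOutflowLayerMode v f h' δ T Y) : ∃ Λ : ℝ, 0 < Λ ∧ ∀ z ∈ nonstable, Λ ≤ ‖z‖ →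
      ∀ t, 0 ≤ t → ‖(s + (v t - f t : ℝ)) * Y z t 1‖ <
        ‖z * Y z t 1 + Y z t 2 + (v t - f t : ℝ) * Y z t 1‖ := by
  have hh := hl.h'_nonneg
  have h1 := hl.h'_lt_one
  obtain ⟨Λ, hΛ, hkey⟩ := OutflowSystem.key (ν := ν) (B := B) (κ := (1 - h') / 2) hl.coeff.pos
    ((hl.coeff.le_v 0 le_rfl).trans (hl.coeff.v_le 0 le_rfl)) hl.coeff.one_le (by linarith)
    (by linarith)
  refine ⟨Λ, hΛ, fun z hz hzΛ t ht => ?_⟩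
  set r := branchEig 1 h' T z with hr
  have hrre : 1 - h' ≤ r.re := hY.branch.eig_re_ge_one_sub hh hz
  set ρ : ℂ := (((1 - h') / 2 : ℝ) : ℂ) - r with hρ
  have hρre : ρ.re < 0 := by
    rw [hρ, Complex.sub_re, Complex.ofReal_re]; linarith
  have hs := (hY.sol z hz).mul_exp ρ
  rw [← hr, hρ, add_sub_cancel, ← hρ] at hs
  have he : Tendsto (fun t : ℝ => Complex.exp (ρ * t)) atTop (𝓝 0) := tendsto_cexp_mul hρre
  have hlim := tendsto_pi_nhds.1 (hY.tendsto z hz)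
  have l0 := he.mul (hlim 0)
  have l1 := he.mul (hlim 1)
  have l2 := he.mul (hlim 2)
  rw [zero_mul] at l0 l1 l2
  have key := hkey _ _ _ z _ _ _ hl.coeff hz hzΛ hs.system l0 l1 l2 (fun X => by
    have h1 : ∀ᶠ t in atTop, Y z t 2 ≠ 0 := (hlim 2).eventually_ne (by simp [outflowVec])
    obtain ⟨t, ht, hXt⟩ := (h1.and (eventually_gt_atTop X)).exists
    exact ⟨t, hXt, fun h => ht (by simpa using h.2.2)⟩) t ht s hl.s_le
  have e1 : (s + (v t - f t : ℝ)) * (Complex.exp (ρ * t) * Y z t 1) =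
      Complex.exp (ρ * t) * ((s + (v t - f t : ℝ)) * Y z t 1) := by ring
  have e2 : z * (Complex.exp (ρ * t) * Y z t 1) + Complex.exp (ρ * t) * Y z t 2 +
      (v t - f t : ℝ) * (Complex.exp (ρ * t) * Y z t 1) =
      Complex.exp (ρ * t) * (z * Y z t 1 + Y z t 2 + (v t - f t : ℝ) * Y z t 1) := by ring
  rw [e1, e2, norm_mul (Complex.exp _), norm_mul (Complex.exp _)] at key
  exact lt_of_mul_lt_mul_left key (norm_nonneg _)

/-- With `U = (z + h) X + w`, one has `(z - s) g = -(U - (s + h) X)` at the boundary, so domination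
by `U` excludes zeros. For real `b` the function `U` has no zero and a positive limit, hence `U > 0`
at the boundary and `g b < 0`, matching the sign at `0`. -/
theorem evenRootCount (hl : OutflowLayer v f H dh h' s v0 ν B c C₁ C₂)
    (hY : IsOutflowLayerMode v f h' δ T Y) (h0 : (reducedOutflow s Y 0).re < 0) :
    EvenRootCount (reducedOutflow s Y) nonstable := by
  obtain ⟨b, hb, hkey⟩ := hY.exists_radius hl
  have hred : ∀ z ∈ nonstable, (z - s) * reducedOutflow s Y z =
      -(z * Y z 0 1 + Y z 0 2 + (v 0 - f 0 : ℝ) * Y z 0 1 -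
        (s + (v 0 - f 0 : ℝ)) * Y z 0 1) := fun z hz => by
    have := sub_ne_zero_of_neg hl.s_neg hz
    rw [reducedOutflow]
    field_simp
    ring
  refine evenRootCount_of_sign (hY.analyticOnNhd_reduced hl.s_neg)
    (fun z hz => hY.conj_reduced s hz) hb.le (fun z hz hL h => ?_) (mul_pos_of_neg_of_neg h0 ?_)
  · have h1 := hred z hz
    rw [h, mul_zero] at h1
    have h2 := sub_eq_zero.1 (neg_eq_zero.1 h1.symm)
    have h3 := hkey z hz hL 0 le_rfl
    rw [h2] at h3
    exact h3.false
  · have hbz : (b : ℂ) ∈ nonstable := by simpa [nonstable] using hb.le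
    have hbn : b ≤ ‖(b : ℂ)‖ := by rw [Complex.norm_real, Real.norm_of_nonneg hb.le]
    have hreal : ∀ t, 0 ≤ t → |(s + (v t - f t)) * (Y b t 1).re| <
        |b * (Y b t 1).re + (Y b t 2).re + (v t - f t) * (Y b t 1).re| := fun t ht => by
      have := hkey b hbz hbn t ht
      rw [hY.real hb.le 1 ht, hY.real hb.le 2 ht] at this
      have e1 : (s + (v t - f t : ℝ) : ℂ) * ((Y b t 1).re : ℂ) =
        (((s + (v t - f t)) * (Y b t 1).re : ℝ) : ℂ) := by push_cast; ring
      have e2 : (b : ℂ) * ((Y b t 1).re : ℂ) + ((Y b t 2).re : ℂ) +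
          (v t - f t : ℝ) * ((Y b t 1).re : ℂ) =
        ((b * (Y b t 1).re + (Y b t 2).re + (v t - f t) * (Y b t 1).re : ℝ) : ℂ) := by
        push_cast; ring
      rwa [e1, e2, Complex.norm_real, Complex.norm_real] at this
    have hrpos : 0 < (branchEig 1 h' T b).re :=
      hY.branch.eig_re_pos_of_lt_one hl.h'_nonneg hl.h'_lt_one hbz
    have hcv : ContinuousOn v (Ici 0) := fun t ht => (hl.deriv_v t ht).continuousWithinAt
    have hc1 : ContinuousOn (fun t => (Y b t 1).re) (Ici 0) :=
      Complex.continuous_re.comp_continuousOn fun t ht => ((hY.sol _ hbz).dX t ht).continuousWithinAt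
    have hc2 : ContinuousOn (fun t => (Y b t 2).re) (Ici 0) :=
      Complex.continuous_re.comp_continuousOn fun t ht => ((hY.sol _ hbz).dw t ht).continuousWithinAt
    have lr : ∀ i, Tendsto (fun t => (Y b t i).re) atTop (𝓝 (outflowVec h' T b i).re) := fun i =>
      (Complex.continuous_re.tendsto _).comp (tendsto_pi_nhds.1 (hY.tendsto _ hbz) i)
    have lv := tendsto_of_decay hl.c_pos hl.decay_v
    have lf := tendsto_of_decay hl.c_pos hl.decay_f
    have e1 : (outflowVec h' T b 1).re = 1 / (branchEig 1 h' T b).re := by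
      have : outflowVec h' T b 1 = ((1 / (branchEig 1 h' T b).re : ℝ) : ℂ) := by
        simp only [outflowVec, Matrix.cons_val]
        rw [hY.eig_real hb.le]
        push_cast
        rfl
      rw [this, Complex.ofReal_re]
    have hlim : Tendsto (fun t => b * (Y b t 1).re + (Y b t 2).re + (v t - f t) * (Y b t 1).re)
        atTop (𝓝 (b * (1 / (branchEig 1 h' T b).re) + 1 +
          (1 - (1 - h')) * (1 / (branchEig 1 h' T b).re))) := by
      have := (((lr 1).const_mul b).add (lr 2)).add ((lv.sub lf).mul (lr 1))
      rw [e1] at this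
      simpa [outflowVec] using this
    have hU := pos_of_tendsto_pos
      (((continuousOn_const.mul hc1).add hc2).add ((hcv.sub hl.cont_f).mul hc1)) (fun t ht h => by
        have h2 := hreal t ht
        have h3 : b * (Y b t 1).re + (Y b t 2).re + (v t - f t) * (Y b t 1).re = 0 := h
        rw [h3, abs_zero] at h2
        exact (abs_nonneg _).not_gt h2)
      (by
        have h2 : 0 < 1 / (branchEig 1 h' T b).re := by positivity
        have h3 := mul_nonneg hl.h'_nonneg h2.le
        have h4 := mul_pos hb h2
        have e : 1 - (1 - h') = h' := by ring
        rw [e]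
        linarith) hlim le_rfl
    have hU' : 0 < b * (Y b 0 1).re + (Y b 0 2).re + (v 0 - f 0) * (Y b 0 1).re := hU
    have h2 := hreal 0 le_rfl
    rw [abs_of_pos hU'] at h2
    have h3 := (le_abs_self _).trans_lt h2
    have h4 := hred b hbz
    rw [hY.real hb.le 1 le_rfl, hY.real hb.le 2 le_rfl] at h4
    have h5 := congrArg Complex.re h4
    rw [← Complex.ofReal_sub, Complex.re_ofReal_mul] at h5
    have e2 : (-((b : ℂ) * ((Y b 0 1).re : ℂ) + ((Y b 0 2).re : ℂ) +
        (v 0 - f 0 : ℝ) * ((Y b 0 1).re : ℂ) -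
        (s + (v 0 - f 0 : ℝ)) * ((Y b 0 1).re : ℂ))).re =
        -(b * (Y b 0 1).re + (Y b 0 2).re + (v 0 - f 0) * (Y b 0 1).re -
          (s + (v 0 - f 0)) * (Y b 0 1).re) := by
      simp
    rw [e2] at h5
    have hbs : 0 < b - s := by linarith [hl.s_neg]
    by_contra! hge
    have := mul_nonneg hbs.le hge
    linarith

end IsOutflowLayerMode

end BoundaryLayer

end

/-! ### From the outflow mode to the outflow Evans functions -/

noncomputable section

namespace BoundaryLayer

/-- The eigenvector of the limiting matrix in the original variables. -/
def eigenVec (h : ℝ) (T : ℂ → ℂ) (z : ℂ) : Fin 3 → ℂ :=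
  ![outflowVec h T z 0 - z * outflowVec h T z 1, z * outflowVec h T z 1, 1]

theorem pairing_outflow (s : ℝ) (z : ℂ) (W : Fin 3 → ℂ) :
    pairing W ![0, -1, -(star z / (star z - (s : ℂ)))] = -(W 1 + W 2 * (z / (z - s))) := by
  simp [pairing, dotProduct, Fin.sum_univ_three]
  ring

section
variable {vh fc H dh : ℝ → ℝ} {h' s v0 ν B c C₁ C₂ δ : ℝ} {T : ℂ → ℂ} {Y : ℂ → ℝ → Fin 3 → ℂ}

/-- Dividing the mode by the constant `C` found at `z = 0` makes it equal there to `(0, 0, H)`,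
which is the normalization in the statement. -/
theorem exists_isOutflowEvans
    (hl : OutflowLayer (fun t => vh (-t)) (fun t => fc (vh (-t))) H dh h' s v0 ν B c C₁ C₂)
    (hf : fc 1 = 1 - h')
    (hY : IsOutflowLayerMode (fun t => vh (-t)) (fun t => fc (vh (-t))) h' δ T Y) :
    ∃ W D, IsOutflowEvans vh fc s W D ∧ ∀ x ≤ 0, W 0 x = ![0, 0, (H (-x) : ℂ)] := by
  obtain ⟨C, hC, hCe⟩ := hY.exists_eq_at_zero hl
  have hC0 : (C : ℂ) ≠ 0 := Complex.ofReal_ne_zero.2 hC.ne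
  have hb := hY.branch
  have hne : ∀ z ∈ nonstable, branchEig 1 h' T z ≠ 0 := fun z hz =>
    hb.eig_ne_zero hl.h'_nonneg hl.h'_lt_one hz
  let U : ℂ → ℝ → Fin 3 → ℂ := fun z t i =>
    (C : ℂ)⁻¹ * (Complex.exp (-branchEig 1 h' T z * t) * Y z t i)
  have hU : ∀ z t i, U z t i = (C : ℂ)⁻¹ * (Complex.exp (-branchEig 1 h' T z * t) * Y z t i) :=
    fun z t i => rfl
  have hUs : ∀ z ∈ nonstable, ShiftedOutflow (fun t => vh (-t)) (fun t => fc (vh (-t))) z 0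
      (fun t => U z t 0) (fun t => U z t 1) (fun t => U z t 2) := fun z hz => by
    have := ((hY.sol z hz).mul_exp (-branchEig 1 h' T z)).const_mul (C : ℂ)⁻¹
    rwa [add_neg_cancel] at this
  refine ⟨fun z x => ![U z (-x) 0 - z * U z (-x) 1, z * U z (-x) 1, U z (-x) 2],
    fun z => z * (C : ℂ)⁻¹ * reducedOutflow s Y z,
    ⟨fun z hz => (analyticAt_id.mul analyticAt_const).mul
      (hY.analyticOnNhd_reduced hl.s_neg z hz),
      ⟨branchEig 1 h' T, fun z => (C : ℂ)⁻¹ • eigenVec h' T z, fun z hz => ?_,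
        fun z hz => ⟨?_, ?_, ?_, ?_, ?_⟩⟩, fun z hz => ?_⟩, fun x hx => ?_⟩
  · have h := analyticAt_pi_iff.1 (hb.analyticAt_outflowVec (hb.lt_re hz) (hne z hz))
    have h3 : AnalyticAt ℂ (eigenVec h' T) z := by
      refine analyticAt_pi_iff.2 fun i => ?_
      fin_cases i
      · exact (h 0).sub (analyticAt_id.mul (h 1))
      · exact analyticAt_id.mul (h 1)
      · exact analyticAt_const
    exact (analyticAt_const (v := (C : ℂ)⁻¹)).smul h3
  · intro h0
    have := congrFun h0 2
    simp [eigenVec, hC0] at this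
  · exact hb.eig_re_pos_of_lt_one hl.h'_nonneg hl.h'_lt_one hz
  · have hr := hne z hz
    have hev := hb.outflowMat_mulVec_outflowVec (hb.lt_re hz) hr
    rw [outflowVec, outflowMat_mulVec] at hev
    have g1 := congrFun hev 0
    have g2 := congrFun hev 1
    have g3 := congrFun hev 2
    simp only [Matrix.cons_val, Pi.zero_apply] at g1 g2 g3
    rw [Matrix.mulVec_smul, smul_comm, hf, coeffMatrix_mulVec]
    congr 1
    simp only [eigenVec, outflowVec]
    set r := branchEig 1 h' T z
    funext i
    fin_cases i
    · simp only [Fin.zero_eta, Matrix.cons_val, Pi.smul_apply, smul_eq_mul]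
      linear_combination -g1 + z * g2
    · simp only [Fin.mk_one, Matrix.cons_val, Pi.smul_apply, smul_eq_mul]
      linear_combination -z * g2
    · simp only [Fin.reduceFinMk, Matrix.cons_val, Pi.smul_apply, smul_eq_mul]
      push_cast at g3 ⊢
      linear_combination -g3
  · exact (hUs z hz).solvesEigen
  · have hlim := tendsto_pi_nhds.1 (hY.tendsto z hz)
    have l0 := ((hlim 0).sub ((hlim 1).const_mul z)).const_mul (C : ℂ)⁻¹
    have l1 := ((hlim 1).const_mul z).const_mul (C : ℂ)⁻¹
    have l2 := (hlim 2).const_mul (C : ℂ)⁻¹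
    have hl3 : Tendsto (fun t => ![(C : ℂ)⁻¹ * (Y z t 0 - z * Y z t 1), (C : ℂ)⁻¹ * (z * Y z t 1),
        (C : ℂ)⁻¹ * Y z t 2]) atTop (𝓝 ((C : ℂ)⁻¹ • eigenVec h' T z)) := by
      have e : (C : ℂ)⁻¹ • eigenVec h' T z = ![(C : ℂ)⁻¹ * (outflowVec h' T z 0 -
          z * outflowVec h' T z 1), (C : ℂ)⁻¹ * (z * outflowVec h' T z 1),
          (C : ℂ)⁻¹ * outflowVec h' T z 2] := by
        funext i
        fin_cases i <;> simp [eigenVec, outflowVec]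
      rw [e]
      exact tendsto_vec3.2 ⟨l0, l1, l2⟩
    refine (hl3.comp tendsto_neg_atBot_atTop).congr fun x => ?_
    have he : Complex.exp (-(branchEig 1 h' T z * x)) *
        Complex.exp (-branchEig 1 h' T z * (-x : ℝ)) = 1 := by
      rw [← Complex.exp_add]; simp
    funext i
    fin_cases i
    · simp only [Function.comp_apply, Fin.zero_eta, Matrix.cons_val, Pi.smul_apply, smul_eq_mul, hU]
      linear_combination (-(C : ℂ)⁻¹ * (Y z (-x) 0 - z * Y z (-x) 1)) * he
    · simp only [Function.comp_apply, Fin.mk_one, Matrix.cons_val, Pi.smul_apply, smul_eq_mul, hU]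
      linear_combination (-(C : ℂ)⁻¹ * (z * Y z (-x) 1)) * he
    · simp only [Function.comp_apply, Fin.reduceFinMk, Matrix.cons_val, Pi.smul_apply, smul_eq_mul,
        hU]
      linear_combination (-(C : ℂ)⁻¹ * Y z (-x) 2) * he
  · rw [pairing_outflow]
    change z * (C : ℂ)⁻¹ * reducedOutflow s Y z = _
    simp only [reducedOutflow, Matrix.cons_val, hU, neg_zero, Complex.ofReal_zero, mul_zero, Complex.exp_zero,
      one_mul]
    ring
  · have hx' : 0 ≤ -x := by linarith
    obtain ⟨h0, h1, h2⟩ := hCe (-x) hx'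
    funext i
    fin_cases i
    · simp only [Fin.zero_eta, Matrix.cons_val, hU]
      rw [h0]
      simp
    · simp
    · simp only [Fin.reduceFinMk, Matrix.cons_val, hU]
      rw [h2]
      field_simp

/-- Any admissible mode is the standard one times the third component of its eigenvector, which
never vanishes. Hence `D = z * V₃ * g` off the origin, and the simple zero, its derivative and the
parity are read off from `g`. -/
theorem IsOutflowEvans.properties
    (hl : OutflowLayer (fun t => vh (-t)) (fun t => fc (vh (-t))) H dh h' s v0 ν B c C₁ C₂)
    (hf : fc 1 = 1 - h')
    (hY : IsOutflowLayerMode (fun t => vh (-t)) (fun t => fc (vh (-t))) h' δ T Y)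
    {W : ℂ → ℝ → Fin 3 → ℂ} {D : ℂ → ℂ} (hD : IsOutflowEvans vh fc s W D) :
    deriv D 0 ≠ 0 ∧
      ((∀ x ≤ 0, W 0 x = ![0, 0, (H (-x) : ℂ)]) → deriv D 0 = 2 - (v0 : ℂ)) ∧
      EvenRootCount D (nonstable \ {0}) := by
  obtain ⟨hDa, ⟨μ, V, hV, hmode⟩, hDz⟩ := hD
  obtain ⟨C, hC, hCe⟩ := hY.exists_eq_at_zero hl
  have hb := hY.branch
  have hne : ∀ z ∈ nonstable, branchEig 1 h' T z ≠ 0 := fun z hz =>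
    hb.eig_ne_zero hl.h'_nonneg hl.h'_lt_one hz
  have hcub : ∀ z ∈ nonstable, V z 2 ≠ 0 ∧ μ z = branchEig 1 h' T z ∧
      μ z * V z 1 = z * V z 2 ∧ μ z * V z 0 = z * (V z 1 + V z 2) := fun z hz => by
    obtain ⟨hV0, hμ, hev, -⟩ := hmode z hz
    have hμ0 : μ z ≠ 0 := fun h => by rw [h] at hμ; simp at hμ
    rw [hf] at hev
    obtain ⟨h2, hc, h3, h4⟩ := cubic_of_eigenvector hμ0 hev hV0
    exact ⟨h2, hb.eq_of_root hz hμ hc, h3, h4⟩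
  have hca : AnalyticOnNhd ℂ (fun z => V z 2) nonstable := fun z hz =>
    analyticAt_pi_iff.1 (hV z hz) 2
  have hga := hY.analyticOnNhd_reduced hl.s_neg
  have hexp : ∀ z (r : ℂ) (t : ℝ), Complex.exp (-(r * (-t : ℝ))) • W z (-t) =
      Complex.exp (r * t) • W z (-t) := fun z r t => by
    congr 2
    push_cast
    ring
  have hlimV : ∀ z ∈ nonstable, Tendsto (fun t : ℝ => Complex.exp (branchEig 1 h' T z * t) •
      W z (-t)) atTop (𝓝 (V z)) := fun z hz => by
    have := (hmode z hz).2.2.2.2.comp tendsto_neg_atTop_atBot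
    rw [(hcub z hz).2.1] at this
    exact this.congr fun t => hexp z _ t
  have key : EqOn D (fun z => z * V z 2 * reducedOutflow s Y z) (nonstable \ {0}) := by
    rintro z ⟨hz, hz0⟩
    have hz0' : z ≠ 0 := hz0
    obtain ⟨h2, hμr, h3, h4⟩ := hcub z hz
    have hr := hne z hz
    rw [hμr] at h3 h4
    have hsol := ((hmode z hz).2.2.2.1.shifted hz0').mul_exp (branchEig 1 h' T z)
    rw [zero_add] at hsol
    have hlim := tendsto_pi_nhds.1 (hlimV z hz)
    simp only [Pi.smul_apply, smul_eq_mul] at hlim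
    have hu := hY.unique z hz (V z 2)
      (fun t => ![Complex.exp (branchEig 1 h' T z * t) * (W z (-t) 0 + W z (-t) 1),
        Complex.exp (branchEig 1 h' T z * t) * (W z (-t) 1 / z),
        Complex.exp (branchEig 1 h' T z * t) * W z (-t) 2]) hsol (by
        have e : V z 2 • outflowVec h' T z = ![V z 0 + V z 1, V z 1 / z, V z 2] := by
          set r := branchEig 1 h' T z with hrdef
          funext i
          fin_cases i
          · simp only [outflowVec, Fin.zero_eta, Matrix.cons_val, Pi.smul_apply, smul_eq_mul,
              ← hrdef]
            field_simp
            linear_combination (-(z + r)) * h3 - r * h4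
          · simp only [outflowVec, Fin.mk_one, Matrix.cons_val, Pi.smul_apply, smul_eq_mul,
              ← hrdef]
            field_simp
            linear_combination -h3
          · simp [outflowVec]
        rw [e]
        refine tendsto_vec3.2 ⟨?_, ?_, hlim 2⟩
        · exact ((hlim 0).add (hlim 1)).congr fun t => (mul_add _ _ _).symm
        · exact ((hlim 1).div_const z).congr fun t => (mul_div_assoc _ _ _)) 0 le_rfl
    have u1 := congrFun hu 1
    have u2 := congrFun hu 2
    simp only [Matrix.cons_val, Complex.ofReal_zero, mul_zero, Complex.exp_zero, neg_zero, one_mul,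
      Pi.smul_apply, smul_eq_mul] at u1 u2
    rw [div_eq_iff hz0'] at u1
    rw [hDz z hz, pairing_outflow, u1, u2]
    change _ = z * V z 2 * reducedOutflow s Y z
    rw [reducedOutflow]
    ring
  have hg0 := IsOutflowLayerMode.reduced_zero hl hCe
  have hv2 : 0 < 2 - v0 := by linarith [hl.init_lt]
  have hgneg : C * (2 - v0) < 0 := mul_neg_of_neg_of_pos hC hv2
  have hgne : reducedOutflow s Y 0 ≠ 0 := by
    rw [hg0, Complex.ofReal_ne_zero]; exact hgneg.ne
  have hderiv := deriv_eq_of_factor hga hDa hca key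
  have hz := zero_mem_nonstable
  refine ⟨by rw [hderiv]; exact mul_ne_zero (hcub 0 hz).1 hgne, fun hW => ?_, ?_⟩
  -- The normalization gives `e^{r t} H → V₃`, while the standard mode gives `C e^{r t} H → 1`. Thus
  -- `C V₃ = 1`, and `C` cancels in `V₃ * C * (2 - v0)`.
  · have l1 : Tendsto (fun t : ℝ => Complex.exp (branchEig 1 h' T 0 * t) * (H t : ℂ)) atTop
        (𝓝 (V 0 2)) := by
      refine (tendsto_pi_nhds.1 (hlimV 0 hz) 2).congr' ?_
      filter_upwards [eventually_ge_atTop 0] with t ht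
      rw [hW (-t) (by linarith)]
      simp
    have l2 : Tendsto (fun t : ℝ => (C : ℂ) * (Complex.exp (branchEig 1 h' T 0 * t) * (H t : ℂ)))
        atTop (𝓝 1) := by
      have h3 : Tendsto (fun t => Y 0 t 2) atTop (𝓝 1) := by
        simpa [outflowVec] using tendsto_pi_nhds.1 (hY.tendsto 0 hz) 2
      refine h3.congr' ?_
      filter_upwards [eventually_ge_atTop 0] with t ht
      have h4 := (hCe t ht).2.2
      have he : Complex.exp (branchEig 1 h' T 0 * t) *
          Complex.exp (-branchEig 1 h' T 0 * t) = 1 := by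
        rw [← Complex.exp_add]; simp
      linear_combination (Complex.exp (branchEig 1 h' T 0 * t)) * h4 - Y 0 t 2 * he
    have h5 := tendsto_nhds_unique (l1.const_mul (C : ℂ)) l2
    rw [hderiv, hg0]
    push_cast
    linear_combination (2 - (v0 : ℂ)) * h5
  · refine EvenRootCount.of_factor hga hDa (a := fun z => z * V z 2)
      (fun z hz => analyticAt_id.mul (hca z hz))
      (fun z hz => mul_ne_zero hz.2 (hcub z hz.1).1) key hgne (hY.evenRootCount hl ?_)
    rw [hg0, Complex.ofReal_re]
    exact hgneg

theorem OutflowLayer.evans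
    (hl : OutflowLayer (fun t => vh (-t)) (fun t => fc (vh (-t))) H dh h' s v0 ν B c C₁ C₂)
    (hf : fc 1 = 1 - h') :
    (∃ W D, IsOutflowEvans vh fc s W D ∧ ∀ x ≤ 0, W 0 x = ![0, 0, (H (-x) : ℂ)]) ∧
      ∀ W D, IsOutflowEvans vh fc s W D → deriv D 0 ≠ 0 ∧
        ((∀ x ≤ 0, W 0 x = ![0, 0, (H (-x) : ℂ)]) → deriv D 0 = 2 - (v0 : ℂ)) ∧
        EvenRootCount D (nonstable \ {0}) := by
  obtain ⟨δ, T, Y, hY⟩ := hl.exists_mode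
  exact ⟨exists_isOutflowEvans hl hf hY, fun W D hD => hD.properties hl hf hY⟩

end

/-! ### Outflow layers -/

theorem IsOutflowProfile.exists_outflowLayer {γ vp v0 : ℝ} {v : ℝ → ℝ} (hγ : 1 ≤ γ) (h0 : 0 < vp)
    (hv : vp < v0) (hv1 : v0 < 1) (hp : IsOutflowProfile γ vp v0 v) :
    ∃ dh B c C₁ C₂, OutflowLayer (fun t => v (-t)) (fun t => fCoeff γ vp (v (-t)))
      (fun t => profileRHS γ vp (v (-t))) dh (hCoeff γ vp 1) (profileRHS γ vp v0) v0 v0 B c C₁ C₂ := by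
  have h1 := hv.trans hv1
  have hv0 := h0.trans hv
  have hm := fun t (ht : 0 ≤ t) => hp.mem hγ h0 hv hv1 (t := t) ht
  have hpos := fun t (ht : 0 ≤ t) => hv0.trans_le (hm t ht).1
  have ha := pressureConst_pos hγ h0 h1
  have hd := fun t (ht : t ∈ Ici (0 : ℝ)) => hp.hasDerivWithinAt_comp_neg ht
  obtain ⟨c, hc, hdec⟩ := hp.exists_decay hγ h0 hv hv1
  obtain ⟨C, hC1, hC⟩ := exists_abs_hCoeffDeriv_le γ vp hv0
  obtain ⟨B, hB1, hB⟩ := exists_hCoeff_le γ vp hv0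
  obtain ⟨K, hK⟩ := (isCompact_Icc (a := v0) (b := 1)).exists_bound_of_continuousOn
    (f := profileRHS γ vp)
    fun y hy => (hasDerivAt_profileRHS γ vp (hv0.trans_le hy.1)).continuousAt.continuousWithinAt
  have hK0 : 0 ≤ K := (norm_nonneg _).trans (hK v0 ⟨le_rfl, hv1.le⟩)
  have hCK : 0 ≤ C * K := mul_nonneg (by linarith) hK0
  have hh0 := fun t (ht : 0 ≤ t) =>
    (mul_pos ha (by linarith : 0 < γ)).le.trans (le_hCoeff hγ h0 h1 (hpos t ht) (hm t ht).2)
  have hle1 : hCoeff γ vp 1 < 1 := hCoeff_one γ vp ▸ pressureConst_mul_lt_one hγ h0 h1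
  -- One constant serves three bounds: `h ≤ B`, `|h' + v h| ≤ C K + B` and `|s| ≤ K`.
  refine ⟨fun t => hCoeffDeriv γ vp (v (-t)) * -profileRHS γ vp (v (-t)), B + C * K + K, c, 1,
    (1 + C) * 1, ?_⟩
  exact
    { coeff :=
        { pos := hv0
          one_le := by linarith
          le_v := fun t ht => (hm t ht).1
          v_le := fun t ht => (hm t ht).2
          h_nonneg := hh0
          h_le := fun t ht => by
            have : hCoeff γ vp (v (-t)) ≤ B := hB _ (hm t ht)
            change hCoeff γ vp (v (-t)) ≤ _
            linarith
          deriv_le := fun t ht => by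
            have b1 : |hCoeffDeriv γ vp (v (-t)) * -profileRHS γ vp (v (-t))| ≤ C * K := by
              rw [abs_mul, abs_neg]
              exact mul_le_mul (hC _ (hm t ht)) (hK _ (hm t ht)) (abs_nonneg _) (by linarith)
            have b2 : |v (-t) * hCoeff γ vp (v (-t))| ≤ B := by
              rw [abs_of_nonneg (mul_nonneg (hpos t ht).le (hh0 t ht))]
              exact (mul_le_of_le_one_left (hh0 t ht) (hm t ht).2).trans (hB _ (hm t ht))
            refine (abs_sub _ _).trans ?_
            rw [abs_neg]
            change _ + |v (-t) * hCoeff γ vp (v (-t))| ≤ _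
            linarith
          deriv := fun t ht =>
            HasDerivAt.comp_hasDerivWithinAt (h := fun t => v (-t)) (h₂ := hCoeff γ vp) t
              (hasDerivAt_hCoeff γ vp (hpos t ht)) (hd t ht) }
      c_pos := hc
      h'_nonneg := by
        rw [hCoeff_one]
        exact mul_nonneg ha.le (by linarith)
      h'_lt_one := hle1
      init := by
        rw [neg_zero, hp.init]
      init_lt := hv1
      s_neg := mul_neg_of_pos_of_neg hv0 (profileRate_neg hγ h0 hv hv1)
      s_le := by
        have : |profileRHS γ vp v0| ≤ K := hK v0 ⟨le_rfl, hv1.le⟩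
        linarith
      H_zero := by
        rw [neg_zero, hp.init]
      H_nonpos := fun t ht => by
        refine mul_nonpos_of_nonneg_of_nonpos (hpos t ht).le ?_
        obtain ⟨κ, hκ, hle⟩ := exists_profileRate_le_right hγ h0 hv hv1
        have h3 := hle _ (hm t ht).1 (hm t ht).2
        have h4 := mul_nonneg hκ.le (sub_nonneg.2 (hm t ht).2)
        change profileRate γ vp (v (-t)) ≤ 0
        linarith
      deriv_v := hd
      deriv_H := fun t ht =>
        (HasDerivAt.comp_hasDerivWithinAt (h := fun t => v (-t)) (h₂ := profileRHS γ vp) t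
          (hasDerivAt_profileRHS γ vp (hpos t ht)) (hd t ht)).congr_deriv (by ring)
      cont_f := fun t ht =>
        (hasDerivAt_fCoeff γ vp (hpos t ht)).continuousAt.comp_continuousWithinAt
          (f := fun t => v (-t)) (hd t ht).continuousWithinAt
      decay_v := hdec
      decay_f := fun t ht => by
        have e : 1 - hCoeff γ vp 1 = fCoeff γ vp 1 := sub_sub_cancel _ _
        rw [e, mul_assoc]
        refine (abs_fCoeff_sub_le hv0 hC ⟨hv1.le, le_rfl⟩ (hm t ht)).trans ?_
        exact mul_le_mul_of_nonneg_left (hdec t ht) (by linarith) }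

/-- Here `h = 1 - v`, so its limit is `0` and `-dh - v h` vanishes identically; the constant `B = 1`
suffices. -/
theorem outflowLayer_limitProfile {v0 : ℝ} (h0 : 0 < v0) (h1 : v0 < 1) :
    OutflowLayer (fun t => limitProfile v0 (-t)) (fun t => fCoeffLimit (limitProfile v0 (-t)))
      (fun t => limitProfile v0 (-t) * (limitProfile v0 (-t) - 1))
      (fun t => limitProfile v0 (-t) * (limitProfile v0 (-t) - 1)) 0 (v0 * (v0 - 1)) v0 v0 1 1
      ((1 - v0) / v0) (2 * ((1 - v0) / v0)) := by
  have hpos := limitProfile_pos h0 h1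
  have hlt := limitProfile_lt_one h0 h1
  have hd : ∀ t : ℝ, HasDerivAt (fun t => limitProfile v0 (-t))
      (-(limitProfile v0 (-t) * (limitProfile v0 (-t) - 1))) t := fun t => by
    have := (hasDerivAt_limitProfile h0 h1 (-t)).scomp t (hasDerivAt_neg t)
    simpa [Function.comp_def] using this
  have hge : ∀ t : ℝ, 0 ≤ t → v0 ≤ limitProfile v0 (-t) := fun t ht => by
    have h2 : 0 < 1 - v0 := by linarith
    have h3 : Real.exp (-t) ≤ 1 := Real.exp_le_one_iff.2 (by linarith)
    have h4 := mul_le_mul_of_nonneg_left h3 h2.le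
    have h5 := mul_pos h2 (Real.exp_pos (-t))
    rw [limitProfile_eq h0 h1, le_div_iff₀ (by linarith)]
    exact mul_le_of_le_one_right h0.le (by linarith)
  have hdec : ∀ t : ℝ, |limitProfile v0 (-t) - 1| ≤ (1 - v0) / v0 * Real.exp (-1 * t) := fun t => by
    rw [abs_sub_comm, abs_of_pos (by linarith [hlt (-t)]), neg_one_mul]
    exact one_sub_limitProfile_le h0 h1 (-t)
  have hH : ∀ t : ℝ, limitProfile v0 (-t) * (limitProfile v0 (-t) - 1) ≤ 0 := fun t =>
    mul_nonpos_of_nonneg_of_nonpos (hpos _).le (by linarith [hlt (-t)])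
  exact
    { coeff :=
        { pos := h0
          one_le := le_rfl
          le_v := hge
          v_le := fun t _ => (hlt _).le
          h_nonneg := fun t _ => by
            simp only [fCoeffLimit]; linarith [hlt (-t)]
          h_le := fun t _ => by
            simp only [fCoeffLimit]; linarith [hpos (-t)]
          deriv_le := fun t _ => by
            have : -(limitProfile v0 (-t) * (limitProfile v0 (-t) - 1)) - limitProfile v0 (-t) *
              (limitProfile v0 (-t) - fCoeffLimit (limitProfile v0 (-t))) = 0 := by
              rw [fCoeffLimit]; ring
            rw [this, abs_zero]; exact zero_le_one
          deriv := fun t _ => by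
            refine ((((hd t).const_sub 1).congr_of_eventuallyEq
              (Eventually.of_forall fun y => ?_)).congr_deriv (neg_neg _)).hasDerivWithinAt
            simp only [fCoeffLimit]; ring }
      c_pos := one_pos
      h'_nonneg := le_rfl
      h'_lt_one := one_pos
      init := by
        rw [neg_zero, limitProfile_zero h0 h1]
      init_lt := h1
      s_neg := mul_neg_of_pos_of_neg h0 (by linarith)
      s_le := by
        rw [abs_le]
        constructor <;> nlinarith
      H_zero := by
        rw [neg_zero, limitProfile_zero h0 h1]
      H_nonpos := fun t _ => hH t
      deriv_v := fun t _ => (hd t).hasDerivWithinAt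
      deriv_H := fun t _ => by
        refine ((hd t).mul ((hd t).sub_const 1)).hasDerivWithinAt.congr_deriv ?_
        rw [fCoeffLimit]; ring
      cont_f := fun t _ => by
        have : ContinuousAt (fun t => 2 * limitProfile v0 (-t) - 1) t :=
          ((hd t).continuousAt.const_mul 2).sub_const 1
        exact this.continuousWithinAt
      decay_v := fun t _ => hdec t
      decay_f := fun t _ => by
        have e : fCoeffLimit (limitProfile v0 (-t)) - (1 - 0) = 2 * (limitProfile v0 (-t) - 1) := by
          rw [fCoeffLimit]; ring
        rw [e, abs_mul, abs_two, mul_assoc]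
        exact mul_le_mul_of_nonneg_left (hdec t) zero_le_two }

end BoundaryLayer

end

/-! ### The stability index lemma -/

theorem lemma3p4 :
    -- inflow
    (∀ (γ vp v0 : ℝ) (v : ℝ → ℝ), 1 ≤ γ → 0 < vp → vp ≤ v0 → v0 < 1 →
      BoundaryLayer.IsInflowProfile γ vp v0 v →
        (∃ D, BoundaryLayer.IsInflowEvans γ vp v D) ∧
        ∀ D, BoundaryLayer.IsInflowEvans γ vp v D →
          D 0 ≠ 0 ∧ BoundaryLayer.EvenRootCount D BoundaryLayer.nonstable) ∧
    -- limiting inflow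
    (∀ v0 : ℝ, 0 < v0 → v0 < 1 →
      (∃ D, BoundaryLayer.IsLimitInflowEvans v0 D) ∧
      ∀ D, BoundaryLayer.IsLimitInflowEvans v0 D →
        D 0 = 0 ∧ deriv D 0 ≠ 0 ∧
        BoundaryLayer.EvenRootCount D (BoundaryLayer.nonstable \ {0})) ∧
    -- limiting inflow, as the boundary value tends to zero
    (∀ D : ℝ → ℂ → ℂ,
      (∀ v0 : ℝ, 0 < v0 → v0 < 1 → BoundaryLayer.IsLimitInflowEvans v0 (D v0)) →
      ∀ z ∈ BoundaryLayer.nonstable, Tendsto (fun v0 => D v0 z) (𝓝[>] 0) (𝓝 0)) ∧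
    -- outflow
    (∀ (γ vp v0 : ℝ) (v : ℝ → ℝ), 1 ≤ γ → 0 < vp → vp < v0 → v0 < 1 →
      BoundaryLayer.IsOutflowProfile γ vp v0 v →
        (∃ W D, BoundaryLayer.IsOutflowEvans v (BoundaryLayer.fCoeff γ vp)
            (BoundaryLayer.profileRHS γ vp v0) W D ∧
          ∀ x ≤ 0, W 0 x = ![0, 0, (BoundaryLayer.profileRHS γ vp (v x) : ℂ)]) ∧
        ∀ W D, BoundaryLayer.IsOutflowEvans v (BoundaryLayer.fCoeff γ vp)
            (BoundaryLayer.profileRHS γ vp v0) W D →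
          deriv D 0 ≠ 0 ∧
          ((∀ x ≤ 0, W 0 x = ![0, 0, (BoundaryLayer.profileRHS γ vp (v x) : ℂ)]) →
            deriv D 0 = 2 - (v0 : ℂ)) ∧
          BoundaryLayer.EvenRootCount D (BoundaryLayer.nonstable \ {0})) ∧
    -- limiting outflow
    (∀ v0 : ℝ, 0 < v0 → v0 < 1 →
      (∃ W D, BoundaryLayer.IsOutflowEvans (BoundaryLayer.limitProfile v0)
          BoundaryLayer.fCoeffLimit (v0 * (v0 - 1)) W D) ∧
      ∀ W D, BoundaryLayer.IsOutflowEvans (BoundaryLayer.limitProfile v0)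
          BoundaryLayer.fCoeffLimit (v0 * (v0 - 1)) W D →
        deriv D 0 ≠ 0 ∧
        BoundaryLayer.EvenRootCount D (BoundaryLayer.nonstable \ {0})) := by
  refine ⟨fun γ vp v0 v hγ h0 hv hv1 hp => hp.evans hγ h0 hv hv1,
    fun v0 h0 h1 => BoundaryLayer.limitInflow_evans h0 h1,
    fun D hD z hz => BoundaryLayer.tendsto_limitInflowEvans hD hz,
    fun γ vp v0 v hγ h0 hv hv1 hp => ?_, fun v0 h0 h1 => ?_⟩
  · obtain ⟨dh, B, c, C₁, C₂, hl⟩ := hp.exists_outflowLayer hγ h0 hv hv1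
    simpa only [neg_neg] using hl.evans (sub_sub_cancel _ _).symm
  · obtain ⟨⟨W, D, hD, -⟩, h⟩ := (BoundaryLayer.outflowLayer_limitProfile h0 h1).evans
      (by norm_num [BoundaryLayer.fCoeffLimit])
    exact ⟨⟨W, D, hD⟩, fun W D hD => ⟨(h W D hD).1, (h W D hD).2.2⟩⟩
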